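/- Let $\mathbb K=\mathbb R$ or $\mathbb C$, let $\mathfrak g$ be a finite-dimensional Lie algebra over $\mathbb K$, and let $\mathfrak g=\mathfrak l\oplus\mathfrak m$ be a reductive decomposition, i.e. $\mathfrak l$ is a Lie subalgebra with inclusion $i:\mathfrak l\to\mathfrak g$, $\mathfrak m$ is a vector space complement of $\mathfrak l$, and $[\mathfrak l,\mathfrak m]\subset\mathfrak m$. Stars denote transposes; in particular $\langle \mathrm{ad}^*_x\xi,y\rangle=\langle\xi,[x,y]\rangle$. The symbol $\circlearrowleft_{(\xi,\eta,\zeta)}$ means the sum over cyclic permutations of $(\xi,\eta,\zeta)$. Let $\mathcal G=(\mathfrak g,[\,,],\varpi,\varphi)$ be a Lie quasi-bialgebra: $\varpi$ is a linear map from $\mathfrak g$ to the skew-symmetric linear maps $\mathfrak g^*\to\mathfrak g$ with $\varpi_{[x,y]}=\mathrm{ad}_x\varpi_y+\varpi_y\mathrm{ad}^*_x-\mathrm{ad}_y\varpi_x-\varpi_x\mathrm{ad}^*_y$, $\varphi\in\wedge^3\mathfrak g$, and $\mathfrak g\oplus\mathfrak g^*$ is a Lie algebra for the bracket extending that of $\mathfrak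 g$ with $[x,\xi]=\varpi_x\xi-\mathrm{ad}^*_x\xi$ and $[\xi,\eta]=\langle\eta,\varpi_\bullet\xi\rangle+\langle\xi\otimes\eta\otimes1,\varphi\rangle$ for $x\in\mathfrak g$, $\xi,\eta\in\mathfrak g^*$. Assume $\varpi_z=0$ for all $z\in\mathfrak l$. For a skew-symmetric linear map $t:\mathfrak g^*\to\mathfrak g$ put $$\langle\xi\otimes\eta\otimes\zeta,\varphi^t\rangle=\langle\xi\otimes\eta\otimes\zeta,\varphi\rangle+\circlearrowleft_{(\xi,\eta,\zeta)}\langle\zeta,[t\xi,t\eta]+\varpi_{t\xi}\eta\rangle .$$ Let $\mathbb D$ be the formal neighbourhood of $0\in\mathfrak l^*$. Let $\mathrm{Dynl}(\mathbb D,\mathcal G)$ be the set of formal dynamical $\ell$-matrices: formal maps $l$ from $\mathbb D$ to the skew-symmetric linear maps $\mathfrak g^*\to\mathfrak g$ such that, for all $\xi,\eta,\zeta\in\mathfrak g^*$ and $z\in\mathfrak l$, $$\circlearrowleft_{(\xi,\eta,\zeta)}\big(\langle\zeta,d_pl(i^*\xi)\eta\rangle-\langle\zeta,[l_p\xi,l_p\eta]\rangle-\langle\zeta,\varpi_{l_p\xi}\eta\rangle\big)=\langle\xi\otimes\eta\otimes\zeta,\varphi\rangle,$$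 $$d_pl(\mathrm{ad}^*_zp)+\varpi_{z}+\mathrm{ad}_{z}l_p+l_p\mathrm{ad}^*_{z}=0 .$$ A gauge transformation is a formal map $\sigma=e^{\Sigma}$ from $\mathbb D$ to a Lie group with Lie algebra $\mathfrak g$, where $\Sigma:\mathbb D\to\mathfrak g$ is a formal map with $\Sigma_0=0$ (so $\sigma_0=1$), which is $\mathfrak l$-equivariant: with $a_p=\frac{e^{\mathrm{ad}_{\Sigma_p}}-1}{\mathrm{ad}_{\Sigma_p}}\circ d_p\Sigma:\mathfrak l^*\to\mathfrak g$ (the right logarithmic derivative of $\sigma$) one has $a_p(\mathrm{ad}^*_zp)=\mathrm{Ad}_{\sigma_p}z-z$ for $z\in\mathfrak l$. It acts by $$l^\sigma_p=\mathrm{Ad}_{\sigma_p}l_p\mathrm{Ad}^*_{\sigma_p}+a_p\,i^*\mathrm{Ad}^*_{\sigma_p}-i\,a_p^*+\pi_{\sigma_p},\qquad \pi_{e^x}=\frac{e^{\rho_x}-1}{\rho_x}\varpi_x,\quad \rho_x t=\mathrm{ad}_xt+t\,\mathrm{ad}_x^*,$$ where $\mathrm{Ad}_{e^x}=e^{\mathrm{ad}_x}$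 and $\pi$ is the group cocycle integrating $\varpi$. Let $\mathcal M(\mathcal G,\mathfrak l)$ be the quotient of $\mathrm{Dynl}(\mathbb D,\mathcal G)$ by the relation $l\sim l'\iff l'=l^\sigma$ for some gauge transformation $\sigma$, and let $$\mathcal M_{\mathcal G,\mathfrak l,\mathfrak m}=\{t\in(\wedge^2\mathfrak m)^{\mathfrak l}\mid\varphi^t\equiv0\bmod\mathfrak l\}$$ be the set of skew-symmetric $t:\mathfrak g^*\to\mathfrak g$ with $\mathrm{ad}_zt+t\,\mathrm{ad}^*_z=0$ for $z\in\mathfrak l$, $t\,\mathfrak m^\perp=0$, $t\,\mathfrak l^\perp\subset\mathfrak m$, and $\langle\xi\otimes\eta\otimes\zeta,\varphi^t\rangle=0$ for all $\xi,\eta,\zeta\in\mathfrak l^\perp$. Then $\sim$ is an equivalence relation, and there is a well-defined injective map $\mathcal M(\mathcal G,\mathfrak l)\to\mathcal M_{\mathcal G,\mathfrak l,\mathfrak m}$ which sends a class $\mathcal C$ to $l_0$, where $l\in\mathcal C$ is any representative such that $l_0\mathfrak m^\perp=0$ and $l_0\mathfrak l^\perp\subset\mathfrak m$; that is, every class has such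 a representative, and $l_0$ is the same for all such representatives of the class. -/

import Mathlib

open Module

section Notation

variable {K : Type*} [Field K] {g : Type*} [LieRing g] [LieAlgebra K g]

/-- Sum over the cyclic permutations of `(a, b, c)`. -/
def cyclSum {V X : Type*} [Add X] (F : V → V → V → X) (a b c : V) : X :=
  F a b c + F b c a + F c a b

variable (K) in
/-- `ad x : g → g`. -/
def adMap (x : g) : g →ₗ[K] g := LieAlgebra.ad K g x

variable (K) in
/-- `ad* x : g* → g*`, the transpose of `ad x`, so that `⟨ad*_x ξ, y⟩ = ⟨ξ, [x, y]⟩`. -/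
def coadMap (x : g) : Dual K g →ₗ[K] Dual K g := (adMap K x).dualMap

/-- Skew-symmetric linear maps `g* → g`. -/
def IsSkew (t : Dual K g →ₗ[K] g) : Prop := ∀ ξ η : Dual K g, ξ (t η) = - η (t ξ)

variable (K g) in
/-- The adjoint action of `g` on linear maps `g* → g`: `x · t = ad_x t + t ad*_x`. -/
def homAct : g →ₗ[K] Module.End K (Dual K g →ₗ[K] g) where
  toFun x :=
    { toFun := fun t => adMap K x ∘ₗ t + t ∘ₗ coadMap K x
      map_add' := fun t t' => by
        ext ξ; simp only [LinearMap.add_apply, LinearMap.comp_apply, map_add]; abel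
      map_smul' := fun c t => by
        ext ξ; simp [LinearMap.add_apply, LinearMap.comp_apply] }
  map_add' x y := by
    ext t ξ
    have h : coadMap K (x + y) ξ = coadMap K x ξ + coadMap K y ξ := by
      ext z; simp [coadMap, adMap]
    simp only [LinearMap.coe_mk, AddHom.coe_mk, LinearMap.add_apply, LinearMap.comp_apply, h,
      map_add]
    simp only [adMap, map_add, LinearMap.add_apply]; abel
  map_smul' c x := by
    ext t ξ
    have h : coadMap K (c • x) ξ = c • coadMap K x ξ := by
      ext z; simp [coadMap, adMap]
    simp [LinearMap.add_apply, LinearMap.comp_apply, h, adMap]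

end Notation

section LieQuasiBialgebras

variable {K : Type*} [Field K] {g : Type*} [LieRing g] [LieAlgebra K g] [FiniteDimensional K g]

/-- The element `⟨ξ ⊗ η ⊗ 1, φ⟩` of `g`, for `φ ∈ ⋀³ g` regarded as an alternating trilinear
form on `g*`: it is characterised by `⟨ζ, ⟨ξ ⊗ η ⊗ 1, φ⟩⟩ = φ(ξ, η, ζ)`. -/
noncomputable def contract (φ : Dual K g [⋀^Fin 3]→ₗ[K] K) (ξ η : Dual K g) : g :=
  (Module.evalEquiv K g).symm (φ.toMultilinearMap.toLinearMap ![ξ, η, 0] 2)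

theorem apply_contract (φ : Dual K g [⋀^Fin 3]→ₗ[K] K) (ξ η ζ : Dual K g) :
    ζ (contract φ ξ η) = φ ![ξ, η, ζ] := by
  have h := Module.apply_evalEquiv_symm_apply K g ζ
    (φ.toMultilinearMap.toLinearMap ![ξ, η, 0] 2)
  have h2 : Function.update ![ξ, η, 0] 2 ζ = ![ξ, η, ζ] := by
    funext i; fin_cases i <;> rfl
  rw [contract, h, MultilinearMap.toLinearMap_apply, h2]
  rfl

/-- The bracket on the double `d = g ⊕ g*`:
`[x, y] = [x, y]_g`, `[x, ξ] = ϖ_x ξ - ad*_x ξ = -[ξ, x]`,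
`[ξ, η] = ⟨η, ϖ_• ξ⟩ + ⟨ξ ⊗ η ⊗ 1, φ⟩`. -/
noncomputable def doubleBracket (ϖ : g →ₗ[K] Dual K g →ₗ[K] g) (φ : Dual K g [⋀^Fin 3]→ₗ[K] K)
    (u v : g × Dual K g) : g × Dual K g :=
  (⁅u.1, v.1⁆ + ϖ u.1 v.2 - ϖ v.1 u.2 + contract φ u.2 v.2,
    - coadMap K u.1 v.2 + coadMap K v.1 u.2 + v.2 ∘ₗ ϖ.flip u.2)

variable (K g) in
/-- A Lie quasi-bialgebra structure `(g, [,], ϖ, φ)` on the Lie algebra `g`: `ϖ` is a Lie algebra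
`1`-cocycle of `g` with values in the skew-symmetric maps `g* → g`, `φ ∈ ⋀³ g`, and the bracket
above makes `g ⊕ g*` into a Lie algebra. -/
structure LieQuasiBialgebra where
  ϖ : g →ₗ[K] Dual K g →ₗ[K] g
  skew : ∀ x, IsSkew (ϖ x)
  cocycle : ∀ x y, ϖ ⁅x, y⁆ = homAct K g x (ϖ y) - homAct K g y (ϖ x)
  φ : Dual K g [⋀^Fin 3]→ₗ[K] K
  double_self : ∀ u, doubleBracket ϖ φ u u = 0
  double_jacobi : ∀ u v w,
    doubleBracket ϖ φ u (doubleBracket ϖ φ v w) + doubleBracket ϖ φ v (doubleBracket ϖ φ w u)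
      + doubleBracket ϖ φ w (doubleBracket ϖ φ u v) = 0

/-- The value `⟨ξ ⊗ η ⊗ ζ, φ^t⟩` of the associator of the twist of `G` by `t`. -/
def LieQuasiBialgebra.twistedAssociator (G : LieQuasiBialgebra K g) (t : Dual K g →ₗ[K] g)
    (ξ η ζ : Dual K g) : K :=
  G.φ ![ξ, η, ζ] + cyclSum (fun ξ η ζ => ζ (⁅t ξ, t η⁆ + G.ϖ (t ξ) η)) ξ η ζ

/-- `g = l ⊕ m` is a reductive decomposition: `m` is a vector space complement of the
subalgebra `l` and `[l, m] ⊂ m`. -/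
def IsReductiveDecomposition (l : LieSubalgebra K g) (m : Submodule K g) : Prop :=
  IsCompl l.toSubmodule m ∧ ∀ z ∈ l, ∀ y ∈ m, ⁅z, y⁆ ∈ m

/-- The conditions `t m^⊥ = 0` and `t l^⊥ ⊂ m`. -/
def IsNormalized (l : LieSubalgebra K g) (m : Submodule K g) (t : Dual K g →ₗ[K] g) : Prop :=
  (∀ ξ ∈ m.dualAnnihilator, t ξ = 0) ∧ ∀ ξ ∈ l.toSubmodule.dualAnnihilator, t ξ ∈ m

/-- The variety `M_{G,l,m} = {t ∈ (⋀² m)^l | φ^t ≡ 0 mod l}`. -/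
def LieQuasiBialgebra.variety (G : LieQuasiBialgebra K g) (l : LieSubalgebra K g)
    (m : Submodule K g) : Set (Dual K g →ₗ[K] g) :=
  {t | IsSkew t ∧ (∀ z ∈ l, homAct K g z t = 0) ∧ IsNormalized l m t ∧
    ∀ ξ ∈ l.toSubmodule.dualAnnihilator, ∀ η ∈ l.toSubmodule.dualAnnihilator,
      ∀ ζ ∈ l.toSubmodule.dualAnnihilator, G.twistedAssociator t ξ η ζ = 0}

end LieQuasiBialgebras

section FormalMaps

/-- Formal maps from the formal neighbourhood of `0` in a `d`-dimensional vector space with linear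
coordinates `x_1, …, x_d` to the vector space `V`: the series `∑_n x^n f_n`, with `f_n ∈ V`. -/
abbrev FormalMap (d : ℕ) (V : Type*) := MvPowerSeries (Fin d) V

namespace FormalMap

variable {K : Type*} [Field K] {d : ℕ}
  {V W X : Type*} [AddCommGroup V] [Module K V] [AddCommGroup W] [Module K W]
  [AddCommGroup X] [Module K X]

/-- The constant formal map. -/
def const (d : ℕ) (v : V) : FormalMap d V := fun n => if n = 0 then v else 0

/-- Pointwise application of a linear map. -/
def map (T : V →ₗ[K] W) (f : FormalMap d V) : FormalMap d W := fun n => T (f n)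

/-- The pointwise value `p ↦ B (f p) (h p)` of a bilinear map (Cauchy product). -/
noncomputable def bilin (B : V →ₗ[K] W →ₗ[K] X) (f : FormalMap d V) (h : FormalMap d W) : FormalMap d X :=
  fun n => ∑ q ∈ Finset.HasAntidiagonal.antidiagonal n, B (f q.1) (h q.2)

/-- Pointwise composition `p ↦ S_p ∘ T_p`. -/
noncomputable def comp (S : FormalMap d (W →ₗ[K] X)) (T : FormalMap d (V →ₗ[K] W)) : FormalMap d (V →ₗ[K] X) :=
  bilin (LinearMap.llcomp K V W X) S T

/-- Pointwise evaluation `p ↦ T_p (f p)`. -/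
noncomputable def eval (T : FormalMap d (V →ₗ[K] W)) (f : FormalMap d V) : FormalMap d W :=
  bilin LinearMap.id T f

/-- `∑_k c_k Φ^k` for a formal map `Φ` to `End V` without constant term: as `Φ^k` only has terms of
degree at least `k`, only the `k ≤ |n|` contribute to the term of exponent `n`. -/
noncomputable def powerSum (c : ℕ → K) (Φ : FormalMap d (Module.End K V)) :
    FormalMap d (Module.End K V) :=
  fun n => ∑ k ∈ Finset.range (n.degree + 1), c k • (Φ ^ k : MvPowerSeries _ _) n

/-- `e^Φ`. -/
noncomputable def exp (Φ : FormalMap d (Module.End K V)) : FormalMap d (Module.End K V) :=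
  powerSum (fun k => (k.factorial : K)⁻¹) Φ

/-- `(e^Φ - 1) / Φ`. -/
noncomputable def expSubOneDiv (Φ : FormalMap d (Module.End K V)) : FormalMap d (Module.End K V) :=
  powerSum (fun k => ((k + 1).factorial : K)⁻¹) Φ

variable (K) in
/-- The partial derivative in the direction of the `i`-th coordinate. -/
noncomputable def pderiv (i : Fin d) (f : FormalMap d V) : FormalMap d V :=
  fun n => ((n i : K) + 1) • f (n + Finsupp.single i 1)

variable {L : Type*} [AddCommGroup L] [Module K L]

/-- For a basis `b` of `L`, viewed as a system of linear coordinates on `L*`, the differential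
`p ↦ (α ↦ d_p f (α))` of a formal map on the formal neighbourhood of `0` in `L*`. -/
noncomputable def differential (b : Basis (Fin d) K L) (f : FormalMap d V) : FormalMap d (Dual K L →ₗ[K] V) :=
  fun n => ∑ i, (Dual.eval K L (b i)).smulRight (pderiv K i f n)

/-- The linear map `A : L* → V` as a formal map in the coordinates given by `b`. -/
noncomputable def ofLinear (b : Basis (Fin d) K L) (A : Dual K L →ₗ[K] V) : FormalMap d V :=
  fun n => ∑ i, if n = Finsupp.single i 1 then A (b.coord i) else 0

end FormalMap

end FormalMaps

section DynamicalMatrices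

variable {K : Type*} [Field K] {g : Type*} [LieRing g] [LieAlgebra K g] [FiniteDimensional K g]
  {l : LieSubalgebra K g} {d : ℕ}

open FormalMap

/-- The transpose `i^* : g* → l*` of the inclusion `i : l → g`. -/
def restrictDual (l : LieSubalgebra K g) : Dual K g →ₗ[K] Dual K l :=
  l.toSubmodule.subtype.dualMap

/-- The adjoint of `a : l* → g`, as a map `g* → l** = l ⊂ g`. -/
noncomputable def adjointMap (l : LieSubalgebra K g) :
    (Dual K l →ₗ[K] g) →ₗ[K] (Dual K g →ₗ[K] g) :=
  LinearMap.llcomp K _ _ _ (l.toSubmodule.subtype ∘ₗ (Module.evalEquiv K l).symm.toLinearMap) ∘ₗ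
    Dual.transpose

/-- The formal map `p ↦ d_p f (ad*_z p)`, for `z ∈ l`. -/
noncomputable def derivCoad {V : Type*} [AddCommGroup V] [Module K V] (b : Basis (Fin d) K l)
    (z : l) (f : FormalMap d V) : FormalMap d V :=
  eval (differential b f) (ofLinear b (coadMap K z))

/-- Formal dynamical `ℓ`-matrices at `0 ∈ l*` associated with `G`: formal maps `r` to the
skew-symmetric maps `g* → g` which satisfy the generalised classical dynamical Yang-Baxter equation
and the `l`-equivariance equation. -/
def Dynl (b : Basis (Fin d) K l) (G : LieQuasiBialgebra K g) :
    Set (FormalMap d (Dual K g →ₗ[K] g)) :=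
  {r | (∀ n, IsSkew (r n)) ∧
    (∀ ξ η ζ : Dual K g,
      cyclSum (fun ξ η ζ : Dual K g =>
        (map (ζ ∘ₗ LinearMap.applyₗ η ∘ₗ LinearMap.applyₗ (restrictDual l ξ)) (differential b r)
          - map ζ (bilin (LieAlgebra.ad K g : g →ₗ[K] Module.End K g)
              (map (LinearMap.applyₗ ξ) r) (map (LinearMap.applyₗ η) r))
          - map (ζ ∘ₗ G.ϖ.flip η ∘ₗ LinearMap.applyₗ ξ) r : FormalMap d K)) ξ η ζ
        = const d (G.φ ![ξ, η, ζ])) ∧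
    ∀ z : l, derivCoad b z r + const d (G.ϖ z) + map (homAct K g (z : g)) r = 0}

/-- `ad_Σ`, for a formal map `Σ` to `g`. -/
def adFormal (S : FormalMap d g) : FormalMap d (Module.End K g) :=
  map (LieAlgebra.ad K g : g →ₗ[K] Module.End K g) S

/-- `Ad_σ = e^{ad_Σ}` for `σ = e^Σ`. -/
noncomputable def AdExp (S : FormalMap d g) : FormalMap d (Module.End K g) :=
  exp (adFormal S)

/-- The right logarithmic derivative `r_{σ_p⁻¹} T_p σ : l* → g` of `σ = e^Σ`, namely
`((e^{ad_Σ} - 1) / ad_Σ) ∘ d_p Σ`. -/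
noncomputable def rightLogDeriv (b : Basis (Fin d) K l) (S : FormalMap d g) :
    FormalMap d (Dual K l →ₗ[K] g) :=
  comp (expSubOneDiv (adFormal S)) (differential b S)

/-- The value `π_σ` on `σ = e^Σ` of the group cocycle `π` integrating `ϖ` (Van Est's formula):
`π_{e^x} = ∫₀¹ e^{s x} · ϖ_x ds = ((e^x - 1) / x) · ϖ_x` for the adjoint action. -/
noncomputable def cocycleExp (G : LieQuasiBialgebra K g) (S : FormalMap d g) :
    FormalMap d (Dual K g →ₗ[K] g) :=
  eval (expSubOneDiv (map (homAct K g) S)) (map G.ϖ S)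

/-- The gauge group `Map_0(D, G)^l` (as a set): formal maps `σ` from the formal neighbourhood `D` of
`0 ∈ l*` to a Lie group with Lie algebra `g`, with `σ_0 = 1`, written `σ = e^Σ` with `Σ` a formal
map to `g` with `Σ_0 = 0`, and `l`-equivariant:
`r_{σ_p⁻¹} (T_p σ) (ad*_z p) = Ad_{σ_p} z - z` for `z ∈ l`. -/
structure GaugeMap (b : Basis (Fin d) K l) where
  logarithm : FormalMap d g
  logarithm_zero : logarithm 0 = 0
  equivariant : ∀ z : l,
    eval (rightLogDeriv b logarithm) (ofLinear b (coadMap K z))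
      = map (LinearMap.applyₗ (z : g)) (AdExp (K := K) logarithm) - const d (z : g)

/-- `θ^σ_p = r_{σ_p⁻¹} (T_p σ) i^* Ad*_{σ_p} - (T_p σ)^* r_{σ_p⁻¹}^*`. -/
noncomputable def GaugeMap.theta {b : Basis (Fin d) K l} (σ : GaugeMap b) :
    FormalMap d (Dual K g →ₗ[K] g) :=
  comp (comp (rightLogDeriv b σ.logarithm) (const d (restrictDual l)))
      (map Dual.transpose (AdExp (K := K) σ.logarithm))
    - map (adjointMap l) (rightLogDeriv b σ.logarithm)

/-- The gauge action `r^σ_p = Ad_{σ_p} r_p Ad*_{σ_p} + θ^σ_p + π_{σ_p}`. -/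
noncomputable def GaugeMap.act {b : Basis (Fin d) K l} (G : LieQuasiBialgebra K g) (σ : GaugeMap b)
    (r : FormalMap d (Dual K g →ₗ[K] g)) : FormalMap d (Dual K g →ₗ[K] g) :=
  comp (comp (AdExp (K := K) σ.logarithm) r) (map Dual.transpose (AdExp (K := K) σ.logarithm))
    + σ.theta + cocycleExp G σ.logarithm

/-- `r'` lies in the gauge orbit of `r`. -/
def GaugeRel (b : Basis (Fin d) K l) (G : LieQuasiBialgebra K g) (r r' : Dynl b G) : Prop :=
  ∃ σ : GaugeMap b, r'.1 = σ.act G r.1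

/-- The moduli space `M(G, l)` of formal dynamical `ℓ`-matrices modulo gauge transformations. -/
def ModuliSpace (b : Basis (Fin d) K l) (G : LieQuasiBialgebra K g) : Type _ :=
  Quot (GaugeRel b G)

/-- The gauge class of a formal dynamical `ℓ`-matrix. -/
def gaugeClass {b : Basis (Fin d) K l} {G : LieQuasiBialgebra K g} (r : Dynl b G) :
    ModuliSpace b G :=
  Quot.mk (GaugeRel b G) r

end DynamicalMatrices

/-! The gauge action becomes transparent on the double g ⊕ g*. To formal maps into the double one
adjoins vector fields and 1-forms on the formal neighbourhood of 0 in l*; the sum carries a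
symmetric pairing and a trilinear expression `DiffQuad.tau`, the Dorfman bracket paired with a third
element. A formal map `r` is encoded by the submodule `lagrangian b r` spanned by the elements (r ξ
+ ξ, -i*ξ, 0) for ξ in g*, and (z, ad*_z p, d⟨p, z⟩) for z in a basis of l. The pairing and `tau`
vanish on these generators exactly when `r` is a dynamical ℓ-matrix: the pairing yields skewness,
`tau` yields the Yang-Baxter equation (`tau_graph_graph_graph`) and l-equivariance
(`tau_base_graph_graph`). On isotropic submodules `tau` is linear over functions, so generators
suffice.

A gauge transformation σ acts on the extended double by a map `Phi` preserving the pairing and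
`tau`; the invariance of `tau` is the Maurer-Cartan equation of the logarithmic derivative a.
Equivariance of σ says that `Phi` fixes the generators coming from l, and then the generators of the
transformed matrix lie in the image of `lagrangian b r` (`GaugeMap.graphGen_act`). Hence the action
preserves solutions. Since isotropy of a graph determines its matrix, the composition law of the
action follows from that of `Phi`. Products and inverses of gauge transformations are built through
logarithmic derivatives instead of the Baker-Campbell-Hausdorff series: every Maurer-Cartan solution
is the logarithmic derivative of a unique e^S with S_0 = 0 (`exists_logDeriv_eq`, `eq_of_logDeriv`).

At p = 0 the action only adds a i* - i a* to l_0, with a = d_0 Σ. This touches only the blocks of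
l_0 that involve l. An equivariant linear Σ removes those blocks, while the m-m block never changes;
a normalised constant term is thus an invariant of the class. The two equations at p = 0, tested on
the annihilator of l, place it in the variety.

For injectivity, let two solutions agree through degree N, and let w be the part of degree N + 1 of
their difference. The nonlinear terms agree through degree N, so w is closed for the cyclic
differential. Contraction with the radial field gives a Cartan homotopy formula whose eigenvalues on
the m-m, l-m and l-l blocks are N + 1, N + 2 and N + 3. Hence the m-m block vanishes and the others
are exact, with a primitive that is l-equivariant because [l, m] ⊂ m. Exponentiating the primitive
removes w, and the infinite product of these corrections converges degree by degree
(`exists_correction`, `exists_act_eq`). -/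

namespace FormalMap

/-! ### Bilinear operations, formal functions and partial derivatives -/

section Calculus

variable {K : Type*} [Field K] {d : ℕ}
  {V W X Y Z : Type*} [AddCommGroup V] [Module K V] [AddCommGroup W] [Module K W]
  [AddCommGroup X] [Module K X] [AddCommGroup Y] [Module K Y] [AddCommGroup Z] [Module K Z]

@[simp] theorem add_coeff (f h : FormalMap d V) (n : Fin d →₀ ℕ) : (f + h) n = f n + h n := rfl

@[simp] theorem sub_coeff (f h : FormalMap d V) (n : Fin d →₀ ℕ) : (f - h) n = f n - h n := rfl

@[simp] theorem neg_coeff (f : FormalMap d V) (n : Fin d →₀ ℕ) : (-f) n = -f n := rfl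

@[simp] theorem zero_coeff (n : Fin d →₀ ℕ) : (0 : FormalMap d V) n = 0 := rfl

@[simp] theorem smul_coeff (c : K) (f : FormalMap d V) (n : Fin d →₀ ℕ) :
    (c • f : FormalMap d V) n = c • f n := rfl

variable (V) in
/-- The coefficient of exponent `n`, as an additive map. -/
def coeffHom (n : Fin d →₀ ℕ) : FormalMap d V →+ V where
  toFun f := f n
  map_zero' := rfl
  map_add' _ _ := rfl

@[simp] theorem sum_coeff {ι : Type*} (s : Finset ι) (f : ι → FormalMap d V) (n : Fin d →₀ ℕ) :
    (∑ i ∈ s, f i) n = ∑ i ∈ s, f i n :=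
  map_sum (coeffHom V n) f s

theorem const_coeff (v : V) (n : Fin d →₀ ℕ) : const d v n = if n = 0 then v else 0 := rfl

@[simp] theorem const_coeff_zero (v : V) : const d v 0 = v := if_pos rfl

@[simp] theorem const_zero : const d (0 : V) = 0 := by
  funext n; simp [const_coeff]

@[simp] theorem map_coeff (T : V →ₗ[K] W) (f : FormalMap d V) (n : Fin d →₀ ℕ) :
    map T f n = T (f n) := rfl

theorem bilin_coeff (B : V →ₗ[K] W →ₗ[K] X) (f : FormalMap d V) (h : FormalMap d W)
    (n : Fin d →₀ ℕ) :
    bilin B f h n = ∑ q ∈ Finset.HasAntidiagonal.antidiagonal n, B (f q.1) (h q.2) := rfl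

/-- `bilin` as a bilinear map. -/
noncomputable def bilinK (B : V →ₗ[K] W →ₗ[K] X) :
    FormalMap d V →ₗ[K] FormalMap d W →ₗ[K] FormalMap d X :=
  LinearMap.mk₂ K (bilin B)
    (fun _ _ _ => by funext n; simp [bilin_coeff, Finset.sum_add_distrib])
    (fun _ _ _ => by funext n; simp [bilin_coeff, Finset.smul_sum])
    (fun _ _ _ => by funext n; simp [bilin_coeff, Finset.sum_add_distrib])
    (fun _ _ _ => by funext n; simp [bilin_coeff, Finset.smul_sum])

theorem bilinK_apply (B : V →ₗ[K] W →ₗ[K] X) (f : FormalMap d V) (h : FormalMap d W) :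
    bilinK B f h = bilin B f h := rfl

section Linearity

variable (B : V →ₗ[K] W →ₗ[K] X)

theorem bilin_add_left (f f' : FormalMap d V) (h : FormalMap d W) :
    bilin B (f + f') h = bilin B f h + bilin B f' h := (bilinK B).map_add₂ f f' h

theorem bilin_add_right (f : FormalMap d V) (h h' : FormalMap d W) :
    bilin B f (h + h') = bilin B f h + bilin B f h' := (bilinK B f).map_add h h'

theorem bilin_sub_left (f f' : FormalMap d V) (h : FormalMap d W) :
    bilin B (f - f') h = bilin B f h - bilin B f' h := (bilinK B).map_sub₂ f f' h

theorem bilin_sub_right (f : FormalMap d V) (h h' : FormalMap d W) :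
    bilin B f (h - h') = bilin B f h - bilin B f h' := (bilinK B f).map_sub h h'

theorem bilin_neg_left (f : FormalMap d V) (h : FormalMap d W) :
    bilin B (-f) h = -bilin B f h := (bilinK B).map_neg₂ f h

theorem bilin_neg_right (f : FormalMap d V) (h : FormalMap d W) :
    bilin B f (-h) = -bilin B f h := (bilinK B f).map_neg h

@[simp] theorem bilin_zero_left (h : FormalMap d W) : bilin B (0 : FormalMap d V) h = 0 :=
  (bilinK B).map_zero₂ h

@[simp] theorem bilin_zero_right (f : FormalMap d V) : bilin B f (0 : FormalMap d W) = 0 :=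
  (bilinK B f).map_zero

theorem bilin_sum_left {ι : Type*} (s : Finset ι) (f : ι → FormalMap d V) (h : FormalMap d W) :
    bilin B (∑ i ∈ s, f i) h = ∑ i ∈ s, bilin B (f i) h := (bilinK B).map_sum₂ s f h

theorem bilin_sum_right {ι : Type*} (s : Finset ι) (f : FormalMap d V) (h : ι → FormalMap d W) :
    bilin B f (∑ i ∈ s, h i) = ∑ i ∈ s, bilin B f (h i) := map_sum (bilinK B f) h s

theorem bilin_smul_left (c : K) (f : FormalMap d V) (h : FormalMap d W) :
    bilin B (c • f) h = c • bilin B f h := (bilinK B).map_smul₂ c f h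

theorem bilin_smul_right (c : K) (f : FormalMap d V) (h : FormalMap d W) :
    bilin B f (c • h) = c • bilin B f h := (bilinK B f).map_smul c h

end Linearity

theorem map_add' (T : V →ₗ[K] W) (f h : FormalMap d V) : map T (f + h) = map T f + map T h := by
  funext n; simp

theorem map_sub' (T : V →ₗ[K] W) (f h : FormalMap d V) : map T (f - h) = map T f - map T h := by
  funext n; simp

theorem map_neg' (T : V →ₗ[K] W) (f : FormalMap d V) : map T (-f) = -map T f := by
  funext n; simp

theorem map_sum' {ι : Type*} (T : V →ₗ[K] W) (s : Finset ι) (f : ι → FormalMap d V) :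
    map T (∑ i ∈ s, f i) = ∑ i ∈ s, map T (f i) := by
  funext n; simp

@[simp] theorem map_zero' (T : V →ₗ[K] W) : map T (0 : FormalMap d V) = 0 := by
  funext n; simp

@[simp] theorem map_const (T : V →ₗ[K] W) (v : V) : map T (const d v) = const d (T v) := by
  funext n; simp only [map_coeff, const_coeff]; split_ifs <;> simp

theorem map_map (T : W →ₗ[K] X) (S : V →ₗ[K] W) (f : FormalMap d V) :
    map T (map S f) = map (T ∘ₗ S) f := rfl

theorem map_bilin (T : X →ₗ[K] Y) (B : V →ₗ[K] W →ₗ[K] X) (f : FormalMap d V)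
    (h : FormalMap d W) : map T (bilin B f h) = bilin (B.compr₂ T) f h := by
  funext n; simp [bilin_coeff]

theorem bilin_map_left (T : Y →ₗ[K] V) (B : V →ₗ[K] W →ₗ[K] X) (f : FormalMap d Y)
    (h : FormalMap d W) : bilin B (map T f) h = bilin (B ∘ₗ T) f h := rfl

theorem bilin_map_right (T : Y →ₗ[K] W) (B : V →ₗ[K] W →ₗ[K] X) (f : FormalMap d V)
    (h : FormalMap d Y) : bilin B f (map T h) = bilin (B.compl₂ T) f h := rfl

theorem bilin_flip (B : V →ₗ[K] W →ₗ[K] X) (f : FormalMap d V) (h : FormalMap d W) :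
    bilin B.flip h f = bilin B f h := by
  funext n
  rw [bilin_coeff, bilin_coeff]
  exact Finset.sum_nbij' Prod.swap Prod.swap (by simp [add_comm]) (by simp [add_comm])
    (by simp) (by simp) (by simp)

theorem bilin_const_left (B : V →ₗ[K] W →ₗ[K] X) (v : V) (h : FormalMap d W) :
    bilin B (const d v) h = map (B v) h := by
  funext n
  rw [bilin_coeff, Finset.sum_eq_single (0, n)]
  · simp
  · rintro ⟨p, q⟩ hpq hne
    have : p ≠ 0 := by
      rintro rfl
      exact hne (by simpa using hpq)
    simp [const_coeff, this]
  · intro h; simp at h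

theorem bilin_const_right (B : V →ₗ[K] W →ₗ[K] X) (f : FormalMap d V) (w : W) :
    bilin B f (const d w) = map (B.flip w) f := by
  rw [← bilin_flip, bilin_const_left]

/-- Both sides sum over triples of exponents with total n. Taking an arbitrary bilinear identity as
hypothesis lets one reindexing serve module axioms, composition, evaluation of products and
invariance of the pairing. -/
theorem bilin_assoc {U : Type*} [AddCommGroup U] [Module K U]
    (B : X →ₗ[K] W →ₗ[K] Z) (C : U →ₗ[K] V →ₗ[K] X)
    (B' : U →ₗ[K] Y →ₗ[K] Z) (C' : V →ₗ[K] W →ₗ[K] Y)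
    (H : ∀ u v w, B (C u v) w = B' u (C' v w)) (f : FormalMap d U) (g : FormalMap d V)
    (h : FormalMap d W) : bilin B (bilin C f g) h = bilin B' f (bilin C' g h) := by
  funext n
  simp only [bilin_coeff, map_sum, LinearMap.sum_apply, Finset.sum_sigma']
  apply Finset.sum_nbij' (fun ⟨⟨_i, j⟩, ⟨k, l⟩⟩ ↦ ⟨(k, l + j), (l, j)⟩)
    (fun ⟨⟨i, _j⟩, ⟨k, l⟩⟩ ↦ ⟨(i + k, l), (i, k)⟩)
  all_goals simp only [Finset.mem_sigma, Finset.HasAntidiagonal.mem_antidiagonal]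
  · rintro ⟨⟨i, j⟩, ⟨k, l⟩⟩ ⟨h1, h2⟩
    simp only at h1 h2
    subst h2; subst h1
    simp [add_assoc]
  · rintro ⟨⟨i, j⟩, ⟨k, l⟩⟩ ⟨h1, h2⟩
    simp only at h1 h2
    subst h2; subst h1
    simp [add_assoc]
  · rintro ⟨⟨i, j⟩, ⟨k, l⟩⟩ ⟨h1, h2⟩
    simp only at h1 h2
    subst h2
    rfl
  · rintro ⟨⟨i, j⟩, ⟨k, l⟩⟩ ⟨h1, h2⟩
    simp only at h1 h2
    subst h2
    rfl
  · rintro ⟨⟨i, j⟩, ⟨k, l⟩⟩ _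
    exact H _ _ _

/-- Multiplication of formal maps by formal functions. -/
noncomputable instance (priority := low) instFunctionSMul :
    SMul (MvPowerSeries (Fin d) K) (MvPowerSeries (Fin d) V) :=
  ⟨fun r f => bilin (LinearMap.lsmul K V) r f⟩

theorem function_smul_def (r : FormalMap d K) (f : FormalMap d V) :
    r • f = bilin (LinearMap.lsmul K V) r f := rfl

theorem bilin_mul (f h : FormalMap d K) : bilin (LinearMap.mul K K) f h = f * h := by
  funext n
  exact (MvPowerSeries.coeff_mul n f h).symm

theorem const_one : const d (1 : K) = 1 := by
  funext n
  exact (MvPowerSeries.coeff_one n).symm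

noncomputable instance (priority := low) instFunctionModule :
    Module (MvPowerSeries (Fin d) K) (MvPowerSeries (Fin d) V) where
  one_smul f := by
    rw [function_smul_def, ← const_one, bilin_const_left]
    funext n; simp
  mul_smul r s f := by
    simp only [function_smul_def]
    rw [← bilin_mul]
    exact bilin_assoc _ _ _ _ (fun u v w => mul_smul u v w) _ _ _
  smul_zero r := by simp [function_smul_def]
  zero_smul r := by simp [function_smul_def]
  smul_add r f h := bilin_add_right _ _ _ _
  add_smul r s f := bilin_add_left _ _ _ _

theorem bilin_function_smul_left (B : V →ₗ[K] W →ₗ[K] X) (r : FormalMap d K)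
    (f : FormalMap d V) (h : FormalMap d W) : bilin B (r • f) h = r • bilin B f h :=
  bilin_assoc _ _ _ _ (fun u v w => by simp) _ _ _

theorem bilin_function_smul_right (B : V →ₗ[K] W →ₗ[K] X) (r : FormalMap d K)
    (f : FormalMap d V) (h : FormalMap d W) : bilin B f (r • h) = r • bilin B f h := by
  rw [← bilin_flip, bilin_function_smul_left, bilin_flip]

theorem map_function_smul (T : V →ₗ[K] W) (r : FormalMap d K) (f : FormalMap d V) :
    map T (r • f) = r • map T f := by
  simp only [function_smul_def]
  rw [map_bilin, bilin_map_right]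
  congr 1
  ext; simp

/-- `bilin` as a bilinear map over the formal functions. -/
noncomputable def bilinF (B : V →ₗ[K] W →ₗ[K] X) :
    FormalMap d V →ₗ[FormalMap d K] FormalMap d W →ₗ[FormalMap d K] FormalMap d X :=
  LinearMap.mk₂ _ (bilin B) (bilin_add_left B) (bilin_function_smul_left B) (bilin_add_right B)
    (fun r f h => bilin_function_smul_right B r f h)

@[simp] theorem bilinF_apply (B : V →ₗ[K] W →ₗ[K] X) (f : FormalMap d V) (h : FormalMap d W) :
    bilinF B f h = bilin B f h := rfl

/-- The pointwise application of a linear map, as a map which is linear over the formal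
functions. -/
noncomputable def mapF (T : V →ₗ[K] W) : FormalMap d V →ₗ[FormalMap d K] FormalMap d W where
  toFun := map T
  map_add' := map_add' T
  map_smul' := map_function_smul T

/-- For V = K there are two actions of the formal functions on themselves, the Cauchy product just
defined and ring multiplication, so scalar-valued pairings get their own versions of the linearity
lemmas, landing in the ring itself. -/
theorem function_smul_eq_mul (r f : FormalMap d K) : bilin (LinearMap.lsmul K K) r f = r * f :=
  bilin_mul r f

theorem bilin_smul_left_mul (B : V →ₗ[K] W →ₗ[K] K) (r : FormalMap d K)
    (f : FormalMap d V) (h : FormalMap d W) : bilin B (r • f) h = r * bilin B f h := by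
  rw [bilin_function_smul_left, function_smul_def, function_smul_eq_mul]

theorem bilin_smul_right_mul (B : V →ₗ[K] W →ₗ[K] K) (r : FormalMap d K)
    (f : FormalMap d V) (h : FormalMap d W) : bilin B f (r • h) = r * bilin B f h := by
  rw [bilin_function_smul_right, function_smul_def, function_smul_eq_mul]

/-- A scalar valued `bilin` as a bilinear form over the formal functions. -/
noncomputable def pairF (B : V →ₗ[K] W →ₗ[K] K) :
    FormalMap d V →ₗ[FormalMap d K] FormalMap d W →ₗ[FormalMap d K] FormalMap d K :=
  LinearMap.mk₂ _ (bilin B) (bilin_add_left B) (bilin_smul_left_mul B) (bilin_add_right B)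
    (fun r f h => bilin_smul_right_mul B r f h)

@[simp] theorem pairF_apply (B : V →ₗ[K] W →ₗ[K] K) (f : FormalMap d V) (h : FormalMap d W) :
    pairF B f h = bilin B f h := rfl

theorem eq_sum_smul_const {ι : Type*} [Fintype ι] (e : Basis ι K V) (f : FormalMap d V) :
    f = ∑ i, map (e.coord i) f • const d (e i) := by
  funext n
  rw [sum_coeff]
  simp only [function_smul_def, bilin_const_right, map_coeff]
  exact (e.sum_repr (f n)).symm

/-- A formal map with values in a finite-dimensional space is a combination of constant maps. -/
@[elab_as_elim]
theorem induction_const [FiniteDimensional K V] {P : FormalMap d V → Prop} (f : FormalMap d V)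
    (hc : ∀ v, P (const d v)) (ha : ∀ f h, P f → P h → P (f + h))
    (hs : ∀ (r : FormalMap d K) f, P f → P (r • f)) : P f := by
  rw [eq_sum_smul_const (Module.finBasis K V) f]
  refine Finset.sum_induction _ P ha ?_ (fun i _ => hs _ _ (hc _))
  simpa using hc 0

section Derivative

theorem pderiv_coeff (i : Fin d) (f : FormalMap d V) (n : Fin d →₀ ℕ) :
    pderiv K i f n = ((n i : K) + 1) • f (n + Finsupp.single i 1) := rfl

variable (K V) in
/-- `pderiv` as a linear map. -/
noncomputable def pderivL (i : Fin d) : FormalMap d V →ₗ[K] FormalMap d V where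
  toFun := pderiv K i
  map_add' f h := by funext n; simp [pderiv_coeff]
  map_smul' c f := by funext n; simp [pderiv_coeff, smul_comm c]

theorem pderiv_add (i : Fin d) (f h : FormalMap d V) :
    pderiv K i (f + h) = pderiv K i f + pderiv K i h := (pderivL K V i).map_add f h

theorem pderiv_sub (i : Fin d) (f h : FormalMap d V) :
    pderiv K i (f - h) = pderiv K i f - pderiv K i h := (pderivL K V i).map_sub f h

theorem pderiv_neg (i : Fin d) (f : FormalMap d V) :
    pderiv K i (-f) = -pderiv K i f := (pderivL K V i).map_neg f

@[simp] theorem pderiv_zero (i : Fin d) : pderiv K i (0 : FormalMap d V) = 0 :=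
  (pderivL K V i).map_zero

theorem pderiv_sum {ι : Type*} (i : Fin d) (s : Finset ι) (f : ι → FormalMap d V) :
    pderiv K i (∑ j ∈ s, f j) = ∑ j ∈ s, pderiv K i (f j) := map_sum (pderivL K V i) f s

theorem pderiv_smul (i : Fin d) (c : K) (f : FormalMap d V) :
    pderiv K i (c • f) = c • pderiv K i f := (pderivL K V i).map_smul c f

@[simp] theorem pderiv_const (i : Fin d) (v : V) : pderiv K i (const d v) = 0 := by
  funext n
  have : n + Finsupp.single i 1 ≠ 0 := fun h => by
    have := DFunLike.congr_fun h i
    simp at this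
  simp [pderiv_coeff, const_coeff, this]

theorem map_pderiv (T : V →ₗ[K] W) (i : Fin d) (f : FormalMap d V) :
    map T (pderiv K i f) = pderiv K i (map T f) := by
  funext n; simp [pderiv_coeff]

theorem pderiv_comm (i j : Fin d) (f : FormalMap d V) :
    pderiv K i (pderiv K j f) = pderiv K j (pderiv K i f) := by
  funext n
  simp only [pderiv_coeff, smul_smul, Finsupp.add_apply, Finsupp.single_apply]
  rw [add_right_comm]
  congr 1
  by_cases h : i = j
  · subst h; rfl
  · simp [h, Ne.symm h, mul_comm]

/-- Shifting the first exponent by the i-th unit turns differentiation into the weight q.1 i; the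
new terms with q.1 i = 0 contribute nothing. Adding the analogous weight q.2 i gives n i + 1, which
is the Leibniz rule. -/
theorem bilin_pderiv_left (B : V →ₗ[K] W →ₗ[K] X) (i : Fin d) (f : FormalMap d V)
    (h : FormalMap d W) (n : Fin d →₀ ℕ) :
    bilin B (pderiv K i f) h n = ∑ q ∈ (Finset.HasAntidiagonal.antidiagonal
        (n + Finsupp.single i 1) : Finset ((Fin d →₀ ℕ) × (Fin d →₀ ℕ))),
      ((q.1 i : ℕ) : K) • B (f q.1) (h q.2) := by
  rw [bilin_coeff]
  symm
  rw [← Finset.sum_filter_add_sum_filter_not _ (fun q => q.1 i = 0)]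
  rw [Finset.sum_eq_zero, zero_add]
  swap
  · intro q hq
    simp [(Finset.mem_filter.1 hq).2]
  have key : ∀ p : Fin d →₀ ℕ, p i ≠ 0 → p - Finsupp.single i 1 + Finsupp.single i 1 = p :=
    fun p hp => tsub_add_cancel_of_le (by simpa [Nat.one_le_iff_ne_zero] using hp)
  refine Finset.sum_nbij' (fun q => (q.1 - Finsupp.single i 1, q.2))
    (fun q => (q.1 + Finsupp.single i 1, q.2)) ?_ ?_ ?_ ?_ ?_
  · rintro ⟨p, q⟩ hpq
    simp only [Finset.mem_filter, Finset.HasAntidiagonal.mem_antidiagonal] at hpq ⊢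
    apply add_right_cancel (b := Finsupp.single i 1)
    rw [add_right_comm, key p hpq.2, hpq.1]
  · rintro ⟨p, q⟩ hpq
    simp only [Finset.mem_filter, Finset.HasAntidiagonal.mem_antidiagonal] at hpq ⊢
    subst hpq
    simp [add_right_comm]
  · rintro ⟨p, q⟩ hpq
    simp only [Finset.mem_filter, Finset.HasAntidiagonal.mem_antidiagonal] at hpq ⊢
    rw [key p hpq.2]
  · rintro ⟨p, q⟩ hpq
    simp
  · rintro ⟨p, q⟩ hpq
    simp only [Finset.mem_filter, Finset.HasAntidiagonal.mem_antidiagonal] at hpq ⊢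
    rw [pderiv_coeff, key p hpq.2]
    have : (((p - Finsupp.single i 1 : Fin d →₀ ℕ) i : ℕ) : K) + 1 = p i := by
      conv_rhs => rw [← key p hpq.2]
      simp
    rw [this]; simp

theorem bilin_pderiv_right (B : V →ₗ[K] W →ₗ[K] X) (i : Fin d) (f : FormalMap d V)
    (h : FormalMap d W) (n : Fin d →₀ ℕ) :
    bilin B f (pderiv K i h) n = ∑ q ∈ (Finset.HasAntidiagonal.antidiagonal
        (n + Finsupp.single i 1) : Finset ((Fin d →₀ ℕ) × (Fin d →₀ ℕ))),
      ((q.2 i : ℕ) : K) • B (f q.1) (h q.2) := by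
  rw [← bilin_flip, bilin_pderiv_left]
  exact Finset.sum_nbij' Prod.swap Prod.swap (by simp [add_comm]) (by simp [add_comm])
    (by simp) (by simp) (by simp)

theorem pderiv_bilin (B : V →ₗ[K] W →ₗ[K] X) (i : Fin d) (f : FormalMap d V)
    (h : FormalMap d W) :
    pderiv K i (bilin B f h) = bilin B (pderiv K i f) h + bilin B f (pderiv K i h) := by
  funext n
  rw [add_coeff, bilin_pderiv_left, bilin_pderiv_right, pderiv_coeff, bilin_coeff, Finset.smul_sum,
    ← Finset.sum_add_distrib]
  refine Finset.sum_congr rfl fun q hq => ?_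
  have := DFunLike.congr_fun (Finset.HasAntidiagonal.mem_antidiagonal.1 hq) i
  simp only [Finsupp.add_apply, Finsupp.single_eq_same] at this
  rw [← add_smul]
  congr 1
  have := congrArg (Nat.cast (R := K)) this
  push_cast at this
  exact this.symm

theorem pderiv_function_smul (i : Fin d) (r : FormalMap d K) (f : FormalMap d V) :
    pderiv K i (r • f) = pderiv K i r • f + r • pderiv K i f := pderiv_bilin _ _ _ _

theorem pderiv_mul (i : Fin d) (r s : FormalMap d K) :
    pderiv K i (r * s) = pderiv K i r * s + r * pderiv K i s := by
  simp only [← bilin_mul]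
  exact pderiv_bilin _ _ _ _

/-- A solution without constant term of a linear homogeneous total differential equation
vanishes. -/
theorem eq_zero_of_pderiv_eq [CharZero K] (B : V →ₗ[K] W →ₗ[K] W) (a : Fin d → FormalMap d V)
    (f : FormalMap d W) (h0 : f 0 = 0) (h : ∀ i, pderiv K i f = bilin B (a i) f) : f = 0 := by
  suffices H : ∀ N, ∀ n : Fin d →₀ ℕ, n.degree = N → f n = 0 by
    funext n; exact H _ n rfl
  intro N
  induction N using Nat.strong_induction_on with
  | _ N ih =>
    intro n hn
    by_cases hn0 : n = 0
    · rw [hn0, h0]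
    obtain ⟨i, hi⟩ : ∃ i, n i ≠ 0 := by
      by_contra! H
      exact hn0 (Finsupp.ext H)
    have hm : n - Finsupp.single i 1 + Finsupp.single i 1 = n :=
      tsub_add_cancel_of_le (by simpa [Nat.one_le_iff_ne_zero] using hi)
    have hd : (n - Finsupp.single i 1).degree + 1 = N := by
      conv_rhs => rw [← hn, ← hm]
      simp
    -- At the exponent n lowered by the i-th unit, the left side is a nonzero multiple of f n, while
    -- the right side only involves coefficients of f of smaller degree.
    have key := congrFun (h i) (n - Finsupp.single i 1)
    rw [pderiv_coeff, bilin_coeff, Finset.sum_eq_zero, hm] at key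
    · exact (smul_eq_zero.1 key).resolve_left (Nat.cast_add_one_ne_zero _)
    · rintro ⟨p, q⟩ hpq
      have hpq := congrArg Finsupp.degree (Finset.HasAntidiagonal.mem_antidiagonal.1 hpq)
      rw [map_add] at hpq
      rw [ih q.degree (by simp only at hpq; omega) q rfl, map_zero]

end Derivative

end Calculus

end FormalMap

namespace FormalMap

/-! ### Series of formal maps, summed degree by degree -/

section Sequences

variable {K : Type*} [Field K] {d : ℕ}
  {U V W X Y Z T : Type*} [AddCommGroup U] [Module K U] [AddCommGroup V] [Module K V]
  [AddCommGroup W] [Module K W] [AddCommGroup X] [Module K X] [AddCommGroup Y] [Module K Y]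
  [AddCommGroup Z] [Module K Z] [AddCommGroup T] [Module K T]

theorem bilin_add_map (B C : V →ₗ[K] W →ₗ[K] X) (f : FormalMap d V) (h : FormalMap d W) :
    bilin (B + C) f h = bilin B f h + bilin C f h := by
  funext n; simp [bilin_coeff, Finset.sum_add_distrib]

/-- Derivation counterpart of `bilin_assoc`. Currying the last argument turns the identity into an
equality of bilinear maps with values in Hom(W, Z); the swapped order of f and g is absorbed by
`bilin_flip`. -/
theorem bilin_leibniz (B : U →ₗ[K] Y →ₗ[K] Z) (C : V →ₗ[K] W →ₗ[K] Y)
    (B₁ : X →ₗ[K] W →ₗ[K] Z) (C₁ : U →ₗ[K] V →ₗ[K] X)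
    (B₂ : V →ₗ[K] T →ₗ[K] Z) (C₂ : U →ₗ[K] W →ₗ[K] T)
    (H : ∀ u v w, B u (C v w) = B₁ (C₁ u v) w + B₂ v (C₂ u w))
    (f : FormalMap d U) (g : FormalMap d V) (h : FormalMap d W) :
    bilin B f (bilin C g h) = bilin B₁ (bilin C₁ f g) h + bilin B₂ g (bilin C₂ f h) := by
  rw [← bilin_assoc LinearMap.id ((LinearMap.llcomp K W Y Z).compl₁₂ B C) B C
    (fun u v w => by simp) f g h]
  rw [← bilin_assoc LinearMap.id ((LinearMap.llcomp K W T Z).compl₁₂ B₂ C₂) B₂ C₂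
    (fun u v w => by simp) g f h]
  rw [← bilin_flip ((LinearMap.llcomp K W T Z).compl₁₂ B₂ C₂)]
  rw [show bilin B₁ (bilin C₁ f g) h = bilin LinearMap.id (map B₁ (bilin C₁ f g)) h from rfl,
    map_bilin, ← bilin_add_left, ← bilin_add_map]
  congr 2
  ext u v w
  simp [H]

/-- The series with terms `x k` has the sum `s`, and `x k` has order at least `k - c`. -/
def SumsTo (c : ℕ) (x : ℕ → FormalMap d V) (s : FormalMap d V) : Prop :=
  (∀ k n, Finsupp.degree n + c < k → x k n = 0) ∧
    ∀ n, ∑ k ∈ Finset.range (Finsupp.degree n + c + 1), x k n = s n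

theorem SumsTo.sum_range {c : ℕ} {x : ℕ → FormalMap d V} {s : FormalMap d V} (h : SumsTo c x s)
    {n : Fin d →₀ ℕ} {M : ℕ} (hM : n.degree + c < M) : ∑ k ∈ Finset.range M, x k n = s n := by
  rw [← h.2 n]
  symm
  refine Finset.sum_subset (Finset.range_subset_range.2 hM) fun k _ hk => h.1 k n ?_
  simpa using hk

/-- Transfers identities between terms to identities between sums. The offsets may differ, since any
sufficiently long partial sum gives the same coefficient. -/
theorem SumsTo.unique {c c' : ℕ} {x : ℕ → FormalMap d V} {s s' : FormalMap d V}
    (h : SumsTo c x s) (h' : SumsTo c' x s') : s = s' := by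
  funext n
  rw [← h.sum_range (M := n.degree + c + c' + 1) (by omega),
    ← h'.sum_range (M := n.degree + c + c' + 1) (by omega)]

theorem SumsTo.sub {c c' : ℕ} {x y : ℕ → FormalMap d V} {s t : FormalMap d V}
    (h : SumsTo c x s) (h' : SumsTo c' y t) :
    SumsTo (c + c') (fun k => x k - y k) (s - t) :=
  ⟨fun k n hk => by beta_reduce; rw [sub_coeff, h.1 k n (by omega), h'.1 k n (by omega), sub_zero],
    fun n => by
      simp only [sub_coeff, Finset.sum_sub_distrib]
      rw [h.sum_range (by omega), h'.sum_range (by omega)]⟩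

theorem SumsTo.shift {c : ℕ} {x : ℕ → FormalMap d V} {s : FormalMap d V} (h : SumsTo c x s)
    {y : ℕ → FormalMap d V} (h0 : y 0 = 0) (hy : ∀ k, y (k + 1) = x k) : SumsTo (c + 1) y s := by
  refine ⟨fun k n hk => ?_, fun n => ?_⟩
  · cases k with
    | zero => omega
    | succ k => rw [hy]; exact h.1 k n (by omega)
  · rw [Finset.sum_range_succ', h0]
    simp only [hy, zero_coeff, add_zero]
    exact h.sum_range (by omega)

theorem SumsTo.pderiv {c : ℕ} {x : ℕ → FormalMap d V} {s : FormalMap d V} (h : SumsTo c x s)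
    (i : Fin d) : SumsTo (c + 1) (fun k => pderiv K i (x k)) (FormalMap.pderiv K i s) := by
  refine ⟨fun k n hk => ?_, fun n => ?_⟩
  · beta_reduce; rw [pderiv_coeff, h.1 k _ (by simp; omega), smul_zero]
  · simp only [pderiv_coeff, ← Finset.smul_sum]
    rw [h.sum_range (by simp; omega)]

theorem SumsTo.bilin_right {c : ℕ} {x : ℕ → FormalMap d V} {s : FormalMap d V}
    (h : SumsTo c x s) (B : V →ₗ[K] W →ₗ[K] X) (f : FormalMap d W) :
    SumsTo c (fun k => bilin B (x k) f) (bilin B s f) := by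
  have hdeg : ∀ n : Fin d →₀ ℕ, ∀ q ∈ (Finset.HasAntidiagonal.antidiagonal n :
      Finset ((Fin d →₀ ℕ) × (Fin d →₀ ℕ))), q.1.degree ≤ n.degree := by
    intro n q hq
    rw [← Finset.HasAntidiagonal.mem_antidiagonal.1 hq, map_add]
    omega
  refine ⟨fun k n hk => ?_, fun n => ?_⟩
  · beta_reduce
    rw [bilin_coeff]
    refine Finset.sum_eq_zero fun q hq => ?_
    rw [h.1 k q.1 (by have := hdeg n q hq; omega), map_zero, LinearMap.zero_apply]
  · simp only [bilin_coeff]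
    rw [Finset.sum_comm]
    refine Finset.sum_congr rfl fun q hq => ?_
    rw [← LinearMap.sum_apply, ← map_sum, h.sum_range (by have := hdeg n q hq; omega)]

/-- The Cauchy product of two sequences. -/
def seqConv (B : V →ₗ[K] W →ₗ[K] X) (x : ℕ → V) (y : ℕ → W) (k : ℕ) : X :=
  ∑ p ∈ Finset.HasAntidiagonal.antidiagonal k, B (x p.1) (y p.2)

theorem seqConv_zero (B : V →ₗ[K] W →ₗ[K] X) (x : ℕ → V) (y : ℕ → W) :
    seqConv B x y 0 = B (x 0) (y 0) := by simp [seqConv]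

/-- If x k and y k are coefficients of s^k in auxiliary power series, multiplication by k + 1 and a
shift is d/ds, and this is its product rule. -/
theorem seqConv_succ (B : V →ₗ[K] W →ₗ[K] X) (x : ℕ → V) (y : ℕ → W) (k : ℕ) :
    ((k + 1 : ℕ) : K) • seqConv B x y (k + 1) =
      seqConv B (fun k => ((k + 1 : ℕ) : K) • x (k + 1)) y k +
        seqConv B x (fun k => ((k + 1 : ℕ) : K) • y (k + 1)) k := by
  have h1 : ∑ p ∈ Finset.HasAntidiagonal.antidiagonal (k + 1), (p.1 : K) • B (x p.1) (y p.2) =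
      seqConv B (fun k => ((k + 1 : ℕ) : K) • x (k + 1)) y k := by
    rw [Finset.Nat.sum_antidiagonal_succ]
    simp [seqConv]
  have h2 : ∑ p ∈ Finset.HasAntidiagonal.antidiagonal (k + 1), (p.2 : K) • B (x p.1) (y p.2) =
      seqConv B x (fun k => ((k + 1 : ℕ) : K) • y (k + 1)) k := by
    rw [Finset.Nat.sum_antidiagonal_succ']
    simp [seqConv]
  rw [← h1, ← h2, ← Finset.sum_add_distrib, seqConv, Finset.smul_sum]
  refine Finset.sum_congr rfl fun p hp => ?_
  rw [← add_smul, ← Nat.cast_add, Finset.HasAntidiagonal.mem_antidiagonal.1 hp]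

theorem SumsTo.conv {c c' : ℕ} {x : ℕ → FormalMap d V} {s : FormalMap d V}
    {y : ℕ → FormalMap d W} {t : FormalMap d W}
    (hx : SumsTo c x s) (hy : SumsTo c' y t) (B : V →ₗ[K] W →ₗ[K] X) :
    SumsTo (c + c') (seqConv (bilinK B) x y) (bilin B s t) := by
  have hdeg : ∀ n : Fin d →₀ ℕ, ∀ q ∈ (Finset.HasAntidiagonal.antidiagonal n :
      Finset ((Fin d →₀ ℕ) × (Fin d →₀ ℕ))), q.1.degree + q.2.degree = n.degree := by
    intro n q hq
    rw [← Finset.HasAntidiagonal.mem_antidiagonal.1 hq, map_add]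
  have hz : ∀ n : Fin d →₀ ℕ, ∀ q ∈ (Finset.HasAntidiagonal.antidiagonal n :
      Finset ((Fin d →₀ ℕ) × (Fin d →₀ ℕ))), ∀ p : ℕ × ℕ,
      (q.1.degree + c < p.1 ∨ q.2.degree + c' < p.2) → B (x p.1 q.1) (y p.2 q.2) = 0 := by
    rintro n q hq p (h | h)
    · rw [hx.1 _ _ h, map_zero, LinearMap.zero_apply]
    · rw [hy.1 _ _ h, map_zero]
  refine ⟨fun k n hk => ?_, fun n => ?_⟩
  · simp only [seqConv, sum_coeff, bilinK_apply, bilin_coeff]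
    refine Finset.sum_eq_zero fun p hp => Finset.sum_eq_zero fun q hq => hz n q hq p ?_
    have := hdeg n q hq
    have := Finset.HasAntidiagonal.mem_antidiagonal.1 hp
    omega
  · simp only [seqConv, sum_coeff, bilinK_apply, bilin_coeff]
    set M := n.degree + (c + c') + 1 with hM
    have step : ∀ F : ℕ × ℕ → X, ∑ k ∈ Finset.range M, ∑ p ∈ Finset.HasAntidiagonal.antidiagonal k, F p =
        ∑ p ∈ (Finset.range M ×ˢ Finset.range M).filter (fun p => p.1 + p.2 < M), F p := by
      intro F
      rw [← Finset.sum_fiberwise_of_maps_to (t := Finset.range M) (g := fun p : ℕ × ℕ => p.1 + p.2)]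
      · refine Finset.sum_congr rfl fun k hk => Finset.sum_congr ?_ fun _ _ => rfl
        ext p
        simp only [Finset.HasAntidiagonal.mem_antidiagonal, Finset.mem_filter, Finset.mem_product,
          Finset.mem_range] at hk ⊢
        omega
      · intro p hp
        simp only [Finset.mem_filter] at hp
        simpa using hp.2
    rw [step, Finset.sum_comm]
    refine Finset.sum_congr rfl fun q hq => ?_
    have hd := hdeg n q hq
    rw [← hx.2 q.1, ← hy.2 q.2, LinearMap.map_sum₂]
    simp only [map_sum]
    rw [← Finset.sum_product' (f := fun a b => B (x a q.1) (y b q.2))]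
    symm
    -- The box of index pairs allowed by the orders of x and y lies in the triangle of the Cauchy
    -- product; every term of the triangle outside the box vanishes.
    refine Finset.sum_subset ?_ ?_
    · intro p hp
      simp only [Finset.mem_filter, Finset.mem_product, Finset.mem_range] at hp ⊢
      omega
    · intro p hp hp'
      refine hz n q hq p ?_
      simp only [Finset.mem_product, Finset.mem_range] at hp'
      omega

theorem eval_eq_bilin (Φ : FormalMap d (V →ₗ[K] W)) (f : FormalMap d V) :
    eval Φ f = bilin LinearMap.id Φ f := rfl

theorem eval_map (ρ : U →ₗ[K] V →ₗ[K] W) (S : FormalMap d U) (f : FormalMap d V) :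
    eval (map ρ S) f = bilin ρ S f := rfl

theorem eval_one (f : FormalMap d V) : eval (1 : FormalMap d (Module.End K V)) f = f := by
  have : (1 : FormalMap d (Module.End K V)) = const d 1 := by
    funext n; exact MvPowerSeries.coeff_one n
  rw [this, eval_eq_bilin, bilin_const_left]
  rfl

theorem eval_mul (Φ Ψ : FormalMap d (Module.End K V)) (f : FormalMap d V) :
    eval (Φ * Ψ) f = eval Φ (eval Ψ f) := by
  have : Φ * Ψ = bilin (LinearMap.mul K (Module.End K V)) Φ Ψ := by
    funext n; exact MvPowerSeries.coeff_mul n Φ Ψ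
  rw [this]
  exact bilin_assoc _ _ _ _ (fun u v w => rfl) _ _ _

theorem eval_pow_succ (Φ : FormalMap d (Module.End K V)) (k : ℕ) (f : FormalMap d V) :
    eval (Φ ^ (k + 1) : MvPowerSeries _ _) f = eval Φ (eval (Φ ^ k : MvPowerSeries _ _) f) := by
  rw [pow_succ', eval_mul]

theorem pow_coeff_eq_zero {Φ : FormalMap d (Module.End K V)} (h0 : Φ 0 = 0) (k : ℕ) :
    ∀ n : Fin d →₀ ℕ, n.degree < k → (Φ ^ k : MvPowerSeries _ _) n = 0 := by
  induction k with
  | zero => intro n hn; omega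
  | succ k ih =>
    intro n hn
    rw [pow_succ']
    refine (MvPowerSeries.coeff_mul n Φ _).trans (Finset.sum_eq_zero fun q hq => ?_)
    by_cases hq1 : q.1 = 0
    · rw [MvPowerSeries.coeff_apply, hq1, h0, zero_mul]
    · rw [MvPowerSeries.coeff_apply (Φ ^ k), ih q.2, mul_zero]
      have h1 := congrArg Finsupp.degree (Finset.HasAntidiagonal.mem_antidiagonal.1 hq)
      rw [map_add] at h1
      have h2 : q.1.degree ≠ 0 := by simpa [Finsupp.degree_eq_zero_iff] using hq1
      omega

theorem sumsTo_powerSum {Φ : FormalMap d (Module.End K V)} (h0 : Φ 0 = 0) (c : ℕ → K) :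
    SumsTo 0 (fun k => c k • (Φ ^ k : MvPowerSeries _ _)) (powerSum c Φ) :=
  ⟨fun k n hk => by
    beta_reduce
    rw [smul_coeff, pow_coeff_eq_zero h0 k n (by omega), smul_zero], fun n => rfl⟩

theorem sumsTo_eval_powerSum {Φ : FormalMap d (Module.End K V)} (h0 : Φ 0 = 0) (c : ℕ → K)
    (f : FormalMap d V) :
    SumsTo 0 (fun k => c k • eval (Φ ^ k : MvPowerSeries _ _) f) (eval (powerSum c Φ) f) := by
  have := (sumsTo_powerSum h0 c).bilin_right LinearMap.id f
  simp only [bilin_smul_left] at this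
  exact this

end Sequences

/-! ### Logarithmic derivatives of exponentials and the Maurer-Cartan equation -/

section LogDeriv

variable {K : Type*} [Field K] {g : Type*} [LieRing g] [LieAlgebra K g] {d : ℕ}
  {V : Type*} [AddCommGroup V] [Module K V]

variable (K g) in
/-- The bracket of `g` as a bilinear map. -/
def lieBilin : g →ₗ[K] g →ₗ[K] g := (LieAlgebra.ad K g : g →ₗ[K] Module.End K g)

@[simp] theorem lieBilin_apply (x y : g) : lieBilin K g x y = ⁅x, y⁆ := rfl

/-- The `i`-th component of the right logarithmic derivative of `e^S`. -/
noncomputable def logDeriv (S : FormalMap d g) (i : Fin d) : FormalMap d g :=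
  eval (expSubOneDiv (K := K) (adFormal S)) (pderiv K i S)

/-- A representation of a Lie algebra, as a linear map. -/
def IsRep (ρ : g →ₗ[K] Module.End K V) : Prop := ∀ x y, ρ ⁅x, y⁆ = ρ x * ρ y - ρ y * ρ x

theorem isRep_ad : IsRep (LieAlgebra.ad K g : g →ₗ[K] Module.End K g) := by
  intro x y; ext z; simp

theorem rep_leibniz {ρ : g →ₗ[K] Module.End K V} (hρ : IsRep ρ) (S a : FormalMap d g)
    (f : FormalMap d V) : bilin ρ S (bilin ρ a f) =
      bilin ρ (bilin (lieBilin K g) S a) f + bilin ρ a (bilin ρ S f) :=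
  bilin_leibniz ρ ρ ρ (lieBilin K g) ρ ρ (fun u v w => by simp [hρ u v]) S a f

/-- The terms of the exponential series of `S` in the representation `ρ`. -/
noncomputable def expTerm (ρ : g →ₗ[K] Module.End K V) (S : FormalMap d g) (f : FormalMap d V)
    (k : ℕ) : FormalMap d V :=
  (k.factorial : K)⁻¹ • eval (map ρ S ^ k : MvPowerSeries _ _) f

theorem expTerm_zero (ρ : g →ₗ[K] Module.End K V) (S : FormalMap d g) (f : FormalMap d V) :
    expTerm ρ S f 0 = f := by simp [expTerm, eval_one]

/-- The terms of the series of the right logarithmic derivative. -/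
noncomputable def logTerm (S : FormalMap d g) (i : Fin d) : ℕ → FormalMap d g
  -- The shift by one makes term k the coefficient of s^k in the logarithmic derivative of e^{sS},
  -- which vanishes at s = 0.
  | 0 => 0
  | k + 1 => ((k + 1).factorial : K)⁻¹ • eval (adFormal (K := K) S ^ k : MvPowerSeries _ _)
      (pderiv K i S)

theorem sumsTo_expTerm (ρ : g →ₗ[K] Module.End K V) {S : FormalMap d g} (h0 : S 0 = 0)
    (f : FormalMap d V) : SumsTo 0 (expTerm ρ S f) (eval (exp (map ρ S)) f) :=
  sumsTo_eval_powerSum (by simp [h0]) _ _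

theorem sumsTo_logTerm {S : FormalMap d g} (h0 : S 0 = 0) (i : Fin d) :
    SumsTo 1 (logTerm (K := K) S i) (logDeriv (K := K) S i) :=
  (sumsTo_eval_powerSum (by simp [adFormal, h0]) (fun k => ((k + 1).factorial : K)⁻¹)
    (pderiv K i S)).shift rfl (fun k => rfl)

variable [CharZero K]

theorem factorial_smul {E : Type*} [AddCommGroup E] [Module K E] (k : ℕ) (x : E) :
    ((k + 1 : ℕ) : K) • ((k + 1).factorial : K)⁻¹ • x = (k.factorial : K)⁻¹ • x := by
  rw [smul_smul, Nat.factorial_succ, Nat.cast_mul, mul_inv, ← mul_assoc,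
    mul_inv_cancel₀ (Nat.cast_ne_zero.2 (Nat.succ_ne_zero k)), one_mul]

/-- The equation d/ds (e^{sS} f) = S · e^{sS} f, in powers of s. -/
theorem expTerm_succ (ρ : g →ₗ[K] Module.End K V) (S : FormalMap d g) (f : FormalMap d V)
    (k : ℕ) : ((k + 1 : ℕ) : K) • expTerm ρ S f (k + 1) = bilin ρ S (expTerm ρ S f k) := by
  rw [expTerm, factorial_smul, eval_pow_succ, eval_map, expTerm, bilin_smul_right]

/-- The equation da/ds = [S, a] + ∂_i S for the logarithmic derivative a of e^{sS}, in powers of s;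
the inhomogeneous term only enters at k = 0. -/
theorem logTerm_succ (S : FormalMap d g) (i : Fin d) (k : ℕ) :
    ((k + 1 : ℕ) : K) • logTerm (K := K) S i (k + 1) =
      bilin (lieBilin K g) S (logTerm (K := K) S i k) + if k = 0 then pderiv K i S else 0 := by
  rw [logTerm, factorial_smul]
  cases k with
  | zero => simp [logTerm, eval_one]
  | succ k => rw [eval_pow_succ, logTerm, bilin_smul_right]; simp; rfl

theorem seqConv_logTerm {W X : Type*} [AddCommGroup W] [Module K W] [AddCommGroup X] [Module K X]
    (B : FormalMap d g →ₗ[K] W →ₗ[K] X) (S : FormalMap d g) (i : Fin d) (y : ℕ → W) (k : ℕ) :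
    seqConv B (fun k => ((k + 1 : ℕ) : K) • logTerm (K := K) S i (k + 1)) y k =
      seqConv B (fun k => bilin (lieBilin K g) S (logTerm (K := K) S i k)) y k +
        B (pderiv K i S) (y k) := by
  simp only [logTerm_succ, seqConv, map_add, LinearMap.add_apply, Finset.sum_add_distrib]
  congr 1
  rw [Finset.sum_eq_single (0, k)]
  · simp
  · rintro ⟨p, q⟩ hpq hne
    have : p ≠ 0 := by
      rintro rfl
      exact hne (by simpa using hpq)
    simp [this]
  · intro h; simp at h

/-- With a_s the logarithmic derivative of e^{sS}, both e^{sS} ∂f and ∂(e^{sS} f) - a_s · e^{sS} f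
solve y' = S · y with y = ∂f at s = 0. The induction on k is uniqueness for this equation. -/
theorem expTerm_pderiv {ρ : g →ₗ[K] Module.End K V} (hρ : IsRep ρ) (S : FormalMap d g)
    (f : FormalMap d V) (i : Fin d) (k : ℕ) :
    expTerm ρ S (pderiv K i f) k = pderiv K i (expTerm ρ S f k) -
      seqConv (bilinK ρ) (logTerm (K := K) S i) (expTerm ρ S f) k := by
  induction k with
  | zero => simp [expTerm_zero, seqConv_zero, logTerm]
  | succ k ih =>
    have hk : ((k + 1 : ℕ) : K) ≠ 0 := Nat.cast_ne_zero.2 (Nat.succ_ne_zero k)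
    apply smul_right_injective _ hk
    simp only [smul_sub]
    rw [expTerm_succ, ih, ← pderiv_smul, expTerm_succ, seqConv_succ, seqConv_logTerm,
      pderiv_bilin]
    simp only [expTerm_succ, bilin_sub_right, bilinK_apply]
    have : bilin ρ S (seqConv (bilinK ρ) (logTerm (K := K) S i) (expTerm ρ S f) k) =
        seqConv (bilinK ρ) (fun k => bilin (lieBilin K g) S (logTerm (K := K) S i k))
          (expTerm ρ S f) k +
        seqConv (bilinK ρ) (logTerm (K := K) S i) (fun k => bilin ρ S (expTerm ρ S f k)) k := by
      simp only [seqConv, bilin_sum_right, bilinK_apply, ← Finset.sum_add_distrib]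
      exact Finset.sum_congr rfl fun p _ => rep_leibniz hρ _ _ _
    rw [this]
    abel

/-- The derivative of the exponential in a representation. -/
theorem pderiv_eval_exp {ρ : g →ₗ[K] Module.End K V} (hρ : IsRep ρ) {S : FormalMap d g}
    (h0 : S 0 = 0) (f : FormalMap d V) (i : Fin d) :
    pderiv K i (eval (exp (map ρ S)) f) =
      eval (exp (map ρ S)) (pderiv K i f) +
        bilin ρ (logDeriv (K := K) S i) (eval (exp (map ρ S)) f) := by
  have h1 := sumsTo_expTerm ρ h0 (pderiv K i f)
  have h2 := (SumsTo.pderiv (K := K) (sumsTo_expTerm ρ h0 f) i).sub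
    ((sumsTo_logTerm (K := K) h0 i).conv (sumsTo_expTerm ρ h0 f) ρ)
  rw [← funext (expTerm_pderiv (K := K) hρ S f i)] at h2
  rw [h1.unique h2]
  abel

/-- Both sides solve c' = [S, c] + [∂_i S, a_j] + [a_i, ∂_j S] with c = 0 at s = 0; for the left
side the second derivatives of S cancel, for the right side the Jacobi identity is used. -/
theorem logTerm_pderiv (S : FormalMap d g) (i j : Fin d) (k : ℕ) :
    pderiv K i (logTerm (K := K) S j k) - pderiv K j (logTerm (K := K) S i k) =
      seqConv (bilinK (lieBilin K g)) (logTerm (K := K) S i) (logTerm (K := K) S j) k := by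
  induction k with
  | zero => simp [seqConv_zero, logTerm]
  | succ k ih =>
    have hk : ((k + 1 : ℕ) : K) ≠ 0 := Nat.cast_ne_zero.2 (Nat.succ_ne_zero k)
    apply smul_right_injective _ hk
    have hflip : ∀ x y : FormalMap d g, bilin (lieBilin K g) x y = -bilin (lieBilin K g) y x := by
      intro x y
      rw [← bilin_flip]
      funext n
      simp [bilin_coeff, ← Finset.sum_neg_distrib]
    have h1 : seqConv (bilinK (lieBilin K g)) (logTerm (K := K) S i)
        (fun k => ((k + 1 : ℕ) : K) • logTerm (K := K) S j (k + 1)) k =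
        seqConv (bilinK (lieBilin K g)) (logTerm (K := K) S i)
          (fun k => bilin (lieBilin K g) S (logTerm (K := K) S j k)) k +
        bilin (lieBilin K g) (logTerm (K := K) S i k) (pderiv K j S) := by
      simp only [logTerm_succ, seqConv, map_add, Finset.sum_add_distrib]
      congr 1
      rw [Finset.sum_eq_single (k, 0)]
      · simp [bilinK_apply]
      · rintro ⟨p, q⟩ hpq hne
        have : q ≠ 0 := by
          rintro rfl
          exact hne (by simpa using hpq)
        simp [this]
      · intro h; simp at h
    have h2 : bilin (lieBilin K g) S (seqConv (bilinK (lieBilin K g)) (logTerm (K := K) S i)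
        (logTerm (K := K) S j) k) =
        seqConv (bilinK (lieBilin K g)) (fun k => bilin (lieBilin K g) S (logTerm (K := K) S i k))
          (logTerm (K := K) S j) k +
        seqConv (bilinK (lieBilin K g)) (logTerm (K := K) S i)
          (fun k => bilin (lieBilin K g) S (logTerm (K := K) S j k)) k := by
      simp only [seqConv, bilin_sum_right, bilinK_apply, ← Finset.sum_add_distrib]
      exact Finset.sum_congr rfl fun p _ => rep_leibniz isRep_ad _ _ _
    simp only [smul_sub]
    rw [← pderiv_smul, ← pderiv_smul, logTerm_succ, logTerm_succ, seqConv_succ, seqConv_logTerm,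
      h1, pderiv_add, pderiv_add, pderiv_bilin, pderiv_bilin]
    have h3 : pderiv K i (if k = 0 then pderiv K j S else 0) =
        pderiv K j (if k = 0 then pderiv K i S else 0) := by
      split_ifs
      · exact pderiv_comm _ _ _
      · simp
    rw [h3, bilinK_apply, hflip (logTerm (K := K) S i k)]
    rw [← ih, bilin_sub_right] at h2
    rw [← sub_eq_zero] at h2 ⊢
    rw [← h2]
    abel

/-- The Maurer-Cartan equation for the right logarithmic derivative. -/
theorem pderiv_logDeriv {S : FormalMap d g} (h0 : S 0 = 0) (i j : Fin d) :
    pderiv K i (logDeriv (K := K) S j) - pderiv K j (logDeriv (K := K) S i) =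
      bilin (lieBilin K g) (logDeriv (K := K) S i) (logDeriv (K := K) S j) := by
  have h1 := (SumsTo.pderiv (K := K) (sumsTo_logTerm (K := K) h0 j) i).sub
    (SumsTo.pderiv (K := K) (sumsTo_logTerm (K := K) h0 i) j)
  have h2 := (sumsTo_logTerm (K := K) h0 i).conv (sumsTo_logTerm (K := K) h0 j) (lieBilin K g)
  rw [← funext (logTerm_pderiv (K := K) S i j)] at h2
  exact h1.unique h2

end LogDeriv

end FormalMap

namespace FormalMap

/-! ### Filtration by degree, fixed points and the Euler derivation -/

section Order

variable {K : Type*} [Field K] {d : ℕ}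
  {V W X : Type*} [AddCommGroup V] [Module K V] [AddCommGroup W] [Module K W]
  [AddCommGroup X] [Module K X]

/-- `f` has no terms of degree less than `N`. -/
def OrderGE (N : ℕ) (f : FormalMap d V) : Prop := ∀ n, Finsupp.degree n < N → f n = 0

theorem OrderGE.mono {N N' : ℕ} {f : FormalMap d V} (h : OrderGE N f) (hN : N' ≤ N) :
    OrderGE N' f := fun n hn => h n (by omega)

theorem orderGE_of_zero (f : FormalMap d V) : OrderGE 0 f := fun _ hn => absurd hn (by omega)

theorem orderGE_one {f : FormalMap d V} (h : f 0 = 0) : OrderGE 1 f := fun n hn => by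
  rw [(Finsupp.degree_eq_zero_iff n).1 (by omega), h]

theorem OrderGE.add {N : ℕ} {f h : FormalMap d V} (hf : OrderGE N f) (hh : OrderGE N h) :
    OrderGE N (f + h) := fun n hn => by rw [add_coeff, hf n hn, hh n hn, add_zero]

theorem OrderGE.neg {N : ℕ} {f : FormalMap d V} (hf : OrderGE N f) :
    OrderGE N (-f) := fun n hn => by rw [neg_coeff, hf n hn, neg_zero]

theorem OrderGE.sub {N : ℕ} {f h : FormalMap d V} (hf : OrderGE N f) (hh : OrderGE N h) :
    OrderGE N (f - h) := fun n hn => by rw [sub_coeff, hf n hn, hh n hn, sub_zero]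

theorem OrderGE.sum {ι : Type*} {N : ℕ} (s : Finset ι) {f : ι → FormalMap d V}
    (hf : ∀ i ∈ s, OrderGE N (f i)) : OrderGE N (∑ i ∈ s, f i) := fun n hn => by
  rw [sum_coeff]
  exact Finset.sum_eq_zero fun i hi => hf i hi n hn

theorem OrderGE.map {N : ℕ} {f : FormalMap d V} (hf : OrderGE N f) (T : V →ₗ[K] W) :
    OrderGE N (FormalMap.map T f) := fun n hn => by rw [map_coeff, hf n hn, map_zero]

theorem OrderGE.bilin {N M : ℕ} {f : FormalMap d V} {h : FormalMap d W} (hf : OrderGE N f)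
    (hh : OrderGE M h) (B : V →ₗ[K] W →ₗ[K] X) : OrderGE (N + M) (bilin B f h) := fun n hn => by
  rw [bilin_coeff]
  refine Finset.sum_eq_zero fun q hq => ?_
  have hd := congrArg Finsupp.degree (Finset.HasAntidiagonal.mem_antidiagonal.1 hq)
  rw [map_add] at hd
  by_cases h1 : q.1.degree < N
  · rw [hf _ h1, map_zero, LinearMap.zero_apply]
  · rw [hh q.2 (by omega), map_zero]

theorem OrderGE.pderiv {N : ℕ} {f : FormalMap d V} (hf : OrderGE (N + 1) f) (i : Fin d) :
    OrderGE N (pderiv K i f) := fun n hn => by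
  rw [pderiv_coeff, hf _ (by simpa using hn), smul_zero]

theorem OrderGE.X_smul {N : ℕ} {f : FormalMap d V} (hf : OrderGE N f) (i : Fin d) :
    OrderGE (N + 1) ((MvPowerSeries.X i : FormalMap d K) • f) := by
  rw [add_comm]
  exact (orderGE_one (f := (MvPowerSeries.X i : FormalMap d K))
    (MvPowerSeries.coeff_zero_X i)).bilin hf _

theorem eq_zero_of_orderGE {f : FormalMap d V} (h : ∀ N, OrderGE N f) : f = 0 :=
  funext fun n => h (n.degree + 1) n (by omega)

/-- `f` and `h` have the same terms of degree less than `N`. -/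
def AgreeTo (N : ℕ) (f h : FormalMap d V) : Prop := OrderGE N (f - h)

theorem agreeTo_iff {N : ℕ} {f h : FormalMap d V} :
    AgreeTo N f h ↔ ∀ n, Finsupp.degree n < N → f n = h n := by
  simp only [AgreeTo, OrderGE, sub_coeff, sub_eq_zero]

theorem AgreeTo.refl (N : ℕ) (f : FormalMap d V) : AgreeTo N f f := agreeTo_iff.2 fun _ _ => rfl

theorem AgreeTo.symm {N : ℕ} {f h : FormalMap d V} (H : AgreeTo N f h) : AgreeTo N h f :=
  agreeTo_iff.2 fun n hn => (agreeTo_iff.1 H n hn).symm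

theorem AgreeTo.trans {N : ℕ} {f h k : FormalMap d V} (H : AgreeTo N f h) (H' : AgreeTo N h k) :
    AgreeTo N f k :=
  agreeTo_iff.2 fun n hn => (agreeTo_iff.1 H n hn).trans (agreeTo_iff.1 H' n hn)

theorem AgreeTo.mono {N N' : ℕ} {f h : FormalMap d V} (H : AgreeTo N f h) (hN : N' ≤ N) :
    AgreeTo N' f h := OrderGE.mono H hN

theorem AgreeTo.add {N : ℕ} {f f' h h' : FormalMap d V} (H : AgreeTo N f f')
    (H' : AgreeTo N h h') : AgreeTo N (f + h) (f' + h') :=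
  agreeTo_iff.2 fun n hn => by
    rw [add_coeff, add_coeff, agreeTo_iff.1 H n hn, agreeTo_iff.1 H' n hn]

theorem AgreeTo.sub {N : ℕ} {f f' h h' : FormalMap d V} (H : AgreeTo N f f')
    (H' : AgreeTo N h h') : AgreeTo N (f - h) (f' - h') :=
  agreeTo_iff.2 fun n hn => by
    rw [sub_coeff, sub_coeff, agreeTo_iff.1 H n hn, agreeTo_iff.1 H' n hn]

theorem AgreeTo.map {N : ℕ} {f h : FormalMap d V} (H : AgreeTo N f h) (T : V →ₗ[K] W) :
    AgreeTo N (FormalMap.map T f) (FormalMap.map T h) :=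
  agreeTo_iff.2 fun n hn => by rw [map_coeff, map_coeff, agreeTo_iff.1 H n hn]

theorem AgreeTo.bilin {N : ℕ} {f f' : FormalMap d V} {h h' : FormalMap d W}
    (H : AgreeTo N f f') (H' : AgreeTo N h h') (B : V →ₗ[K] W →ₗ[K] X) :
    AgreeTo N (FormalMap.bilin B f h) (FormalMap.bilin B f' h') := by
  have : FormalMap.bilin B f h - FormalMap.bilin B f' h' =
      FormalMap.bilin B (f - f') h + FormalMap.bilin B f' (h - h') := by
    rw [bilin_sub_left, bilin_sub_right]; abel
  rw [AgreeTo, this]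
  exact (OrderGE.bilin H (orderGE_of_zero h) B).add
    ((OrderGE.bilin (orderGE_of_zero f') H' B).mono (by omega))

theorem AgreeTo.pderiv {N : ℕ} {f h : FormalMap d V} (H : AgreeTo (N + 1) f h) (i : Fin d) :
    AgreeTo N (FormalMap.pderiv K i f) (FormalMap.pderiv K i h) := by
  rw [AgreeTo, ← pderiv_sub]
  exact OrderGE.pderiv H i

theorem AgreeTo.pow {N : ℕ} {Φ Ψ : FormalMap d (Module.End K V)} (H : AgreeTo N Φ Ψ) (k : ℕ) :
    AgreeTo N (Φ ^ k : MvPowerSeries _ _) (Ψ ^ k : MvPowerSeries _ _) := by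
  induction k with
  | zero => rw [pow_zero, pow_zero]; exact AgreeTo.refl _ _
  | succ k ih =>
    have : ∀ Φ Ψ : FormalMap d (Module.End K V),
        Φ * Ψ = FormalMap.bilin (LinearMap.mul K (Module.End K V)) Φ Ψ := fun Φ Ψ => by
      funext n; exact MvPowerSeries.coeff_mul n Φ Ψ
    rw [pow_succ, pow_succ, this, this]
    exact ih.bilin H _

theorem AgreeTo.powerSum {N : ℕ} {Φ Ψ : FormalMap d (Module.End K V)} (H : AgreeTo N Φ Ψ)
    (c : ℕ → K) : AgreeTo N (powerSum c Φ) (powerSum c Ψ) :=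
  agreeTo_iff.2 fun n hn => Finset.sum_congr rfl fun k _ => by
    rw [agreeTo_iff.1 (H.pow k) n hn]

theorem end_one_eq_const : (1 : FormalMap d (Module.End K V)) = const d 1 := by
  funext n; exact MvPowerSeries.coeff_one n

theorem powerSum_coeff_zero (c : ℕ → K) (Φ : FormalMap d (Module.End K V)) :
    powerSum c Φ 0 = c 0 • 1 := by
  simp [powerSum, end_one_eq_const]

/-- Contraction principle for the degree filtration: in the iterates of 0 the coefficient of
exponent n no longer changes from step |n| + 1 on. -/
theorem exists_fixedPoint (Ψ : FormalMap d V → FormalMap d V)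
    (hΨ : ∀ N f h, AgreeTo N f h → AgreeTo (N + 1) (Ψ f) (Ψ h)) : ∃ f, Ψ f = f := by
  let T : ℕ → FormalMap d V := fun k => Ψ^[k] 0
  have hT : ∀ k, T (k + 1) = Ψ (T k) := fun k => Function.iterate_succ_apply' Ψ k 0
  have h1 : ∀ k, AgreeTo k (T k) (T (k + 1)) := by
    intro k
    induction k with
    | zero => exact orderGE_of_zero _
    | succ k ih => rw [hT k, hT (k + 1)]; exact hΨ _ _ _ ih
  have h2 : ∀ k j, AgreeTo k (T k) (T (k + j)) := by
    intro k j
    induction j with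
    | zero => exact AgreeTo.refl _ _
    | succ j ih => exact ih.trans ((h1 (k + j)).mono (by omega))
  refine ⟨fun n => T (n.degree + 1) n, ?_⟩
  have h3 : ∀ k, AgreeTo k (fun n => T (n.degree + 1) n) (T k) := by
    intro k
    refine agreeTo_iff.2 fun n hn => ?_
    obtain ⟨j, rfl⟩ := Nat.exists_eq_add_of_le (Nat.succ_le_of_lt hn)
    exact agreeTo_iff.1 (h2 (n.degree + 1) j) n (by omega)
  funext n
  have := agreeTo_iff.1 (hΨ _ _ _ (h3 n.degree)) n (by omega)
  rw [this, ← hT]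

/-- The Euler derivation. -/
noncomputable def euler (f : FormalMap d V) : FormalMap d V :=
  ∑ i, (MvPowerSeries.X i : FormalMap d K) • pderiv K i f

theorem euler_coeff (f : FormalMap d V) (n : Fin d →₀ ℕ) :
    euler (K := K) f n = (n.degree : K) • f n := by
  have key : ∀ i, ((MvPowerSeries.X i : FormalMap d K) • pderiv K i f) n = (n i : K) • f n := by
    intro i
    rw [function_smul_def, bilin_pderiv_right, Finset.sum_eq_single (Finsupp.single i 1, n)]
    · have : (MvPowerSeries.X i : FormalMap d K) (Finsupp.single i 1) = 1 :=
        MvPowerSeries.coeff_index_single_self_X i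
      simp [this]
    · rintro ⟨p, q⟩ hpq hne
      have hp : p ≠ Finsupp.single i 1 := by
        rintro rfl
        have := Finset.HasAntidiagonal.mem_antidiagonal.1 hpq
        simp only at this
        rw [add_comm] at this
        exact hne (by rw [add_right_cancel this])
      have : (MvPowerSeries.X i : FormalMap d K) p = 0 := by
        classical
        have := MvPowerSeries.coeff_X (R := K) p i
        rw [if_neg hp] at this
        exact this
      simp [this]
    · intro h
      exact absurd (Finset.HasAntidiagonal.mem_antidiagonal.2 (add_comm _ _)) h
  rw [euler, sum_coeff, Finset.sum_congr rfl fun i _ => key i, ← Finset.sum_smul,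
    Finsupp.degree_eq_sum]
  push_cast
  rfl

theorem AgreeTo.euler {N : ℕ} {f h : FormalMap d V} (H : AgreeTo N f h) :
    AgreeTo N (FormalMap.euler (K := K) f) (FormalMap.euler (K := K) h) :=
  agreeTo_iff.2 fun n hn => by rw [euler_coeff, euler_coeff, agreeTo_iff.1 H n hn]

theorem euler_coeff_zero (f : FormalMap d V) : euler (K := K) f 0 = 0 := by
  simp [euler_coeff]

end Order

/-! ### Integration of solutions of the Maurer-Cartan equation -/

section Integration

variable {K : Type*} [Field K] [CharZero K] {g : Type*} [LieRing g] [LieAlgebra K g] {d : ℕ}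

theorem sum_X_smul_logDeriv (S : FormalMap d g) :
    ∑ i, (MvPowerSeries.X i : FormalMap d K) • logDeriv (K := K) S i =
      eval (expSubOneDiv (K := K) (adFormal S)) (euler (K := K) S) := by
  rw [euler, eval_eq_bilin, bilin_sum_right]
  refine Finset.sum_congr rfl fun i _ => ?_
  rw [bilin_function_smul_right]
  rfl

theorem AgreeTo.adFormal {N : ℕ} {S S' : FormalMap d g} (H : AgreeTo N S S') :
    AgreeTo N (adFormal (K := K) S) (_root_.adFormal (K := K) S') := H.map _

/-- The radial component of the logarithmic derivative is the Euler derivative of S plus an error.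
Neither (e^{ad S} - 1)/ad S - 1 nor the Euler derivative has a constant term, so the error at one
degree only depends on S in lower degrees. This drives both existence and uniqueness of logarithms.
-/
theorem AgreeTo.eval_expSubOneDiv_euler {N : ℕ} {S S' : FormalMap d g} (H : AgreeTo N S S') :
    AgreeTo (N + 1)
      (eval (expSubOneDiv (K := K) (_root_.adFormal S)) (FormalMap.euler (K := K) S) -
        FormalMap.euler (K := K) S)
      (eval (expSubOneDiv (K := K) (_root_.adFormal S')) (FormalMap.euler (K := K) S') -
        FormalMap.euler (K := K) S') := by
  set φ := expSubOneDiv (K := K) (_root_.adFormal S) with hφ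
  set φ' := expSubOneDiv (K := K) (_root_.adFormal S') with hφ'
  have h1 : OrderGE N (φ - φ') := H.adFormal.powerSum _
  have h2 : OrderGE 1 (φ' - 1) := orderGE_one (by
    rw [sub_coeff, hφ', expSubOneDiv, powerSum_coeff_zero]
    simp [end_one_eq_const])
  have h3 : OrderGE N (FormalMap.euler (K := K) S - FormalMap.euler (K := K) S') := H.euler
  have h4 : OrderGE 1 (FormalMap.euler (K := K) S) := orderGE_one (euler_coeff_zero S)
  have key : eval φ (FormalMap.euler (K := K) S) - FormalMap.euler (K := K) S -
      (eval φ' (FormalMap.euler (K := K) S') - FormalMap.euler (K := K) S') =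
      eval (φ - φ') (FormalMap.euler (K := K) S) +
        eval (φ' - 1) (FormalMap.euler (K := K) S - FormalMap.euler (K := K) S') := by
    have h1 : ∀ f : FormalMap d g, eval (φ' - 1) f = eval φ' f - f := fun f => by
      conv_rhs => rw [← eval_one (K := K) f, ← eval_mul, mul_one]
      exact bilin_sub_left _ _ _ _
    rw [h1]
    simp only [eval_eq_bilin, bilin_sub_left, bilin_sub_right]
    abel
  rw [AgreeTo, key]
  exact (h1.bilin h4 _).add ((h2.bilin h3 _).mono (by omega))

theorem agreeTo_of_euler {V : Type*} [AddCommGroup V] [Module K V] {N : ℕ} {f h : FormalMap d V}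
    (H : AgreeTo N (euler (K := K) f) (euler (K := K) h)) (h0 : f 0 = h 0) : AgreeTo N f h :=
  agreeTo_iff.2 fun n hn => by
    by_cases hn0 : n = 0
    · rw [hn0, h0]
    · have := agreeTo_iff.1 H n hn
      rw [euler_coeff, euler_coeff] at this
      refine smul_right_injective _ ?_ this
      rw [Nat.cast_ne_zero]
      exact fun h => hn0 ((Finsupp.degree_eq_zero_iff n).1 h)

/-- A formal map without constant term is determined by the right logarithmic derivative of its
exponential, degree by degree. -/
theorem agreeTo_of_logDeriv {S S' : FormalMap d g} (h0 : S 0 = 0) (h0' : S' 0 = 0) {N : ℕ}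
    (H : ∀ i, AgreeTo N (logDeriv (K := K) S i) (logDeriv (K := K) S' i)) :
    AgreeTo (N + 1) S S' := by
  have hc : AgreeTo (N + 1) (eval (expSubOneDiv (K := K) (adFormal S)) (euler (K := K) S))
      (eval (expSubOneDiv (K := K) (adFormal S')) (euler (K := K) S')) := by
    rw [← sum_X_smul_logDeriv, ← sum_X_smul_logDeriv, AgreeTo, ← Finset.sum_sub_distrib]
    refine OrderGE.sum _ fun i _ => ?_
    rw [← smul_sub]
    exact OrderGE.X_smul (H i) i
  -- The radial components agree to order N + 1. If S and S' agree to order M, the error terms agree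
  -- to order M + 1, hence so do the Euler derivatives, which determine all coefficients but the
  -- constant one.
  suffices h : ∀ M ≤ N + 1, AgreeTo M S S' from h _ le_rfl
  intro M
  induction M with
  | zero => intro _; exact orderGE_of_zero _
  | succ M ih =>
    intro hM
    have h1 := AgreeTo.eval_expSubOneDiv_euler (K := K) (ih (by omega))
    have h2 := (hc.mono hM).sub h1
    simp only [sub_sub_cancel] at h2
    exact agreeTo_of_euler h2 (h0.trans h0'.symm)

theorem eq_of_logDeriv {S S' : FormalMap d g} (h0 : S 0 = 0) (h0' : S' 0 = 0)
    (H : ∀ i, logDeriv (K := K) S i = logDeriv (K := K) S' i) : S = S' :=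
  sub_eq_zero.1 (eq_zero_of_orderGE fun N => OrderGE.mono (agreeTo_of_logDeriv (K := K) h0 h0'
    (N := N) fun i => by rw [H i]; exact AgreeTo.refl _ _) (by omega))

theorem pderiv_X (i j : Fin d) : pderiv K i (MvPowerSeries.X j : FormalMap d K) =
    if i = j then 1 else 0 := by
  classical
  funext n
  rw [pderiv_coeff]
  have h1 := MvPowerSeries.coeff_X (R := K) (n + Finsupp.single i 1) j
  rw [MvPowerSeries.coeff_apply] at h1
  rw [h1]
  by_cases hij : i = j
  · subst hij
    have h2 := MvPowerSeries.coeff_one (R := K) n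
    rw [MvPowerSeries.coeff_apply] at h2
    rw [if_pos rfl, h2]
    by_cases hn : n = 0
    · simp [hn]
    · simp [hn]
  · rw [if_neg hij, if_neg, smul_zero]
    · rfl
    · intro h
      have h3 := DFunLike.congr_fun h i
      simp [Finsupp.single_apply, Ne.symm hij] at h3

/-- Two solutions of the Maurer-Cartan equation with the same radial component are equal. -/
theorem maurerCartan_unique {a a' : Fin d → FormalMap d g}
    (ha : ∀ i j, pderiv K i (a j) - pderiv K j (a i) = bilin (lieBilin K g) (a i) (a j))
    (ha' : ∀ i j, pderiv K i (a' j) - pderiv K j (a' i) = bilin (lieBilin K g) (a' i) (a' j))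
    (H : ∑ i, (MvPowerSeries.X i : FormalMap d K) • a i =
      ∑ i, (MvPowerSeries.X i : FormalMap d K) • a' i) : a = a' := by
  -- Write c for the common radial component. Contracting the difference of the two Maurer-Cartan
  -- equations with the radial field, and differentiating the equality of radial components, gives
  -- (E + 1)(a_j - a'_j) = [c, a_j - a'_j], with E the Euler derivation.
  have h1 : ∀ j, euler (K := K) (a j - a' j) + (a j - a' j) = bilin (lieBilin K g)
      (∑ i, (MvPowerSeries.X i : FormalMap d K) • a i) (a j - a' j) := by
    intro j
    have h2 : pderiv K j (∑ i, (MvPowerSeries.X i : FormalMap d K) • (a i - a' i)) = 0 := by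
      simp only [smul_sub, Finset.sum_sub_distrib, H, sub_self, pderiv_zero]
    simp only [pderiv_sum, pderiv_function_smul, pderiv_X, Finset.sum_add_distrib] at h2
    simp only [ite_smul, one_smul, zero_smul, Finset.sum_ite_eq, Finset.mem_univ, if_true] at h2
    have h3 : ∀ i, pderiv K i (a j - a' j) = pderiv K j (a i - a' i) +
        (bilin (lieBilin K g) (a i) (a j) - bilin (lieBilin K g) (a' i) (a' j)) := by
      intro i
      rw [← ha, ← ha', pderiv_sub, pderiv_sub]
      abel
    rw [euler]
    simp only [h3, smul_add, smul_sub, Finset.sum_add_distrib, Finset.sum_sub_distrib]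
    simp only [← bilin_function_smul_left, ← bilin_sum_left]
    simp only [smul_sub, pderiv_sub, Finset.sum_sub_distrib] at h2
    simp only [pderiv_sub, smul_sub, Finset.sum_sub_distrib]
    rw [← H, bilin_sub_right, ← sub_eq_zero, ← h2]
    abel
  have h0 : (∑ i, (MvPowerSeries.X i : FormalMap d K) • a i) 0 = 0 := by
    have : OrderGE 1 (∑ i, (MvPowerSeries.X i : FormalMap d K) • a i) :=
      OrderGE.sum _ fun i _ => (orderGE_of_zero (a i)).X_smul i
    exact this 0 (by simp)
  funext j
  rw [← sub_eq_zero]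
  refine eq_zero_of_orderGE fun N => ?_
  induction N with
  | zero => exact orderGE_of_zero _
  | succ N ih =>
    intro n hn
    -- The bracket with c raises the order, since c has no constant term, whereas E + 1 multiplies
    -- degree |n| by |n| + 1.
    have h2 := (orderGE_one h0).bilin ih (lieBilin K g) n (by omega)
    rw [← h1, add_coeff, euler_coeff,
      show ∀ x : g, (n.degree : K) • x + x = ((n.degree : K) + 1) • x from
        fun x => by rw [add_smul, one_smul]] at h2
    exact (smul_eq_zero.1 h2).resolve_left (Nat.cast_add_one_ne_zero _)

/-- Every solution of the Maurer-Cartan equation is a right logarithmic derivative. -/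
theorem exists_logDeriv_eq {a : Fin d → FormalMap d g}
    (ha : ∀ i j, pderiv K i (a j) - pderiv K j (a i) = bilin (lieBilin K g) (a i) (a j)) :
    ∃ S : FormalMap d g, S 0 = 0 ∧ ∀ i, logDeriv (K := K) S i = a i := by
  set c := ∑ i, (MvPowerSeries.X i : FormalMap d K) • a i with hc
  have hc0 : c 0 = 0 := by
    have : OrderGE 1 c := OrderGE.sum _ fun i _ => (orderGE_of_zero (a i)).X_smul i
    exact this 0 (by simp)
  -- A fixed point solves E S = c - (error of S), with E inverted degree by degree. In degree 0 the
  -- convention that the inverse of 0 is 0 enforces S 0 = 0.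
  let Ψ : FormalMap d g → FormalMap d g := fun S n => (n.degree : K)⁻¹ •
    (c - (eval (expSubOneDiv (K := K) (adFormal S)) (euler (K := K) S) - euler (K := K) S)) n
  have hΨ : ∀ S n, Ψ S n = (n.degree : K)⁻¹ • (c -
    (eval (expSubOneDiv (K := K) (adFormal S)) (euler (K := K) S) - euler (K := K) S)) n :=
    fun _ _ => rfl
  obtain ⟨S, hS⟩ := exists_fixedPoint Ψ fun N f h H => agreeTo_iff.2 fun n hn => by
    rw [hΨ, hΨ, agreeTo_iff.1 ((AgreeTo.refl (N + 1) c).sub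
      (AgreeTo.eval_expSubOneDiv_euler (K := K) H)) n hn]
  have hS0 : S 0 = 0 := by
    rw [← hS, hΨ]
    simp
  -- Both families satisfy the Maurer-Cartan equation, so only their radial components need
  -- comparison.
  refine ⟨S, hS0, congrFun (maurerCartan_unique (pderiv_logDeriv hS0) ha ?_)⟩
  rw [sum_X_smul_logDeriv, ← hc]
  have key : euler (K := K) S =
      c - (eval (expSubOneDiv (K := K) (adFormal S)) (euler (K := K) S) - euler (K := K) S) := by
    funext n
    by_cases hn : n = 0
    · have h4 : OrderGE 1 (eval (expSubOneDiv (K := K) (adFormal S)) (euler (K := K) S)) :=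
        ((orderGE_of_zero (expSubOneDiv (K := K) (adFormal S))).bilin
          (orderGE_one (euler_coeff_zero S)) _).mono (by omega)
      rw [hn, sub_coeff, sub_coeff, hc0, euler_coeff_zero, h4 0 (by simp)]
      simp
    · rw [euler_coeff]
      conv_lhs => rw [← hS, hΨ]
      rw [smul_smul, mul_inv_cancel₀, one_smul]
      rw [Nat.cast_ne_zero]
      exact fun h => hn ((Finsupp.degree_eq_zero_iff n).1 h)
  rw [← sub_eq_zero] at key ⊢
  rw [← key]
  abel

end Integration

end FormalMap

/-! ### An algebraic model of the Dorfman bracket and its gauge symmetries -/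

/-- A module over a commutative ring `R` with commuting operators `∂ i` over derivations `δ i` of
`R`, a skew-symmetric bracket and an invariant symmetric bilinear form. -/
structure DiffQuad (R E ι : Type*) [CommRing R] [AddCommGroup E] [Module R E] where
  δ : ι → R →+ R
  D : ι → E →+ E
  br : E →ₗ[R] E →ₗ[R] E
  B : E →ₗ[R] E →ₗ[R] R
  δ_mul : ∀ i r s, δ i (r * s) = δ i r * s + r * δ i s
  D_smul : ∀ i r x, D i (r • x) = δ i r • x + r • D i x
  br_skew : ∀ x y, br x y = -br y x
  B_symm : ∀ x y, B x y = B y x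
  B_inv : ∀ x y z, B (br x y) z = B x (br y z)
  δ_B : ∀ i x y, δ i (B x y) = B (D i x) y + B x (D i y)

namespace DiffQuad

variable {R E ι : Type*} [CommRing R] [AddCommGroup E] [Module R E] [Fintype ι]
  (Q : DiffQuad R E ι)

/-- The derivative along the vector field `u`. -/
def nab (u : ι → R) : E →+ E where
  toFun x := ∑ i, u i • Q.D i x
  map_zero' := by simp
  map_add' x y := by simp [Finset.sum_add_distrib]

theorem nab_apply (u : ι → R) (x : E) : Q.nab u x = ∑ i, u i • Q.D i x := rfl

theorem nab_add_left (u v : ι → R) (x : E) : Q.nab (u + v) x = Q.nab u x + Q.nab v x := by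
  simp [nab_apply, add_smul, Finset.sum_add_distrib]

theorem nab_smul_left (r : R) (u : ι → R) (x : E) : Q.nab (r • u) x = r • Q.nab u x := by
  simp [nab_apply, mul_smul, Finset.smul_sum]

/-- The derivative of a function along the vector field `u`. -/
def nabR (u : ι → R) : R →+ R where
  toFun r := ∑ i, u i * Q.δ i r
  map_zero' := by simp
  map_add' x y := by simp [mul_add, Finset.sum_add_distrib]

theorem nabR_apply (u : ι → R) (r : R) : Q.nabR u r = ∑ i, u i * Q.δ i r := rfl

theorem nab_smul (u : ι → R) (r : R) (x : E) :
    Q.nab u (r • x) = Q.nabR u r • x + r • Q.nab u x := by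
  simp only [nab_apply, nabR_apply, Q.D_smul, smul_add, Finset.sum_add_distrib, Finset.smul_sum,
    Finset.sum_smul, mul_smul]
  congr 1
  exact Finset.sum_congr rfl fun i _ => smul_comm _ _ _

theorem nabR_B (u : ι → R) (x y : E) :
    Q.nabR u (Q.B x y) = Q.B (Q.nab u x) y + Q.B x (Q.nab u y) := by
  simp [nab_apply, nabR_apply, Q.δ_B, mul_add, Finset.sum_add_distrib]

/-- The pairing of the Dorfman bracket of `x` and `y` with `z`, for the anchor `α`. -/
def tau (α : E →ₗ[R] (ι → R)) (x y z : E) : R :=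
  Q.B (Q.br x y) z + Q.B (Q.nab (α x) y) z - Q.B (Q.nab (α y) x) z + Q.B (Q.nab (α z) x) y

variable (α : E →ₗ[R] (ι → R))

theorem tau_add_right (x y z z' : E) :
    Q.tau α x y (z + z') = Q.tau α x y z + Q.tau α x y z' := by
  simp only [tau, map_add, LinearMap.add_apply, nab_add_left]; ring

theorem tau_smul_right (r : R) (x y z : E) : Q.tau α x y (r • z) = r * Q.tau α x y z := by
  simp only [tau, map_smul, LinearMap.smul_apply, nab_smul_left, smul_eq_mul]; ring

theorem tau_add_middle (x y y' z : E) :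
    Q.tau α x (y + y') z = Q.tau α x y z + Q.tau α x y' z := by
  simp only [tau, map_add, LinearMap.add_apply, nab_add_left]; ring

/-- The derivative of r contributes a multiple of B y z only. On an isotropic submodule `tau` is
therefore linear over functions in each argument and its vanishing can be checked on generators. -/
theorem tau_smul_middle (r : R) (x y z : E) (h : Q.B y z = 0) :
    Q.tau α x (r • y) z = r * Q.tau α x y z := by
  simp only [tau, map_smul, map_add, LinearMap.add_apply, LinearMap.smul_apply, nab_smul_left,
    smul_eq_mul, nab_smul, h]; ring

theorem tau_add_left (x x' y z : E) :
    Q.tau α (x + x') y z = Q.tau α x y z + Q.tau α x' y z := by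
  simp only [tau, map_add, LinearMap.add_apply, nab_add_left]; ring

theorem tau_smul_left (r : R) (x y z : E) (h : Q.B x z = 0) (h' : Q.B x y = 0) :
    Q.tau α (r • x) y z = r * Q.tau α x y z := by
  simp only [tau, map_smul, map_add, LinearMap.add_apply, LinearMap.smul_apply, nab_smul_left,
    smul_eq_mul, nab_smul, h, h']; ring

theorem B_nab_swap {x y : E} (h : Q.B x y = 0) (u : ι → R) :
    Q.B (Q.nab u x) y = -Q.B (Q.nab u y) x := by
  have := Q.nabR_B u x y
  rw [h, map_zero, Q.B_symm x] at this
  linear_combination -this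

theorem tau_swap_left {x y z : E} (hxy : Q.B x y = 0) :
    Q.tau α y x z = -Q.tau α x y z := by
  have h := Q.B_nab_swap hxy (α z)
  simp only [tau, Q.br_skew y x, map_neg, LinearMap.neg_apply]
  linear_combination h

/-- On mutually orthogonal elements `tau` is antisymmetric, because `B` is invariant under the
bracket and derivatives of vanishing pairings vanish. -/
theorem tau_swap_right {x y z : E} (hxy : Q.B x y = 0) (hyz : Q.B y z = 0) (hxz : Q.B x z = 0) :
    Q.tau α x z y = -Q.tau α x y z := by
  have h := Q.B_nab_swap hyz (α x)
  have h1 : Q.B (Q.br x z) y = -Q.B (Q.br x y) z := by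
    rw [Q.B_inv, Q.br_skew z y, map_neg, Q.B_inv]
  simp only [tau]
  linear_combination h1 + h

section Span

variable {G : Set E} (hG : ∀ x ∈ G, ∀ y ∈ G, Q.B x y = 0)
include hG

theorem isotropic_span {x y : E} (hx : x ∈ Submodule.span R G) (hy : y ∈ Submodule.span R G) :
    Q.B x y = 0 := by
  induction hx using Submodule.span_induction with
  | mem x hx =>
    induction hy using Submodule.span_induction with
    | mem y hy => exact hG x hx y hy
    | zero => simp
    | add y y' _ _ h h' => rw [map_add, h, h', add_zero]
    | smul r y _ h => rw [map_smul, h, smul_zero]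
  | zero => simp
  | add x x' _ _ h h' => rw [map_add, LinearMap.add_apply, h, h', add_zero]
  | smul r x _ h => rw [map_smul, LinearMap.smul_apply, h, smul_zero]

theorem tau_eq_zero_of_span (hτ : ∀ x ∈ G, ∀ y ∈ G, ∀ z ∈ G, Q.tau α x y z = 0) {x y z : E}
    (hx : x ∈ Submodule.span R G) (hy : y ∈ Submodule.span R G) (hz : z ∈ Submodule.span R G) :
    Q.tau α x y z = 0 := by
  induction hx using Submodule.span_induction with
  | mem x hx =>
    induction hy using Submodule.span_induction with
    | mem y hy =>
      induction hz using Submodule.span_induction with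
      | mem z hz => exact hτ x hx y hy z hz
      | zero => simpa using Q.tau_smul_right α 0 x y 0
      | add z z' _ _ h h' => rw [tau_add_right, h, h', add_zero]
      | smul r z _ h => rw [tau_smul_right, h, mul_zero]
    | zero => simpa using Q.tau_smul_middle α 0 x 0 z (by simp)
    | add y y' _ _ h h' => rw [tau_add_middle, h, h', add_zero]
    | smul r y hy h => rw [tau_smul_middle _ _ _ _ _ _ (Q.isotropic_span hG hy hz), h, mul_zero]
  | zero => simpa using Q.tau_smul_left α 0 0 y z (by simp) (by simp)
  | add x x' _ _ h h' => rw [tau_add_left, h, h', add_zero]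
  | smul r x hx h =>
    rw [tau_smul_left _ _ _ _ _ _ (Q.isotropic_span hG hx hz) (Q.isotropic_span hG hx hy), h,
      mul_zero]

end Span

section Extension

/-- The extension of `Q` by the vector fields and the `1`-forms. -/
def extend : DiffQuad R (E × (ι → R) × (ι → R)) ι where
  δ := Q.δ
  D i := ((Q.D i).comp (AddMonoidHom.fst _ _)).prod
    ((((Q.δ i).compLeft ι).comp ((AddMonoidHom.fst _ _).comp (AddMonoidHom.snd _ _))).prod
      (((Q.δ i).compLeft ι).comp ((AddMonoidHom.snd _ _).comp (AddMonoidHom.snd _ _))))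
  br := LinearMap.mk₂ R (fun x y => (Q.br x.1 y.1, 0, 0))
    (fun _ _ _ => by simp) (fun _ _ _ => by simp) (fun _ _ _ => by simp) (fun _ _ _ => by simp)
  B := LinearMap.mk₂ R (fun x y => Q.B x.1 y.1 + ∑ i, x.2.1 i * y.2.2 i + ∑ i, x.2.2 i * y.2.1 i)
    (fun _ _ _ => by simp [add_mul, Finset.sum_add_distrib]; ring)
    (fun _ _ _ => by simp [mul_add, Finset.mul_sum, mul_assoc])
    (fun _ _ _ => by simp [mul_add, Finset.sum_add_distrib]; ring)
    (fun _ _ _ => by simp [mul_add, Finset.mul_sum, mul_left_comm])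
  δ_mul := Q.δ_mul
  D_smul i r x := by
    ext j <;> simp [Q.D_smul, Q.δ_mul]
  br_skew x y := by ext <;> simp [Q.br_skew x.1 y.1]
  B_symm x y := by
    simp only [LinearMap.mk₂_apply, Q.B_symm x.1 y.1, mul_comm]; ring
  B_inv x y z := by simp [Q.B_inv]
  δ_B i x y := by
    simp [Q.δ_B, Q.δ_mul, Finset.sum_add_distrib]; ring

variable (R E ι) in
/-- The anchor of the extension. -/
def anchor : (E × (ι → R) × (ι → R)) →ₗ[R] (ι → R) :=
  LinearMap.fst R _ _ ∘ₗ LinearMap.snd R _ _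

@[simp] theorem anchor_apply (x : E × (ι → R) × (ι → R)) : anchor R E ι x = x.2.1 := rfl

theorem extend_B (x y : E × (ι → R) × (ι → R)) : Q.extend.B x y =
    Q.B x.1 y.1 + ∑ i, x.2.1 i * y.2.2 i + ∑ i, x.2.2 i * y.2.1 i := rfl

theorem extend_br (x y : E × (ι → R) × (ι → R)) :
    Q.extend.br x y = (Q.br x.1 y.1, 0, 0) := rfl

theorem extend_nab (u : ι → R) (x : E × (ι → R) × (ι → R)) : Q.extend.nab u x =
    (Q.nab u x.1, fun j => Q.nabR u (x.2.1 j), fun j => Q.nabR u (x.2.2 j)) := by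
  rw [nab_apply]
  ext j
  · simp [Prod.fst_sum, nab_apply]; rfl
  · simp [Prod.fst_sum, Prod.snd_sum, nabR_apply]; rfl
  · simp [Prod.snd_sum, nabR_apply]; rfl

theorem extend_tau (x y z : E × (ι → R) × (ι → R)) : Q.extend.tau (anchor R E ι) x y z =
    Q.B (Q.br x.1 y.1) z.1 + Q.extend.B (Q.extend.nab x.2.1 y) z -
      Q.extend.B (Q.extend.nab y.2.1 x) z + Q.extend.B (Q.extend.nab z.2.1 x) y := by
  rw [tau, extend_br, extend_B Q (Q.br x.1 y.1, 0, 0) z]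
  simp

end Extension

/-- A gauge transformation: an automorphism `A` together with the components `a i` of the
corresponding logarithmic derivative. -/
structure Gauge where
  A : E →ₗ[R] E
  a : ι → E
  A_B : ∀ x y, Q.B (A x) (A y) = Q.B x y
  A_br : ∀ x y, Q.br (A x) (A y) = A (Q.br x y)
  D_A : ∀ i x, Q.D i (A x) = A (Q.D i x) + Q.br (a i) (A x)
  maurerCartan : ∀ i j, Q.D i (a j) - Q.D j (a i) = Q.br (a i) (a j)
  isotropic : ∀ i j, Q.B (a i) (a j) = 0
  isotropic_D : ∀ k i j, Q.B (Q.D k (a i)) (a j) = 0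

namespace Gauge

variable {Q} (σ : Q.Gauge)

/-- The logarithmic derivative along a vector field. -/
def al : (ι → R) →ₗ[R] E := Fintype.linearCombination R σ.a

theorem al_apply (v : ι → R) : σ.al v = ∑ i, v i • σ.a i := rfl

/-- The second derivative term `∑ u_i v_j ∂_i a_j`. -/
def da (u v : ι → R) : E := ∑ j, v j • Q.nab u (σ.a j)

theorem nab_al (u v : ι → R) :
    Q.nab u (σ.al v) = σ.al (fun j => Q.nabR u (v j)) + σ.da u v := by
  simp only [al_apply, map_sum, nab_smul, Finset.sum_add_distrib, da]

theorem da_sub (u v : ι → R) : σ.da u v - σ.da v u = Q.br (σ.al u) (σ.al v) := by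
  simp only [da, nab_apply, al_apply, map_sum, LinearMap.sum_apply, map_smul,
    LinearMap.smul_apply, Finset.smul_sum, ← σ.maurerCartan, smul_sub, Finset.sum_sub_distrib]
  congr 1
  rw [Finset.sum_comm]
  exact Finset.sum_congr rfl fun j _ => Finset.sum_congr rfl fun i _ => smul_comm _ _ _

theorem B_al_al (u v : ι → R) : Q.B (σ.al u) (σ.al v) = 0 := by
  simp [al_apply, σ.isotropic]

theorem B_da_al (u v w : ι → R) : Q.B (σ.da u v) (σ.al w) = 0 := by
  simp [al_apply, da, nab_apply, σ.isotropic_D]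

theorem nab_A (u : ι → R) (x : E) :
    Q.nab u (σ.A x) = σ.A (Q.nab u x) + Q.br (σ.al u) (σ.A x) := by
  simp [nab_apply, σ.D_A, smul_add, Finset.sum_add_distrib, al_apply]

/-- The action of a gauge transformation on the extension. -/
def Phi : (E × (ι → R) × (ι → R)) →ₗ[R] (E × (ι → R) × (ι → R)) where
  -- Subtracting the logarithmic derivative along the vector component changes the pairing; the
  -- correction of the 1-form component restores it.
  toFun x := (σ.A x.1 - σ.al x.2.1, x.2.1, fun i => x.2.2 i + Q.B (σ.a i) (σ.A x.1))
  map_add' x y := by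
    ext j
    · simp; abel
    · simp
    · simp; ring
  map_smul' r x := by
    ext j
    · simp [smul_sub]
    · simp
    · simp; ring

theorem Phi_apply (x : E × (ι → R) × (ι → R)) : σ.Phi x =
    (σ.A x.1 - σ.al x.2.1, x.2.1, fun i => x.2.2 i + Q.B (σ.a i) (σ.A x.1)) := rfl

theorem sum_mul_B (v : ι → R) (x : E) : ∑ i, v i * Q.B (σ.a i) x = Q.B (σ.al v) x := by
  simp [al_apply]

theorem Phi_B (x y : E × (ι → R) × (ι → R)) :
    Q.extend.B (σ.Phi x) (σ.Phi y) = Q.extend.B x y := by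
  have h1 : ∑ i, Q.B (σ.a i) (σ.A x.1) * y.2.1 i = Q.B (σ.al y.2.1) (σ.A x.1) := by
    rw [← sum_mul_B]; exact Finset.sum_congr rfl fun _ _ => mul_comm _ _
  simp only [extend_B, Phi_apply, mul_add, add_mul, Finset.sum_add_distrib, h1, sum_mul_B, map_sub,
    LinearMap.sub_apply, σ.A_B, σ.B_al_al, Q.B_symm (σ.al y.2.1)]
  ring

/-- Isolates the failure of `Phi` to commute with covariant differentiation: a bracket with the
logarithmic derivative, and second-derivative terms `da`. -/
theorem Phi_nab_B (u : ι → R) (x y : E × (ι → R) × (ι → R)) :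
    Q.extend.B (Q.extend.nab u (σ.Phi x)) (σ.Phi y) = Q.extend.B (Q.extend.nab u x) y +
      Q.B (Q.br (σ.al u) (σ.A x.1)) (σ.A y.1) - Q.B (σ.da u x.2.1) (σ.A y.1) +
      Q.B (σ.da u y.2.1) (σ.A x.1) := by
  have h1 : ∑ i, Q.nabR u (Q.B (σ.a i) (σ.A x.1)) * y.2.1 i =
      Q.B (σ.da u y.2.1) (σ.A x.1) + Q.B (σ.al y.2.1) (Q.nab u (σ.A x.1)) := by
    simp only [nabR_B, da, map_sum, LinearMap.sum_apply, map_smul, LinearMap.smul_apply, al_apply,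
      ← Finset.sum_add_distrib, smul_eq_mul]
    exact Finset.sum_congr rfl fun _ _ => by ring
  simp only [extend_B, extend_nab, Phi_apply, map_add, mul_add, add_mul, Finset.sum_add_distrib,
    h1, sum_mul_B, map_sub, nab_al, nab_A, LinearMap.sub_apply, LinearMap.add_apply, σ.A_B,
    σ.B_al_al, σ.B_da_al]
  rw [Q.B_symm (σ.al y.2.1), Q.B_symm (σ.al y.2.1)]
  ring

/-- The bracket defects from `Phi_nab_B` combine with the mixed terms of the expanded bracket; what
remains of the `da` terms is antisymmetrised in two vector fields, and the Maurer-Cartan equation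
`da_sub` cancels it. -/
theorem Phi_tau (x y z : E × (ι → R) × (ι → R)) :
    Q.extend.tau (anchor R E ι) (σ.Phi x) (σ.Phi y) (σ.Phi z) =
      Q.extend.tau (anchor R E ι) x y z := by
  have hx : ∀ x, (σ.Phi x).2.1 = x.2.1 := fun x => rfl
  have hx1 : ∀ x, (σ.Phi x).1 = σ.A x.1 - σ.al x.2.1 := fun x => rfl
  rw [extend_tau, extend_tau, hx, hx, hx, Phi_nab_B, Phi_nab_B, Phi_nab_B, hx1, hx1, hx1]
  have m1 := congrArg (fun e => Q.B e (σ.A z.1)) (σ.da_sub x.2.1 y.2.1)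
  have m2 := congrArg (fun e => Q.B e (σ.A y.1)) (σ.da_sub x.2.1 z.2.1)
  have m3 := congrArg (fun e => Q.B e (σ.A x.1)) (σ.da_sub y.2.1 z.2.1)
  simp only [map_sub, LinearMap.sub_apply] at m1 m2 m3
  have c0 : Q.B (Q.br (σ.al x.2.1) (σ.al y.2.1)) (σ.al z.2.1) = 0 := by
    rw [← da_sub, map_sub, LinearMap.sub_apply, B_da_al, B_da_al, sub_zero]
  have c1 : Q.B (Q.br (σ.A x.1) (σ.al y.2.1)) (σ.A z.1) =
      -Q.B (Q.br (σ.al y.2.1) (σ.A x.1)) (σ.A z.1) := by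
    rw [Q.br_skew, map_neg, LinearMap.neg_apply]
  have c2 : Q.B (Q.br (σ.A x.1) (σ.A y.1)) (σ.al z.2.1) =
      Q.B (Q.br (σ.al z.2.1) (σ.A x.1)) (σ.A y.1) := by
    rw [Q.B_symm, ← Q.B_inv]
  have c3 : Q.B (Q.br (σ.A x.1) (σ.al y.2.1)) (σ.al z.2.1) =
      Q.B (Q.br (σ.al y.2.1) (σ.al z.2.1)) (σ.A x.1) := by
    rw [Q.B_inv, Q.B_symm]
  have c4 : Q.B (Q.br (σ.al x.2.1) (σ.A y.1)) (σ.al z.2.1) =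
      -Q.B (Q.br (σ.al x.2.1) (σ.al z.2.1)) (σ.A y.1) := by
    rw [Q.br_skew, map_neg, LinearMap.neg_apply, Q.B_inv, Q.B_symm]
  simp only [map_sub, LinearMap.sub_apply, σ.A_br, c0, c1, c2, c3, c4]
  rw [← σ.A_br, c2, σ.A_br, σ.A_B]
  linear_combination -m1 + m2 - m3

end Gauge

end DiffQuad

namespace FormalMap

/-! ### Exponentials in representations -/

section Representations

variable {K : Type*} [Field K] {g : Type*} [LieRing g] [LieAlgebra K g] {d : ℕ}
  {V W X : Type*} [AddCommGroup V] [Module K V] [AddCommGroup W] [Module K W]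
  [AddCommGroup X] [Module K X]

theorem bilin_coeff_zero (B : V →ₗ[K] W →ₗ[K] X) (f : FormalMap d V) (h : FormalMap d W) :
    bilin B f h 0 = B (f 0) (h 0) := by
  rw [bilin_coeff, Finset.sum_eq_single (0, 0)]
  · rintro ⟨p, q⟩ hpq hne
    have := Finset.HasAntidiagonal.mem_antidiagonal.1 hpq
    simp only [add_eq_zero] at this
    exact absurd (by rw [this.1, this.2]) hne
  · intro h; simp at h

theorem exp_coeff_zero (Φ : FormalMap d (Module.End K V)) : exp Φ 0 = 1 := by
  rw [exp, powerSum_coeff_zero]; simp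

theorem eval_exp_coeff_zero (Φ : FormalMap d (Module.End K V)) (f : FormalMap d V) :
    eval (exp Φ) f 0 = f 0 := by
  rw [eval_eq_bilin, bilin_coeff_zero, exp_coeff_zero]; rfl

theorem isUnit_exp (Φ : FormalMap d (Module.End K V)) : IsUnit (exp Φ) := by
  rw [MvPowerSeries.isUnit_iff_constantCoeff, ← MvPowerSeries.coeff_zero_eq_constantCoeff_apply,
    MvPowerSeries.coeff_apply, exp_coeff_zero]
  exact isUnit_one

theorem eval_exp_surjective (Φ : FormalMap d (Module.End K V)) (f : FormalMap d V) :
    ∃ h, eval (exp Φ) h = f := by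
  obtain ⟨u, hu⟩ := isUnit_exp Φ
  refine ⟨eval (↑u⁻¹ : MvPowerSeries (Fin d) (Module.End K V)) f, ?_⟩
  rw [← eval_mul, ← hu, Units.mul_inv, eval_one]

theorem eval_exp_injective (Φ : FormalMap d (Module.End K V)) {f h : FormalMap d V}
    (H : eval (exp Φ) f = eval (exp Φ) h) : f = h := by
  obtain ⟨u, hu⟩ := isUnit_exp Φ
  have := congrArg (eval (↑u⁻¹ : MvPowerSeries (Fin d) (Module.End K V))) H
  rwa [← eval_mul, ← eval_mul, ← hu, Units.inv_mul, eval_one, eval_one] at this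

theorem powerSum_zero (c : ℕ → K) :
    powerSum c (0 : FormalMap d (Module.End K V)) = const d (c 0 • 1) := by
  funext n
  change ∑ k ∈ Finset.range (n.degree + 1), c k •
    ((0 : MvPowerSeries (Fin d) (Module.End K V)) ^ k) n = _
  rw [Finset.sum_eq_single 0]
  · rw [pow_zero, end_one_eq_const, const_coeff, const_coeff]
    split_ifs <;> simp
  · intro k _ hk
    rw [zero_pow hk, zero_coeff, smul_zero]
  · intro h; simp at h

theorem exp_zero : exp (0 : FormalMap d (Module.End K V)) = 1 := by
  rw [exp, powerSum_zero, end_one_eq_const]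
  simp

theorem eval_exp_zero_rep (S : FormalMap d g) (f : FormalMap d V) :
    eval (exp (map (0 : g →ₗ[K] Module.End K V) S)) f = f := by
  have : map (0 : g →ₗ[K] Module.End K V) S = 0 := by funext n; simp
  rw [this, exp_zero, eval_one]

variable [CharZero K]

theorem pderiv_eval_exp_const {ρ : g →ₗ[K] Module.End K V} (hρ : IsRep ρ) {S : FormalMap d g}
    (h0 : S 0 = 0) (v : V) (i : Fin d) :
    pderiv K i (eval (exp (map ρ S)) (const d v)) =
      bilin ρ (logDeriv (K := K) S i) (eval (exp (map ρ S)) (const d v)) := by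
  rw [pderiv_eval_exp hρ h0, pderiv_const, eval_eq_bilin, bilin_zero_right, zero_add]

/-- Exponentials are compatible with equivariant bilinear maps. -/
theorem eval_exp_bilin [FiniteDimensional K V] [FiniteDimensional K W]
    {ρ₁ : g →ₗ[K] Module.End K V} {ρ₂ : g →ₗ[K] Module.End K W} {ρ₃ : g →ₗ[K] Module.End K X}
    (h₁ : IsRep ρ₁) (h₂ : IsRep ρ₂) (h₃ : IsRep ρ₃) (B : V →ₗ[K] W →ₗ[K] X)
    (hB : ∀ x v w, ρ₃ x (B v w) = B (ρ₁ x v) w + B v (ρ₂ x w)) {S : FormalMap d g}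
    (h0 : S 0 = 0) (f : FormalMap d V) (h : FormalMap d W) :
    eval (exp (map ρ₃ S)) (bilin B f h) =
      bilin B (eval (exp (map ρ₁ S)) f) (eval (exp (map ρ₂ S)) h) := by
  -- For constant arguments both sides solve ∂_i y = ρ₃(a_i) y, with a the logarithmic derivative of
  -- e^S, and agree at 0. Both sides are linear over functions, so constants suffice.
  refine induction_const (K := K) f (fun v => ?_) (fun f f' H H' => ?_) (fun r f H => ?_)
  · refine induction_const (K := K) h (fun w => ?_) (fun h h' H H' => ?_) (fun r h H => ?_)
    · rw [← sub_eq_zero]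
      refine eq_zero_of_pderiv_eq ρ₃ (logDeriv (K := K) S) _ ?_ fun i => ?_
      · rw [sub_coeff, eval_exp_coeff_zero, bilin_coeff_zero, bilin_coeff_zero,
          eval_exp_coeff_zero, eval_exp_coeff_zero, sub_self]
      · rw [bilin_const_left, map_const, pderiv_sub, pderiv_eval_exp_const h₃ h0, pderiv_bilin,
          pderiv_eval_exp_const h₁ h0, pderiv_eval_exp_const h₂ h0, bilin_sub_right,
          bilin_leibniz ρ₃ B B ρ₁ B ρ₂ hB]
    · simp only [eval_eq_bilin, bilin_add_right] at H H' ⊢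
      rw [H, H']
    · simp only [eval_eq_bilin, bilin_function_smul_right] at H ⊢
      rw [H]
  · simp only [eval_eq_bilin, bilin_add_right, bilin_add_left] at H H' ⊢
    rw [H, H']
  · simp only [eval_eq_bilin, bilin_function_smul_right, bilin_function_smul_left] at H ⊢
    rw [H]

/-- An intertwiner is an equivariant bilinear map K × V → W, with K the trivial representation. -/
theorem eval_exp_map {ρ₁ : g →ₗ[K] Module.End K V} {ρ₂ : g →ₗ[K] Module.End K W}
    [FiniteDimensional K V] (h₁ : IsRep ρ₁) (h₂ : IsRep ρ₂) (T : V →ₗ[K] W)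
    (hT : ∀ x v, ρ₂ x (T v) = T (ρ₁ x v)) {S : FormalMap d g} (h0 : S 0 = 0)
    (f : FormalMap d V) :
    eval (exp (map ρ₂ S)) (map T f) = map T (eval (exp (map ρ₁ S)) f) := by
  have h3 : IsRep (0 : g →ₗ[K] Module.End K K) := fun x y => by simp
  have := eval_exp_bilin h3 h₁ h₂ (LinearMap.toSpanSingleton K _ T) (fun x v w => by simp [hT])
    h0 (const d 1) f
  rw [eval_exp_zero_rep, bilin_const_left, bilin_const_left] at this
  simpa using this

end Representations

end FormalMap

/-! ### The double of a Lie quasi-bialgebra -/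

section Double

variable {K : Type*} [Field K] {g : Type*} [LieRing g] [LieAlgebra K g] [FiniteDimensional K g]

theorem eq_of_dual {x y : g} (h : ∀ ζ : Dual K g, ζ x = ζ y) : x = y := by
  rw [← sub_eq_zero, ← Module.forall_dual_apply_eq_zero_iff K]
  intro ζ
  rw [map_sub, h, sub_self]

theorem update_vec_zero {E : Type*} (x y z w : E) :
    Function.update ![x, y, z] 0 w = ![w, y, z] := by
  funext i; fin_cases i <;> rfl

theorem contract_add_left (φ : Dual K g [⋀^Fin 3]→ₗ[K] K) (ξ ξ' η : Dual K g) :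
    contract φ (ξ + ξ') η = contract φ ξ η + contract φ ξ' η :=
  eq_of_dual (K := K) fun ζ => by
    rw [map_add, apply_contract, apply_contract, apply_contract]
    simpa only [update_vec_zero] using φ.map_update_add ![ξ, η, ζ] 0 ξ ξ'

theorem contract_smul_left (φ : Dual K g [⋀^Fin 3]→ₗ[K] K) (c : K) (ξ η : Dual K g) :
    contract φ (c • ξ) η = c • contract φ ξ η :=
  eq_of_dual (K := K) fun ζ => by
    rw [map_smul, apply_contract, apply_contract]
    simpa only [update_vec_zero] using φ.map_update_smul ![ξ, η, ζ] 0 c ξ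

theorem alternating_swap_left (φ : Dual K g [⋀^Fin 3]→ₗ[K] K) (ξ η ζ : Dual K g) :
    φ ![η, ξ, ζ] = -φ ![ξ, η, ζ] := by
  rw [← φ.map_swap ![ξ, η, ζ] (i := 0) (j := 1) (by decide)]
  congr 1
  funext i; fin_cases i <;> rfl

theorem alternating_rotate (φ : Dual K g [⋀^Fin 3]→ₗ[K] K) (ξ η ζ : Dual K g) :
    φ ![η, ζ, ξ] = φ ![ξ, η, ζ] := by
  have h : φ ![ξ, ζ, η] = -φ ![ξ, η, ζ] := by
    rw [← φ.map_swap ![ξ, η, ζ] (i := 1) (j := 2) (by decide)]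
    congr 1
    funext i; fin_cases i <;> rfl
  have h2 : φ ![η, ζ, ξ] = -φ ![ξ, ζ, η] := by
    rw [← φ.map_swap ![ξ, ζ, η] (i := 0) (j := 2) (by decide)]
    congr 1
    funext i; fin_cases i <;> rfl
  rw [h2, h, neg_neg]

theorem contract_swap (φ : Dual K g [⋀^Fin 3]→ₗ[K] K) (ξ η : Dual K g) :
    contract φ η ξ = -contract φ ξ η :=
  eq_of_dual (K := K) fun ζ => by
    rw [map_neg, apply_contract, apply_contract, alternating_swap_left]

theorem contract_zero_left (φ : Dual K g [⋀^Fin 3]→ₗ[K] K) (η : Dual K g) :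
    contract φ 0 η = 0 := by
  simpa using contract_smul_left φ 0 0 η

@[simp] theorem coadMap_apply (x : g) (ξ : Dual K g) (y : g) : coadMap K x ξ y = ξ ⁅x, y⁆ := rfl

theorem coadMap_add (x y : g) : coadMap K (x + y) = coadMap K x + coadMap K y := by
  ext ξ z; simp

theorem coadMap_smul (c : K) (x : g) : coadMap K (c • x) = c • coadMap K x := by
  ext ξ z; simp

namespace LieQuasiBialgebra

variable (G : LieQuasiBialgebra K g)

/-- The bracket of the double as a bilinear map. -/
noncomputable def double : (g × Dual K g) →ₗ[K] (g × Dual K g) →ₗ[K] (g × Dual K g) :=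
  LinearMap.mk₂ K (doubleBracket G.ϖ G.φ)
    (fun u u' v => by
      simp only [doubleBracket, Prod.fst_add, Prod.snd_add, map_add, add_lie, LinearMap.add_apply,
        contract_add_left, coadMap_add, LinearMap.comp_add, Prod.mk_add_mk]
      congr 1 <;> abel)
    (fun c u v => by
      simp only [doubleBracket, Prod.smul_fst, Prod.smul_snd, map_smul, smul_lie,
        LinearMap.smul_apply, contract_smul_left, coadMap_smul, LinearMap.comp_smul,
        Prod.smul_mk, smul_add, smul_sub, smul_neg])
    (fun u v v' => by
      simp only [doubleBracket, Prod.fst_add, Prod.snd_add, map_add, lie_add, LinearMap.add_apply,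
        contract_swap G.φ _ u.2, contract_add_left, coadMap_add, LinearMap.add_comp,
        Prod.mk_add_mk]
      congr 1 <;> abel)
    (fun c u v => by
      simp only [doubleBracket, Prod.smul_fst, Prod.smul_snd, map_smul, lie_smul,
        LinearMap.smul_apply, contract_swap G.φ _ u.2, contract_smul_left, coadMap_smul,
        LinearMap.smul_comp, Prod.smul_mk, smul_add, smul_sub, smul_neg])

theorem double_apply (u v : g × Dual K g) : G.double u v = doubleBracket G.ϖ G.φ u v := rfl

theorem double_skew (u v : g × Dual K g) : G.double u v = -G.double v u := by
  have h := G.double_self (u + v)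
  have hu := G.double_self u
  have hv := G.double_self v
  rw [← double_apply] at h hu hv
  simp only [map_add, LinearMap.add_apply, hu, hv, zero_add, add_zero] at h
  rw [eq_neg_iff_add_eq_zero, add_comm]; exact h

theorem double_jacobi' (u v w : g × Dual K g) :
    G.double u (G.double v w) = G.double (G.double u v) w + G.double v (G.double u w) := by
  have h := G.double_jacobi u v w
  simp only [← double_apply] at h
  rw [G.double_skew w u, map_neg, G.double_skew w] at h
  rw [← sub_eq_zero, ← h]
  abel

theorem double_inl (x : g) (v : g × Dual K g) :
    G.double (x, 0) v = (⁅x, v.1⁆ + G.ϖ x v.2, -coadMap K x v.2) := by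
  simp [double_apply, doubleBracket, contract_zero_left]

end LieQuasiBialgebra

variable (K g) in
/-- The canonical pairing on `g ⊕ g*`. -/
def doublePairing : (g × Dual K g) →ₗ[K] (g × Dual K g) →ₗ[K] K :=
  LinearMap.mk₂ K (fun u v => u.2 v.1 + v.2 u.1)
    (fun _ _ _ => by simp; ring) (fun _ _ _ => by simp; ring)
    (fun _ _ _ => by simp; ring) (fun _ _ _ => by simp; ring)

@[simp] theorem doublePairing_apply (u v : g × Dual K g) :
    doublePairing K g u v = u.2 v.1 + v.2 u.1 := rfl

/-- Only skewness of ϖ, skewness of the bracket of g and alternation of φ enter; the Jacobi identity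
of the double plays no role. -/
theorem LieQuasiBialgebra.doublePairing_invariant (G : LieQuasiBialgebra K g)
    (u v w : g × Dual K g) :
    doublePairing K g (G.double u v) w = doublePairing K g u (G.double v w) := by
  simp only [doublePairing_apply, G.double_apply, doubleBracket, LinearMap.add_apply,
    LinearMap.neg_apply, LinearMap.comp_apply, LinearMap.flip_apply, coadMap_apply, map_add,
    map_sub, apply_contract]
  rw [← alternating_rotate G.φ u.2, G.skew w.1 v.2 u.2, G.skew u.1 w.2 v.2,
    ← lie_skew w.1 u.1, ← lie_skew v.1 u.1]
  simp only [map_neg, G.skew v.1 w.2 u.2]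
  ring

end Double

/-! ### Formal maps into the double, and the group cocycle as a block of its adjoint action -/

section FormalDouble

open FormalMap

variable {K : Type*} [Field K] {g : Type*} [LieRing g] [LieAlgebra K g] [FiniteDimensional K g]
  {d : ℕ}

namespace FormalMap

theorem map_function_smul_mul {V : Type*} [AddCommGroup V] [Module K V] (T : V →ₗ[K] K)
    (r : FormalMap d K) (f : FormalMap d V) : map T (r • f) = r * map T f := by
  rw [map_function_smul, function_smul_def, function_smul_eq_mul]

theorem bilin_lie_swap {g : Type*} [LieRing g] [LieAlgebra K g] (x y : FormalMap d g) :
    bilin (lieBilin K g) x y = -bilin (lieBilin K g) y x := by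
  rw [← bilin_flip]
  funext n
  simp [bilin_coeff, ← Finset.sum_neg_distrib]

theorem const_mul_const (x y : K) : const d x * const d y = const d (x * y) := by
  rw [← bilin_mul, bilin_const_left, map_const]; rfl

theorem const_add {V : Type*} [AddCommGroup V] (x y : V) :
    const d (x + y) = const d x + const d y := by
  funext n; simp only [const_coeff, add_coeff]; split_ifs <;> simp

theorem const_sum {V ι : Type*} [AddCommGroup V] (s : Finset ι) (x : ι → V) :
    const d (∑ i ∈ s, x i) = ∑ i ∈ s, const d (x i) := by
  classical
  induction s using Finset.induction_on with
  | empty => funext n; simp [const_coeff]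
  | insert i s hi ih => rw [Finset.sum_insert hi, Finset.sum_insert hi, const_add, ih]

theorem function_smul_const {V : Type*} [AddCommGroup V] [Module K V] (x : K) (f : FormalMap d V) :
    const d x • f = x • f := by
  rw [function_smul_def, bilin_const_left]; rfl

/-- The first factor of ρ moves v into the image of J, where ρ is intertwined with ρ'; dropping that
factor turns e^ρ - 1 into (e^{ρ'} - 1)/ρ'. It produces π_σ from the double, and later the
equivariance of e^S from that of S. -/
theorem eval_exp_const_of_intertwines {V W : Type*} [AddCommGroup V] [Module K V]
    [AddCommGroup W] [Module K W] [CharZero K]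
    (ρ : g →ₗ[K] Module.End K V) (ρ' : g →ₗ[K] Module.End K W) (J : W →ₗ[K] V) (c : g →ₗ[K] W)
    (v : V) (hv : ∀ x, ρ x v = J (c x)) (hJ : ∀ x w, ρ x (J w) = J (ρ' x w)) {S : FormalMap d g}
    (h0 : S 0 = 0) :
    eval (exp (map ρ S)) (const d v) =
      map J (eval (expSubOneDiv (map ρ' S)) (map c S)) + const d v := by
  have h1 : ∀ k, eval (map ρ S ^ (k + 1) : MvPowerSeries _ _) (const d v) =
      map J (eval (map ρ' S ^ k : MvPowerSeries _ _) (map c S)) := by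
    intro k
    induction k with
    | zero =>
      rw [eval_pow_succ, pow_zero, pow_zero, eval_one, eval_one, eval_map, bilin_const_right]
      funext n
      exact hv (S n)
    | succ k ih =>
      rw [eval_pow_succ, ih, eval_pow_succ, eval_map, eval_map, map_bilin, bilin_map_right]
      congr 1
      exact LinearMap.ext fun x => LinearMap.ext fun t => hJ x t
  have h2 := sumsTo_expTerm ρ h0 (const d v)
  have h3 := sumsTo_eval_powerSum (Φ := map ρ' S) (by simp [h0])
    (fun k => ((k + 1).factorial : K)⁻¹) (map c S)
  funext n
  rw [← h2.sum_range (M := n.degree + 1 + 1) (by omega), Finset.sum_range_succ', add_coeff,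
    expTerm_zero, map_coeff, expSubOneDiv, ← h3.2 n, map_sum]
  congr 1
  refine Finset.sum_congr rfl fun k _ => ?_
  rw [expTerm, h1]
  exact (map_smul J _ _).symm

end FormalMap

namespace LieQuasiBialgebra

variable (G : LieQuasiBialgebra K g)

variable (d) in
/-- Formal maps with values in the double. -/
noncomputable def formalDouble :
    DiffQuad (FormalMap d K) (FormalMap d (g × Dual K g)) (Fin d) where
  δ i := (pderivL K K i).toAddMonoidHom
  D i := (pderivL K (g × Dual K g) i).toAddMonoidHom
  br := bilinF G.double
  B := pairF (doublePairing K g)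
  δ_mul i r s := pderiv_mul i r s
  D_smul i r x := pderiv_function_smul i r x
  br_skew x y := by
    simp only [bilinF_apply]
    rw [← bilin_flip]
    funext n
    rw [neg_coeff, bilin_coeff, bilin_coeff, ← Finset.sum_neg_distrib]
    exact Finset.sum_congr rfl fun q _ => G.double_skew _ _
  B_symm x y := by
    simp only [pairF_apply]
    rw [← bilin_flip]
    congr 1
    ext <;> simp
  B_inv x y z := bilin_assoc _ _ _ _ G.doublePairing_invariant x y z
  δ_B i x y := by
    exact pderiv_bilin (K := K) (doublePairing K g) i x y

theorem formalDouble_δ (i : Fin d) (r : FormalMap d K) :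
    (G.formalDouble d).δ i r = pderiv K i r := rfl

theorem formalDouble_D (i : Fin d) (x : FormalMap d (g × Dual K g)) :
    (G.formalDouble d).D i x = pderiv K i x := rfl

theorem formalDouble_br (x y : FormalMap d (g × Dual K g)) :
    (G.formalDouble d).br x y = bilin G.double x y := rfl

theorem formalDouble_B (x y : FormalMap d (g × Dual K g)) :
    (G.formalDouble d).B x y = bilin (doublePairing K g) x y := rfl

/-- The adjoint representation of `g` on the double. -/
noncomputable def adDouble : g →ₗ[K] Module.End K (g × Dual K g) :=
  G.double ∘ₗ LinearMap.inl K g (Dual K g)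

theorem adDouble_apply (x : g) (v : g × Dual K g) :
    G.adDouble x v = (⁅x, v.1⁆ + G.ϖ x v.2, -coadMap K x v.2) := G.double_inl x v

theorem isRep_adDouble : IsRep G.adDouble := by
  intro x y
  refine LinearMap.ext fun v => ?_
  have h := G.double_jacobi' (x, 0) (y, 0) v
  have h2 : G.double (x, 0) (y, 0) = (⁅x, y⁆, 0) := by rw [double_inl]; simp
  rw [h2] at h
  simp only [LinearMap.sub_apply, Module.End.mul_apply, adDouble, LinearMap.comp_apply,
    LinearMap.inl_apply]
  rw [h]; abel

variable (K g) in
/-- The coadjoint representation. -/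
def coadRep : g →ₗ[K] Module.End K (Dual K g) where
  toFun x := -coadMap K x
  map_add' x y := by rw [coadMap_add]; abel
  map_smul' c x := by ext ξ z; simp

theorem coadRep_apply (x : g) (ξ : Dual K g) : coadRep K g x ξ = -coadMap K x ξ := rfl

theorem isRep_coadRep : IsRep (coadRep K g) := by
  intro x y
  ext ξ z
  simp [coadRep_apply]

/-- The action of `g` on linear maps from `g*` to the double. -/
noncomputable def homDouble : g →ₗ[K] Module.End K (Dual K g →ₗ[K] g × Dual K g) :=
  LinearMap.mk₂ K (fun x H => G.adDouble x ∘ₗ H + H ∘ₗ coadMap K x)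
    (fun x y H => by rw [map_add, coadMap_add, LinearMap.add_comp, LinearMap.comp_add]; abel)
    (fun c x H => by rw [map_smul, coadMap_smul, LinearMap.smul_comp, LinearMap.comp_smul, smul_add])
    (fun x H H' => by rw [LinearMap.comp_add, LinearMap.add_comp]; abel)
    (fun c x H => by rw [LinearMap.comp_smul, LinearMap.smul_comp, smul_add])

theorem homDouble_apply (x : g) (H : Dual K g →ₗ[K] g × Dual K g) (ξ : Dual K g) :
    G.homDouble x H ξ = G.adDouble x (H ξ) + H (coadMap K x ξ) := rfl

theorem isRep_homDouble : IsRep (V := Dual K g →ₗ[K] g × Dual K g) G.homDouble := by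
  intro x y
  refine LinearMap.ext fun H => LinearMap.ext fun ξ => ?_
  have h : coadMap K ⁅x, y⁆ ξ = coadMap K y (coadMap K x ξ) - coadMap K x (coadMap K y ξ) := by
    ext z; simp
  change G.homDouble ⁅x, y⁆ H ξ = G.homDouble x (G.homDouble y H) ξ - G.homDouble y (G.homDouble x H) ξ
  simp only [LinearMap.sub_apply, Module.End.mul_apply, homDouble_apply, G.isRep_adDouble x y, h,
    map_sub, map_add]
  abel

theorem homDouble_inl (x : g) (t : Dual K g →ₗ[K] g) :
    G.homDouble x (LinearMap.inl K g (Dual K g) ∘ₗ t) = LinearMap.inl K g (Dual K g) ∘ₗ homAct K g x t := by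
  refine LinearMap.ext fun ξ => ?_
  rw [homDouble_apply, adDouble_apply]
  simp [homAct, adMap]

/-- The failure of the inclusion g* → g ⊕ g* to be g-invariant is ϖ. Exponentiating this relation
yields the cocycle π. -/
theorem homDouble_inr (x : g) :
    G.homDouble x (LinearMap.inr K g (Dual K g)) = LinearMap.inl K g (Dual K g) ∘ₗ G.ϖ x := by
  refine LinearMap.ext fun ξ => ?_
  rw [homDouble_apply, adDouble_apply]
  simp

variable [CharZero K]

set_option maxHeartbeats 1000000 in
theorem eval_exp_homDouble_inr {S : FormalMap d g} (h0 : S 0 = 0)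
    (J : (Dual K g →ₗ[K] g) →ₗ[K] (Dual K g →ₗ[K] g × Dual K g))
    (hJ : ∀ t, J t = LinearMap.inl K g (Dual K g) ∘ₗ t) :
    eval (exp (map G.homDouble S)) (const d (LinearMap.inr K g (Dual K g))) =
      map J (cocycleExp G S) + const d (LinearMap.inr K g (Dual K g)) := by
  have := @eval_exp_const_of_intertwines _ _ _ _ _ _ d (Dual K g →ₗ[K] g × Dual K g)
    (Dual K g →ₗ[K] g) _ _ _ _ _ G.homDouble (homAct K g) J G.ϖ (LinearMap.inr K g (Dual K g))
    (fun x => by rw [hJ, G.homDouble_inr]) (fun x w => by rw [hJ, hJ, G.homDouble_inl]) _ h0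
  exact this

variable (K g) in
/-- The evaluation pairing. -/
def dualPairing : Dual K g →ₗ[K] g →ₗ[K] K := LinearMap.id

@[simp] theorem dualPairing_apply (ξ : Dual K g) (x : g) : dualPairing K g ξ x = ξ x := rfl

theorem bilin_dualPairing_transpose (E : FormalMap d (Module.End K g))
    (η : FormalMap d (Dual K g)) (f : FormalMap d g) :
    bilin (dualPairing K g) (eval (map Dual.transpose E) η) f =
      bilin (dualPairing K g) η (eval E f) := by
  have e : eval (map Dual.transpose E) η =
      bilin (LinearMap.flip (Dual.transpose : Module.End K g →ₗ[K] Module.End K (Dual K g))) η E := by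
    rw [bilin_flip, eval_map]
  rw [e, eval_eq_bilin]
  exact bilin_assoc (dualPairing K g)
    (LinearMap.flip (Dual.transpose : Module.End K g →ₗ[K] Module.End K (Dual K g)))
    (dualPairing K g) LinearMap.id (fun u v w => by simp [Dual.transpose_apply]) η E f

/-- The exponential of -ad* is inverse to Ad*: the evaluation pairing is invariant under the
exponentials, and Ad is surjective, so testing against Ad f determines the form. -/
theorem eval_exp_coadRep_transpose {S : FormalMap d g} (h0 : S 0 = 0) (ξ : Dual K g) :
    eval (exp (map (coadRep K g) S))
      (eval (map Dual.transpose (AdExp (K := K) S)) (const d ξ)) = const d ξ := by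
  have h3 : IsRep (0 : g →ₗ[K] Module.End K K) := fun x y => by simp
  have h2 : ∀ η f, bilin (dualPairing K g) η f =
      bilin (dualPairing K g) (eval (exp (map (coadRep K g) S)) η) (eval (AdExp (K := K) S) f) := by
    intro η f
    have := eval_exp_bilin (K := K) isRep_coadRep isRep_ad h3 (dualPairing K g)
      (fun x v w => by simp [coadRep_apply]) h0 η f
    rwa [eval_exp_zero_rep] at this
  funext n
  refine LinearMap.ext fun y => ?_
  obtain ⟨f, hf⟩ := eval_exp_surjective (adFormal (K := K) S) (const d y)
  have h4 := h2 (eval (map Dual.transpose (AdExp (K := K) S)) (const d ξ)) f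
  rw [bilin_dualPairing_transpose] at h4
  rw [AdExp, hf] at h4
  rw [bilin_const_right, bilin_const_right] at h4
  exact (congrFun h4 n).symm

/-- The exponential of the adjoint action on the double, on the image of `Ad*`. -/
theorem eval_exp_adDouble_inr {S : FormalMap d g} (h0 : S 0 = 0) (ξ : Dual K g) :
    eval (exp (map G.adDouble S)) (map (LinearMap.inr K g (Dual K g))
      (eval (map Dual.transpose (AdExp (K := K) S)) (const d ξ))) =
    map (LinearMap.inl K g (Dual K g)) (map (LinearMap.applyₗ ξ) (cocycleExp G S)) +
      const d (LinearMap.inr K g (Dual K g) ξ) := by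
  -- Evaluation Hom(g*, g ⊕ g*) × g* → g ⊕ g* is equivariant; it is applied to the constant
  -- inclusion of g* and to Ad* ξ.
  have h := eval_exp_bilin (K := K) G.isRep_homDouble isRep_coadRep G.isRep_adDouble
    (LinearMap.id : (Dual K g →ₗ[K] g × Dual K g) →ₗ[K] _)
    (fun x v w => by simp [coadRep_apply, homDouble_apply]) h0 (const d (LinearMap.inr K g (Dual K g)))
    (eval (map Dual.transpose (AdExp (K := K) S)) (const d ξ))
  rw [bilin_const_left, eval_exp_coadRep_transpose h0, eval_exp_homDouble_inr G h0
    (LinearMap.llcomp K (Dual K g) g (g × Dual K g) (LinearMap.inl K g (Dual K g)))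
    (fun t => rfl)] at h
  rw [LinearMap.id_apply] at h
  rw [h, bilin_const_right, map_add', FormalMap.map_const]
  rfl

theorem eval_exp_adDouble_inl {S : FormalMap d g} (h0 : S 0 = 0) (f : FormalMap d g) :
    eval (exp (map G.adDouble S)) (map (LinearMap.inl K g (Dual K g)) f) =
      map (LinearMap.inl K g (Dual K g)) (eval (AdExp (K := K) S) f) :=
  eval_exp_map isRep_ad G.isRep_adDouble _ (fun x v => by simp [adDouble_apply]) h0 f

theorem bilin_double_inl (f : FormalMap d g) (x : FormalMap d (g × Dual K g)) :
    bilin G.double (map (LinearMap.inl K g (Dual K g)) f) x = bilin G.adDouble f x := rfl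

theorem bilin_double_inl_inl (f h : FormalMap d g) :
    bilin G.double (map (LinearMap.inl K g (Dual K g)) f) (map (LinearMap.inl K g (Dual K g)) h) =
      map (LinearMap.inl K g (Dual K g)) (bilin (lieBilin K g) f h) := by
  rw [bilin_double_inl, bilin_map_right, map_bilin]
  congr 1
  refine LinearMap.ext fun x => LinearMap.ext fun y => ?_
  simp [adDouble_apply]

theorem bilin_pairing_inl_inl (f h : FormalMap d g) :
    bilin (doublePairing K g) (map (LinearMap.inl K g (Dual K g)) f) (map (LinearMap.inl K g (Dual K g)) h) = 0 := by
  funext n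
  simp [bilin_coeff]

theorem gauge_B {S : FormalMap d g} (h0 : S 0 = 0) (x y : FormalMap d (g × Dual K g)) :
    bilin (doublePairing K g) (eval (exp (map G.adDouble S)) x) (eval (exp (map G.adDouble S)) y) =
      bilin (doublePairing K g) x y := by
  have h3 : IsRep (0 : g →ₗ[K] Module.End K K) := fun x y => by simp
  have h := eval_exp_bilin (K := K) G.isRep_adDouble G.isRep_adDouble h3 (doublePairing K g)
    (fun x v w => by
      have h1 := G.doublePairing_invariant v (x, 0) w
      rw [G.double_skew v, map_neg, LinearMap.neg_apply] at h1
      change (0 : K) = doublePairing K g (G.double (x, 0) v) w + doublePairing K g v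
        (G.double (x, 0) w)
      rw [← h1]; ring) h0 x y
  rw [eval_exp_zero_rep] at h
  exact h.symm

theorem gauge_br {S : FormalMap d g} (h0 : S 0 = 0) (x y : FormalMap d (g × Dual K g)) :
    bilin G.double (eval (exp (map G.adDouble S)) x) (eval (exp (map G.adDouble S)) y) =
      eval (exp (map G.adDouble S)) (bilin G.double x y) :=
  (eval_exp_bilin (K := K) G.isRep_adDouble G.isRep_adDouble G.isRep_adDouble G.double
    (fun x v w => G.double_jacobi' (x, 0) v w) h0 x y).symm

theorem gauge_D {S : FormalMap d g} (h0 : S 0 = 0) (i : Fin d) (x : FormalMap d (g × Dual K g)) :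
    pderiv K i (eval (exp (map G.adDouble S)) x) = eval (exp (map G.adDouble S)) (pderiv K i x) +
      bilin G.double (map (LinearMap.inl K g (Dual K g)) (logDeriv (K := K) S i))
        (eval (exp (map G.adDouble S)) x) :=
  pderiv_eval_exp G.isRep_adDouble h0 x i

/-- The gauge transformation of the formal double given by a formal map to `g` which satisfies
`S 0 = 0`. -/
noncomputable def gaugeOf {S : FormalMap d g} (h0 : S 0 = 0) : (G.formalDouble d).Gauge where
  A := bilinF LinearMap.id (exp (map G.adDouble S))
  a i := map (LinearMap.inl K g (Dual K g)) (logDeriv (K := K) S i)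
  A_B x y := by
    simp only [bilinF_apply, formalDouble_B, ← eval_eq_bilin]
    exact G.gauge_B h0 x y
  A_br x y := by
    simp only [bilinF_apply, formalDouble_br, ← eval_eq_bilin]
    exact G.gauge_br h0 x y
  D_A i x := by
    simp only [bilinF_apply, formalDouble_br, formalDouble_D, ← eval_eq_bilin]
    exact G.gauge_D h0 i x
  maurerCartan i j := by
    simp only [formalDouble_D, formalDouble_br]
    rw [← map_pderiv, ← map_pderiv, ← FormalMap.map_sub', pderiv_logDeriv h0, bilin_double_inl_inl]
  isotropic i j := bilin_pairing_inl_inl _ _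
  isotropic_D k i j := by
    simp only [formalDouble_D, formalDouble_B]
    rw [← map_pderiv, bilin_pairing_inl_inl]

end LieQuasiBialgebra

end FormalDouble

/-! ### A basis of l as coordinates on l*, and the gauge action in these coordinates -/

section Coordinates

open FormalMap

variable {K : Type*} [Field K] {d : ℕ} {V W : Type*} [AddCommGroup V] [Module K V]
  [AddCommGroup W] [Module K W]

namespace FormalMap

section Dual

variable {L : Type*} [AddCommGroup L] [Module K L] (b : Basis (Fin d) K L)

/-- The linear function `p ↦ ⟨p, y⟩`. -/
noncomputable def lin (y : L) : FormalMap d K :=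
  map (Dual.eval K L y) (ofLinear b (LinearMap.id : Dual K L →ₗ[K] Dual K L))

theorem ofLinear_coeff (A : Dual K L →ₗ[K] V) (n : Fin d →₀ ℕ) :
    ofLinear b A n = ∑ i, if n = Finsupp.single i 1 then A (b.coord i) else 0 := rfl

theorem map_ofLinear (T : V →ₗ[K] W) (A : Dual K L →ₗ[K] V) :
    map T (ofLinear b A) = ofLinear b (T ∘ₗ A) := by
  funext n
  simp [ofLinear_coeff, apply_ite T]

theorem lin_eq (y : L) : lin b y = ofLinear b (Dual.eval K L y) := map_ofLinear _ _ _

theorem lin_add (y y' : L) : lin b (y + y') = lin b y + lin b y' := by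
  funext n; simp [lin]

theorem lin_neg (y : L) : lin b (-y) = -lin b y := by
  funext n; simp [lin]

theorem lin_sub (y y' : L) : lin b (y - y') = lin b y - lin b y' := by
  rw [sub_eq_add_neg, lin_add, lin_neg, sub_eq_add_neg]

theorem lin_zero : lin b (0 : L) = 0 := by
  funext n; simp [lin]

theorem pderiv_ofLinear (A : Dual K L →ₗ[K] V) (i : Fin d) :
    pderiv K i (ofLinear b A) = const d (A (b.coord i)) := by
  funext n
  rw [pderiv_coeff, ofLinear_coeff, const_coeff]
  by_cases hn : n = 0
  · subst hn
    rw [Finset.sum_eq_single i]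
    · simp
    · intro j _ hj
      rw [if_neg]
      intro h
      have := Finsupp.single_left_inj (b := 1) (by norm_num) |>.1 (by simpa using h)
      exact hj this.symm
    · simp
  · rw [if_neg hn, Finset.sum_eq_zero, smul_zero]
    intro j _
    rw [if_neg]
    intro h
    have h2 := congrArg Finsupp.degree h
    simp only [map_add, Finsupp.degree_single] at h2
    exact hn ((Finsupp.degree_eq_zero_iff n).1 (by omega))

theorem pderiv_lin (y : L) (i : Fin d) : pderiv K i (lin b y) = const d (b.coord i y) := by
  rw [lin_eq, pderiv_ofLinear]; rfl

theorem ofLinear_coeff_zero (A : Dual K L →ₗ[K] V) : ofLinear b A 0 = 0 := by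
  rw [ofLinear_coeff]
  refine Finset.sum_eq_zero fun i _ => if_neg ?_
  intro h
  have := DFunLike.congr_fun h i
  simp at this

/-- The map `v ↦ (p ↦ ⟨p, y⟩ v)`. -/
noncomputable def evalSMul (y : L) : V →ₗ[K] (Dual K L →ₗ[K] V) :=
  LinearMap.smulRightₗ (Dual.eval K L y)

theorem evalSMul_apply (y : L) (v : V) (α : Dual K L) : evalSMul y v α = α y • v := rfl

theorem differential_eq (f : FormalMap d V) :
    differential b f = ∑ i, map (evalSMul (b i)) (pderiv K i f) := by
  funext n
  rw [sum_coeff]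
  rfl

theorem eval_map_evalSMul (y : L) (h : FormalMap d V) (F : FormalMap d (Dual K L)) :
    eval (map (evalSMul y) h) F = (map (Dual.eval K L y) F : FormalMap d K) • h := by
  rw [eval_map, function_smul_def, bilin_map_left, ← bilin_flip]
  rfl

theorem eval_sum_left {ι : Type*} (s : Finset ι) (T : ι → FormalMap d (V →ₗ[K] W))
    (f : FormalMap d V) : eval (∑ i ∈ s, T i) f = ∑ i ∈ s, eval (T i) f := by
  simp only [eval_eq_bilin, bilin_sum_left]

theorem eval_differential (f : FormalMap d V) (F : FormalMap d (Dual K L)) :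
    eval (differential b f) F =
      ∑ i, (map (Dual.eval K L (b i)) F : FormalMap d K) • pderiv K i f := by
  rw [differential_eq, eval_sum_left]
  exact Finset.sum_congr rfl fun i _ => eval_map_evalSMul _ _ _

end Dual

end FormalMap

variable {g : Type*} [LieRing g] [LieAlgebra K g] [FiniteDimensional K g]
  {l : LieSubalgebra K g} (b : Basis (Fin d) K l)

/-- The components of the vector field `p ↦ ad*_z p` on `l*`. -/
noncomputable def coadField (z : l) : Fin d → FormalMap d K := fun i => lin b ⁅z, b i⁆

theorem map_eval_ofLinear_coadMap (z y : l) :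
    map (Dual.eval K l y) (ofLinear b (coadMap K z)) = lin b ⁅z, y⁆ := by
  rw [map_ofLinear, lin_eq]
  congr 1

theorem derivCoad_eq (z : l) (f : FormalMap d V) :
    derivCoad b z f = ∑ i, coadField b z i • pderiv K i f := by
  rw [derivCoad, eval_differential]
  simp only [map_eval_ofLinear_coadMap, coadField]

theorem rightLogDeriv_eq (S : FormalMap d g) :
    rightLogDeriv b S = ∑ i, map (evalSMul (b i)) (logDeriv (K := K) S i) := by
  rw [rightLogDeriv, differential_eq, comp, bilin_sum_right]
  refine Finset.sum_congr rfl fun i _ => ?_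
  rw [bilin_map_right, FormalMap.logDeriv, eval_eq_bilin, map_bilin]
  congr 1
  refine LinearMap.ext fun T => LinearMap.ext fun v => LinearMap.ext fun α => ?_
  simp [evalSMul_apply]

theorem eval_rightLogDeriv_coadMap (S : FormalMap d g) (z : l) :
    eval (rightLogDeriv b S) (ofLinear b (coadMap K z)) =
      ∑ i, coadField b z i • logDeriv (K := K) S i := by
  rw [rightLogDeriv_eq, eval_sum_left]
  refine Finset.sum_congr rfl fun i _ => ?_
  rw [eval_map_evalSMul, map_eval_ofLinear_coadMap]
  rfl

theorem adjointMap_evalSMul (y : l) (v : g) (ξ : Dual K g) :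
    adjointMap l (evalSMul y v) ξ = ξ v • (y : g) := by
  have h : (evalEquiv K l).symm (Dual.transpose (evalSMul y v) ξ) = ξ v • y := by
    rw [LinearEquiv.symm_apply_eq]
    ext α
    simp [Dual.transpose_apply, evalSMul_apply, mul_comm]
  change ((evalEquiv K l).symm (Dual.transpose (evalSMul y v) ξ) : g) = _
  rw [h]
  rfl

/-- The transpose `Ad*_σ ξ`. -/
noncomputable def coAdExp (S : FormalMap d g) (ξ : Dual K g) : FormalMap d (Dual K g) :=
  eval (map Dual.transpose (AdExp (K := K) S)) (const d ξ)

theorem map_applyₗ_eq_eval (T : FormalMap d (V →ₗ[K] W)) (v : V) :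
    map (LinearMap.applyₗ v) T = eval T (const d v) := by
  rw [eval_eq_bilin, bilin_const_right]; rfl

theorem eval_comp {X : Type*} [AddCommGroup X] [Module K X] (S : FormalMap d (W →ₗ[K] X))
    (T : FormalMap d (V →ₗ[K] W)) (f : FormalMap d V) : eval (comp S T) f = eval S (eval T f) :=
  bilin_assoc _ _ _ _ (fun _ _ _ => rfl) _ _ _

theorem eval_add_left (S T : FormalMap d (V →ₗ[K] W)) (f : FormalMap d V) :
    eval (S + T) f = eval S f + eval T f := by
  simp only [eval_eq_bilin, bilin_add_left]

theorem eval_sub_left (S T : FormalMap d (V →ₗ[K] W)) (f : FormalMap d V) :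
    eval (S - T) f = eval S f - eval T f := by
  simp only [eval_eq_bilin, bilin_sub_left]

theorem eval_const_left (T : V →ₗ[K] W) (f : FormalMap d V) : eval (const d T) f = map T f := by
  rw [eval_eq_bilin, bilin_const_left]; rfl

/-- The gauge action, applied to an element of `g*`. -/
theorem GaugeMap.eval_act {b : Basis (Fin d) K l} (G : LieQuasiBialgebra K g) (σ : GaugeMap b)
    (r : FormalMap d (Dual K g →ₗ[K] g)) (ξ : Dual K g) :
    eval (σ.act G r) (const d ξ) =
      eval (AdExp (K := K) σ.logarithm) (eval r (coAdExp σ.logarithm ξ))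
        + ∑ i, (map (Dual.eval K g (b i : g)) (coAdExp σ.logarithm ξ) : FormalMap d K) •
            logDeriv (K := K) σ.logarithm i
        - ∑ i, (map ξ (logDeriv (K := K) σ.logarithm i) : FormalMap d K) • const d (b i : g)
        + eval (cocycleExp G σ.logarithm) (const d ξ) := by
  have h1 : eval (map (adjointMap l) (rightLogDeriv b σ.logarithm)) (const d ξ) =
      ∑ i, (map ξ (logDeriv (K := K) σ.logarithm i) : FormalMap d K) • const d (b i : g) := by
    rw [← map_applyₗ_eq_eval, rightLogDeriv_eq, map_sum', map_sum']
    refine Finset.sum_congr rfl fun i _ => ?_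
    rw [function_smul_def, bilin_const_right, map_map, map_map, map_map]
    funext n
    exact adjointMap_evalSMul _ _ _
  rw [act, theta, eval_add_left, eval_add_left, eval_sub_left, h1, eval_comp, eval_comp, eval_comp,
    eval_comp, eval_const_left, rightLogDeriv_eq, eval_sum_left]
  rw [← coAdExp, add_sub_assoc]
  congr 3
  refine Finset.sum_congr rfl fun i _ => ?_
  rw [eval_map_evalSMul, map_map]
  rfl

end Coordinates

/-! ### The submodule attached to a formal map `r` -/

section Lagrangian

open FormalMap

variable {K : Type*} [Field K] {g : Type*} [LieRing g] [LieAlgebra K g] [FiniteDimensional K g]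
  [CharZero K] {l : LieSubalgebra K g} {d : ℕ}

/-- The section `r η ⊕ η` of the double. -/
noncomputable def graphSection (r : FormalMap d (Dual K g →ₗ[K] g)) :
    FormalMap d (Dual K g) →ₗ[FormalMap d K] FormalMap d (g × Dual K g) :=
  mapF (LinearMap.inl K g (Dual K g)) ∘ₗ bilinF LinearMap.id r + mapF (LinearMap.inr K g (Dual K g))

/-- The section of the extended double attached to a section of `g*`. -/
noncomputable def graphGen (b : Basis (Fin d) K l) (r : FormalMap d (Dual K g →ₗ[K] g)) :
    FormalMap d (Dual K g) →ₗ[FormalMap d K] FormalMap d (g × Dual K g) ×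
      (Fin d → FormalMap d K) × (Fin d → FormalMap d K) where
  -- With anchor -i*η, the derivative terms of `tau` carry the sign of the derivative terms in the
  -- dynamical Yang-Baxter equation.
  toFun η := (graphSection r η, fun i => -map (Dual.eval K g (b i : g)) η, 0)
  map_add' η η' := by
    ext1
    · exact map_add (graphSection r) η η'
    · ext1
      · funext i
        simp only [Prod.snd_add, Prod.fst_add, Pi.add_apply, map_add']
        abel
      · simp
  map_smul' s η := by
    ext1
    · exact map_smul (graphSection r) s η
    · ext1
      · funext i
        simp only [Prod.smul_snd, Prod.smul_fst, Pi.smul_apply, map_function_smul_mul,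
          RingHom.id_apply, smul_eq_mul, mul_neg]
      · simp

theorem graphGen_apply (b : Basis (Fin d) K l) (r : FormalMap d (Dual K g →ₗ[K] g))
    (η : FormalMap d (Dual K g)) : graphGen b r η =
      (map (LinearMap.inl K g (Dual K g)) (eval r η) + map (LinearMap.inr K g (Dual K g)) η,
        fun i => -map (Dual.eval K g (b i : g)) η, 0) := rfl

variable (K g) in
/-- The section of the extended double attached to a basis vector of `l`. -/
noncomputable def baseGen {l : LieSubalgebra K g} (b : Basis (Fin d) K l) (k : Fin d) :
    FormalMap d (g × Dual K g) × (Fin d → FormalMap d K) × (Fin d → FormalMap d K) :=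
  (map (LinearMap.inl K g (Dual K g)) (const d (b k : g)), coadField b (b k), Pi.single k 1)

/-- The generators of the Lagrangian submodule attached to `r`. -/
def lagrangianGens (b : Basis (Fin d) K l) (r : FormalMap d (Dual K g →ₗ[K] g)) :
    Set (FormalMap d (g × Dual K g) × (Fin d → FormalMap d K) × (Fin d → FormalMap d K)) :=
  Set.range (fun ξ : Dual K g => graphGen b r (const d ξ)) ∪ Set.range (baseGen K g b)

/-- The Lagrangian submodule attached to `r`. -/
noncomputable def lagrangian (b : Basis (Fin d) K l) (r : FormalMap d (Dual K g →ₗ[K] g)) :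
    Submodule (FormalMap d K)
      (FormalMap d (g × Dual K g) × (Fin d → FormalMap d K) × (Fin d → FormalMap d K)) :=
  Submodule.span _ (lagrangianGens b r)

theorem baseGen_mem (b : Basis (Fin d) K l) (r : FormalMap d (Dual K g →ₗ[K] g)) (k : Fin d) :
    baseGen K g b k ∈ lagrangian b r :=
  Submodule.subset_span (Or.inr ⟨k, rfl⟩)

theorem graphGen_mem (b : Basis (Fin d) K l) (r : FormalMap d (Dual K g →ₗ[K] g))
    (η : FormalMap d (Dual K g)) : graphGen b r η ∈ lagrangian b r := by
  refine induction_const (K := K) η (fun v => ?_) (fun f f' H H' => ?_) (fun r f H => ?_)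
  · exact Submodule.subset_span (Or.inl ⟨v, rfl⟩)
  · rw [map_add]; exact Submodule.add_mem _ H H'
  · rw [map_smul]; exact Submodule.smul_mem _ _ H

section Trilinear

variable (G : LieQuasiBialgebra K g)

theorem formalDouble_cyclic (x y z : FormalMap d (g × Dual K g)) :
    (G.formalDouble d).B ((G.formalDouble d).br x y) z =
      (G.formalDouble d).B ((G.formalDouble d).br y z) x := by
  rw [DiffQuad.B_inv, DiffQuad.B_symm]

theorem trilinear_inl_inl_inl (f h k : FormalMap d g) :
    (G.formalDouble d).B ((G.formalDouble d).br (map (LinearMap.inl K g (Dual K g)) f)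
      (map (LinearMap.inl K g (Dual K g)) h)) (map (LinearMap.inl K g (Dual K g)) k) = 0 := by
  rw [G.formalDouble_br, G.bilin_double_inl_inl, G.formalDouble_B,
    LieQuasiBialgebra.bilin_pairing_inl_inl]

theorem trilinear_inl_inl_inr (f h : FormalMap d g) (ζ : Dual K g) :
    (G.formalDouble d).B ((G.formalDouble d).br (map (LinearMap.inl K g (Dual K g)) f)
      (map (LinearMap.inl K g (Dual K g)) h)) (map (LinearMap.inr K g (Dual K g)) (const d ζ)) =
      map ζ (bilin (lieBilin K g) f h) := by
  rw [G.formalDouble_br, G.bilin_double_inl_inl, G.formalDouble_B, FormalMap.map_const,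
    bilin_const_right, map_map]
  congr 1
  ext x; simp

theorem trilinear_inl_inr_inr (f : FormalMap d g) (η ζ : Dual K g) :
    (G.formalDouble d).B ((G.formalDouble d).br (map (LinearMap.inl K g (Dual K g)) f)
      (map (LinearMap.inr K g (Dual K g)) (const d η)))
      (map (LinearMap.inr K g (Dual K g)) (const d ζ)) = map (ζ ∘ₗ G.ϖ.flip η) f := by
  rw [G.formalDouble_br, G.bilin_double_inl, G.formalDouble_B, FormalMap.map_const,
    FormalMap.map_const, bilin_const_right, bilin_const_right, map_map]
  congr 1
  ext x; simp [G.adDouble_apply]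

theorem trilinear_inr_inr_inr (ξ η ζ : Dual K g) :
    (G.formalDouble d).B ((G.formalDouble d).br (map (LinearMap.inr K g (Dual K g)) (const d ξ))
      (map (LinearMap.inr K g (Dual K g)) (const d η)))
      (map (LinearMap.inr K g (Dual K g)) (const d ζ)) = const d (G.φ ![ξ, η, ζ]) := by
  rw [G.formalDouble_br, G.formalDouble_B, FormalMap.map_const, FormalMap.map_const,
    FormalMap.map_const, bilin_const_right, bilin_const_right, FormalMap.map_const,
    FormalMap.map_const]
  congr 1
  simp [G.double_apply, doubleBracket, apply_contract]

/-- The pairing of a bracket with a third element is cyclically invariant, so each mixed term can be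
rotated until its g-components come first; the term with three g-components vanishes since g is an
isotropic subalgebra. -/
theorem trilinear_graph (f h k : FormalMap d g) (ξ η ζ : Dual K g) :
    (G.formalDouble d).B ((G.formalDouble d).br
      (map (LinearMap.inl K g (Dual K g)) f + map (LinearMap.inr K g (Dual K g)) (const d ξ))
      (map (LinearMap.inl K g (Dual K g)) h + map (LinearMap.inr K g (Dual K g)) (const d η)))
      (map (LinearMap.inl K g (Dual K g)) k + map (LinearMap.inr K g (Dual K g)) (const d ζ)) =
    const d (G.φ ![ξ, η, ζ]) +
      (map ζ (bilin (lieBilin K g) f h) + map (ζ ∘ₗ G.ϖ.flip η) f) +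
      (map ξ (bilin (lieBilin K g) h k) + map (ξ ∘ₗ G.ϖ.flip ζ) h) +
      (map η (bilin (lieBilin K g) k f) + map (η ∘ₗ G.ϖ.flip ξ) k) := by
  have e : ∀ x y z, (G.formalDouble d).B ((G.formalDouble d).br x y) z =
      (G.formalDouble d).B ((G.formalDouble d).br z x) y := fun x y z =>
    (formalDouble_cyclic G z x y).symm
  simp only [map_add, LinearMap.add_apply]
  rw [trilinear_inl_inl_inl, trilinear_inl_inl_inr, trilinear_inl_inr_inr, trilinear_inr_inr_inr,
    e (map (LinearMap.inl K g (Dual K g)) f) (map (LinearMap.inr K g (Dual K g)) (const d η)),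
    trilinear_inl_inl_inr,
    formalDouble_cyclic G (map (LinearMap.inr K g (Dual K g)) (const d ξ))
      (map (LinearMap.inl K g (Dual K g)) h) (map (LinearMap.inl K g (Dual K g)) k),
    trilinear_inl_inl_inr,
    formalDouble_cyclic G (map (LinearMap.inr K g (Dual K g)) (const d ξ))
      (map (LinearMap.inl K g (Dual K g)) h) (map (LinearMap.inr K g (Dual K g)) (const d ζ)),
    trilinear_inl_inr_inr,
    e (map (LinearMap.inr K g (Dual K g)) (const d ξ))
      (map (LinearMap.inr K g (Dual K g)) (const d η)) (map (LinearMap.inl K g (Dual K g)) k),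
    trilinear_inl_inr_inr]
  abel

end Trilinear

section Pairings

variable (G : LieQuasiBialgebra K g) (b : Basis (Fin d) K l)
  (r : FormalMap d (Dual K g →ₗ[K] g))

theorem pairing_inl_graph (f h : FormalMap d g) (ζ : Dual K g) :
    (G.formalDouble d).B (map (LinearMap.inl K g (Dual K g)) f)
      (map (LinearMap.inl K g (Dual K g)) h + map (LinearMap.inr K g (Dual K g)) (const d ζ)) =
      map ζ f := by
  rw [map_add, G.formalDouble_B, G.formalDouble_B, LieQuasiBialgebra.bilin_pairing_inl_inl,
    zero_add, FormalMap.map_const, bilin_const_right, map_map]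
  congr 1
  ext x; simp

theorem pairing_graph_graph (f h : FormalMap d g) (ξ ζ : Dual K g) :
    (G.formalDouble d).B
      (map (LinearMap.inl K g (Dual K g)) f + map (LinearMap.inr K g (Dual K g)) (const d ξ))
      (map (LinearMap.inl K g (Dual K g)) h + map (LinearMap.inr K g (Dual K g)) (const d ζ)) =
      map ζ f + map ξ h := by
  have h0 : (G.formalDouble d).B (map (LinearMap.inr K g (Dual K g)) (const d ξ))
      (map (LinearMap.inr K g (Dual K g)) (const d ζ)) = 0 := by
    rw [G.formalDouble_B, FormalMap.map_const, FormalMap.map_const, bilin_const_left,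
      FormalMap.map_const]
    simp [const_zero]
  have h1 := pairing_inl_graph G h f ξ
  rw [DiffQuad.B_symm, map_add, LinearMap.add_apply] at h1
  rw [map_add, map_add, LinearMap.add_apply, LinearMap.add_apply, h0, add_zero, h1, add_comm,
    ← pairing_inl_graph G f (0 : FormalMap d g) ζ, map_zero', zero_add]

end Pairings

end Lagrangian

/-! ### The defining equations of ℓ-matrices as vanishing of `tau` on generators -/

section LagrangianTau

open FormalMap

variable {K : Type*} [Field K] {g : Type*} [LieRing g] [LieAlgebra K g] [FiniteDimensional K g]
  [CharZero K] {l : LieSubalgebra K g} {d : ℕ} (G : LieQuasiBialgebra K g) (b : Basis (Fin d) K l)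
  (r : FormalMap d (Dual K g →ₗ[K] g))

theorem graphGen_const (ξ : Dual K g) : graphGen b r (const d ξ) =
    (map (LinearMap.inl K g (Dual K g)) (eval r (const d ξ)) +
      map (LinearMap.inr K g (Dual K g)) (const d ξ), fun i => -const d (ξ (b i)), 0) := by
  rw [graphGen_apply]
  simp only [FormalMap.map_const]
  rfl

theorem formalDouble_nab_graph (u : Fin d → FormalMap d K) (f : FormalMap d g) (ξ : Dual K g) :
    (G.formalDouble d).nab u (map (LinearMap.inl K g (Dual K g)) f +
      map (LinearMap.inr K g (Dual K g)) (const d ξ)) =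
      map (LinearMap.inl K g (Dual K g)) (∑ i, u i • pderiv K i f) := by
  rw [DiffQuad.nab_apply, map_sum']
  refine Finset.sum_congr rfl fun i _ => ?_
  rw [G.formalDouble_D, pderiv_add, ← map_pderiv, ← map_pderiv, pderiv_const, map_zero', add_zero,
    map_function_smul]

theorem formalDouble_nabR_const (u : Fin d → FormalMap d K) (c : K) :
    (G.formalDouble d).nabR u (const d c) = 0 := by
  rw [DiffQuad.nabR_apply]
  exact Finset.sum_eq_zero fun i _ => by rw [G.formalDouble_δ, pderiv_const, mul_zero]

theorem formalDouble_nabR_lin (u : Fin d → FormalMap d K) (y : l) :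
    (G.formalDouble d).nabR u (lin b y) = ∑ i, u i * const d (b.coord i y) := by
  rw [DiffQuad.nabR_apply]
  exact Finset.sum_congr rfl fun i _ => by rw [G.formalDouble_δ, pderiv_lin]

theorem single_eq_const (k j : Fin d) :
    (Pi.single k 1 : Fin d → FormalMap d K) j = const d ((Pi.single k 1 : Fin d → K) j) := by
  by_cases h : j = k
  · subst h; simp [const_one]
  · simp [Pi.single_eq_of_ne h, const_zero]

theorem extend_B_nab_graph_graph (u : Fin d → FormalMap d K) (ξ η : Dual K g) :
    (G.formalDouble d).extend.B ((G.formalDouble d).extend.nab u (graphGen b r (const d ξ)))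
      (graphGen b r (const d η)) = map η (∑ i, u i • pderiv K i (eval r (const d ξ))) := by
  rw [DiffQuad.extend_nab, DiffQuad.extend_B, graphGen_const, graphGen_const]
  simp only [formalDouble_nab_graph, pairing_inl_graph, map_neg, formalDouble_nabR_const, neg_zero,
    zero_mul, Pi.zero_apply, map_zero, Finset.sum_const_zero, add_zero]

theorem extend_B_nab_base_graph (u : Fin d → FormalMap d K) (k : Fin d) (η : Dual K g) :
    (G.formalDouble d).extend.B ((G.formalDouble d).extend.nab u (baseGen K g b k))
      (graphGen b r (const d η)) = 0 := by
  rw [DiffQuad.extend_nab, DiffQuad.extend_B, graphGen_const, baseGen]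
  have h := formalDouble_nab_graph G u (const d (b k : g)) 0
  simp only [pderiv_const, smul_zero, Finset.sum_const_zero, map_zero', const_zero, add_zero] at h
  simp only [single_eq_const, formalDouble_nabR_const, h,
    zero_mul, Pi.zero_apply, mul_zero, Finset.sum_const_zero, add_zero, map_zero,
    LinearMap.zero_apply]

theorem extend_B_nab_base_base (u : Fin d → FormalMap d K) (j k : Fin d) :
    (G.formalDouble d).extend.B ((G.formalDouble d).extend.nab u (baseGen K g b j))
      (baseGen K g b k) = (G.formalDouble d).nabR u (lin b ⁅b j, b k⁆) := by
  rw [DiffQuad.extend_nab, DiffQuad.extend_B, baseGen, baseGen]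
  have h := formalDouble_nab_graph G u (const d (b j : g)) 0
  simp only [pderiv_const, smul_zero, Finset.sum_const_zero, map_zero', const_zero, add_zero] at h
  simp only [single_eq_const (k := j), formalDouble_nabR_const, h,
    zero_mul, Finset.sum_const_zero, add_zero, map_zero, zero_add,
    LinearMap.zero_apply]
  rw [Finset.sum_eq_single k]
  · simp [coadField]
  · intro i _ hi; simp [Pi.single_eq_of_ne hi]
  · simp

theorem extend_B_graph_graph (r' : FormalMap d (Dual K g →ₗ[K] g)) (ξ η : Dual K g) :
    (G.formalDouble d).extend.B (graphGen b r (const d ξ)) (graphGen b r' (const d η)) =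
      map η (eval r (const d ξ)) + map ξ (eval r' (const d η)) := by
  rw [DiffQuad.extend_B, graphGen_const, graphGen_const]
  simp only [pairing_graph_graph, Pi.zero_apply, mul_zero, zero_mul, Finset.sum_const_zero,
    add_zero]

theorem extend_B_base_graph (k : Fin d) (η : Dual K g) :
    (G.formalDouble d).extend.B (baseGen K g b k) (graphGen b r (const d η)) = 0 := by
  rw [DiffQuad.extend_B, graphGen_const, baseGen]
  simp only [pairing_inl_graph, Pi.zero_apply, mul_zero, Finset.sum_const_zero, add_zero]
  rw [Finset.sum_eq_single k]
  · simp [FormalMap.map_const]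
  · intro i _ hi; simp [Pi.single_eq_of_ne hi]
  · simp

theorem extend_B_base_base (j k : Fin d) :
    (G.formalDouble d).extend.B (baseGen K g b j) (baseGen K g b k) = 0 := by
  rw [DiffQuad.extend_B, baseGen, baseGen]
  rw [Finset.sum_eq_single k, Finset.sum_eq_single j]
  · simp only [G.formalDouble_B, LieQuasiBialgebra.bilin_pairing_inl_inl, coadField,
      Pi.single_eq_same, mul_one, one_mul, zero_add]
    rw [← lie_skew, lin_neg, neg_add_cancel]
  · intro i _ hi; simp [Pi.single_eq_of_ne hi]
  · simp
  · intro i _ hi; simp [Pi.single_eq_of_ne hi]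
  · simp

/-- Coadjoint vector fields act on linear functions through the bracket of l, so the three
derivative terms add up to the Jacobi identity of l. -/
theorem tau_base_base_base (i j k : Fin d) :
    (G.formalDouble d).extend.tau (DiffQuad.anchor _ _ _) (baseGen K g b i) (baseGen K g b j)
      (baseGen K g b k) = 0 := by
  have e : ∀ (y z : l), (G.formalDouble d).nabR (coadField b z) (lin b y) = lin b ⁅z, y⁆ := by
    intro y z
    rw [formalDouble_nabR_lin]
    have h : ⁅z, y⁆ = ∑ i, b.coord i y • ⁅z, b i⁆ := by
      conv_lhs => rw [← b.sum_repr y, lie_sum]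
      simp [lie_smul]
    rw [h, lin_eq, show (Dual.eval K l) (∑ i, b.coord i y • ⁅z, b i⁆) =
      ∑ i, b.coord i y • Dual.eval K l ⁅z, b i⁆ by simp]
    funext n
    rw [sum_coeff, ofLinear_coeff]
    simp only [coadField, lin_eq, ← bilin_mul, bilin_const_right, map_coeff, ofLinear_coeff]
    simp [Finset.mul_sum, mul_comm]
    rw [Finset.sum_comm]
    refine Finset.sum_congr rfl fun x _ => ?_
    split_ifs <;> simp
  rw [DiffQuad.extend_tau, extend_B_nab_base_base, extend_B_nab_base_base, extend_B_nab_base_base]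
  have h : (G.formalDouble d).B ((G.formalDouble d).br (baseGen K g b i).1 (baseGen K g b j).1)
    (baseGen K g b k).1 = 0 := trilinear_inl_inl_inl G _ _ _
  rw [h]
  change 0 + (G.formalDouble d).nabR (coadField b (b i)) _ -
    (G.formalDouble d).nabR (coadField b (b j)) _ +
    (G.formalDouble d).nabR (coadField b (b k)) _ = _
  rw [e, e, e, zero_add, ← lin_sub, ← lin_add, leibniz_lie (b i), ← lie_skew (b k)]
  convert lin_zero b
  abel

/-- The bracket contributes ⟨ξ, [b_j, b_k]⟩, and the derivative of the linear function of [b_j, b_k]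
along the anchor -i*ξ contributes its negative. -/
theorem tau_base_base_graph (j k : Fin d) (ξ : Dual K g) :
    (G.formalDouble d).extend.tau (DiffQuad.anchor _ _ _) (baseGen K g b j) (baseGen K g b k)
      (graphGen b r (const d ξ)) = 0 := by
  rw [DiffQuad.extend_tau, extend_B_nab_base_graph, extend_B_nab_base_graph,
    extend_B_nab_base_base, graphGen_const]
  have h0 : (baseGen K g b j).1 = map (LinearMap.inl K g (Dual K g)) (const d (b j : g)) := rfl
  have h1 : (baseGen K g b k).1 = map (LinearMap.inl K g (Dual K g)) (const d (b k : g)) := rfl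
  rw [map_add, h0, h1, trilinear_inl_inl_inl, trilinear_inl_inl_inr, formalDouble_nabR_lin]
  rw [bilin_const_left, FormalMap.map_const, FormalMap.map_const]
  simp only [neg_mul, const_mul_const, Finset.sum_neg_distrib, ← const_sum]
  rw [zero_add, add_zero, sub_zero, ← sub_eq_add_neg, sub_eq_zero]
  congr 1
  have h : (⁅(b j : g), (b k : g)⁆ : g) = ∑ i, b.coord i ⁅b j, b k⁆ • (b i : g) := by
    have := congrArg (Subtype.val) (b.sum_repr ⁅b j, b k⁆)
    rw [← LieSubalgebra.coe_bracket, ← this]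
    simp only [AddSubmonoidClass.coe_finsetSum, Basis.coord_apply]
    rfl
  change ξ ⁅(b j : g), (b k : g)⁆ = _
  rw [h, map_sum]
  exact Finset.sum_congr rfl fun i _ => by rw [map_smul, smul_eq_mul, mul_comm]

theorem tau_base_graph_graph (hr : ∀ n, IsSkew (r n)) (k : Fin d) (ξ η : Dual K g) :
    (G.formalDouble d).extend.tau (DiffQuad.anchor _ _ _) (baseGen K g b k)
      (graphGen b r (const d ξ)) (graphGen b r (const d η)) =
    map η (eval (derivCoad b (b k) r + const d (G.ϖ (b k)) + map (homAct K g (b k : g)) r)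
      (const d ξ)) := by
  rw [DiffQuad.extend_tau, extend_B_nab_graph_graph, extend_B_nab_base_graph,
    extend_B_nab_base_graph, sub_zero, add_zero, graphGen_const, graphGen_const]
  have h0 : (baseGen K g b k).1 = map (LinearMap.inl K g (Dual K g)) (const d (b k : g)) := rfl
  have h1 : (baseGen K g b k).2.1 = coadField b (b k) := rfl
  have h2 := trilinear_graph G (const d (b k : g)) (eval r (const d ξ)) (eval r (const d η)) 0 ξ η
  have h3 : G.φ ![0, ξ, η] = 0 := G.φ.map_coord_zero 0 rfl
  rw [const_zero, map_zero', add_zero, h3, const_zero, zero_add] at h2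
  have h4 : map η (eval (derivCoad b (b k) r) (const d ξ)) =
      map η (∑ i, coadField b (b k) i • pderiv K i (eval r (const d ξ))) := by
    rw [derivCoad_eq, ← map_applyₗ_eq_eval, ← map_applyₗ_eq_eval, map_sum']
    congr 1
    refine Finset.sum_congr rfl fun i _ => ?_
    rw [map_function_smul, map_pderiv]
  rw [h0, h1, h2, eval_add_left, eval_add_left, map_add', map_add', h4, bilin_const_left,
    bilin_const_right, eval_const_left, ← map_applyₗ_eq_eval, ← map_applyₗ_eq_eval,
    ← map_applyₗ_eq_eval]
  funext n
  have e := hr n η (coadMap K (b k : g) ξ)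
  simp only [add_coeff, map_coeff, FormalMap.map_const, const_coeff, homAct]
  simp only [LinearMap.comp_apply, LinearMap.flip_apply, LinearMap.applyₗ_apply_apply, map_zero,
    LinearMap.zero_apply, LinearMap.zero_comp, LinearMap.comp_zero, LinearMap.coe_mk,
    AddHom.coe_mk, LinearMap.add_apply, map_add, lieBilin_apply, adMap, LieAlgebra.ad_apply, e,
    coadMap_apply, ← lie_skew (b k : g) (r n η), map_neg]
  ring

theorem map_differential_eq (ξ η ζ : Dual K g) :
    (map (ζ ∘ₗ LinearMap.applyₗ η ∘ₗ LinearMap.applyₗ (restrictDual l ξ)) (differential b r) :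
      FormalMap d K) = map ζ (∑ i, const d (ξ (b i)) • pderiv K i (eval r (const d η))) := by
  rw [differential_eq, map_sum', map_sum']
  refine Finset.sum_congr rfl fun i _ => ?_
  rw [map_map, function_smul_const, eval_eq_bilin, bilin_const_right, ← map_pderiv]
  funext n
  have h : restrictDual l ξ (b i) = ξ (b i) := rfl
  simp [evalSMul_apply, h]

/-- Skewness of r rewrites the middle derivative term so that the three become cyclic permutations
of one another; `trilinear_graph` supplies the remaining terms. -/
theorem tau_graph_graph_graph (hr : ∀ n, IsSkew (r n)) (ξ η ζ : Dual K g) :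
    (G.formalDouble d).extend.tau (DiffQuad.anchor _ _ _) (graphGen b r (const d ξ))
      (graphGen b r (const d η)) (graphGen b r (const d ζ)) =
    const d (G.φ ![ξ, η, ζ]) - cyclSum (fun ξ η ζ : Dual K g =>
        (map (ζ ∘ₗ LinearMap.applyₗ η ∘ₗ LinearMap.applyₗ (restrictDual l ξ)) (differential b r)
          - map ζ (bilin (LieAlgebra.ad K g : g →ₗ[K] Module.End K g)
              (map (LinearMap.applyₗ ξ) r) (map (LinearMap.applyₗ η) r))
          - map (ζ ∘ₗ G.ϖ.flip η ∘ₗ LinearMap.applyₗ ξ) r : FormalMap d K)) ξ η ζ := by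
  rw [DiffQuad.extend_tau, extend_B_nab_graph_graph, extend_B_nab_graph_graph,
    extend_B_nab_graph_graph]
  have h : ∀ (ξ η ζ : Dual K g), map ζ (∑ i, (graphGen b r (const d ξ)).2.1 i •
      pderiv K i (eval r (const d η))) = -(map (ζ ∘ₗ LinearMap.applyₗ η ∘ₗ LinearMap.applyₗ
        (restrictDual l ξ)) (differential b r) : FormalMap d K) := by
    intro ξ η ζ
    rw [map_differential_eq, ← map_neg']
    congr 1
    simp only [graphGen_const, neg_smul, Finset.sum_neg_distrib]
  have hsw : ∀ ξ η ζ : Dual K g, map ζ (∑ i, (graphGen b r (const d η)).2.1 i •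
      pderiv K i (eval r (const d ξ))) = -map ξ (∑ i, (graphGen b r (const d η)).2.1 i •
      pderiv K i (eval r (const d ζ))) := by
    intro ξ η ζ
    have e : map ζ (eval r (const d ξ)) = -map ξ (eval r (const d ζ)) := by
      rw [← map_applyₗ_eq_eval, ← map_applyₗ_eq_eval]
      funext n
      simpa using hr n ζ ξ
    simp only [map_sum', map_function_smul, map_pderiv, e, pderiv_neg,
      ← Finset.sum_neg_distrib]
    exact Finset.sum_congr rfl fun i _ => bilin_neg_right _ _ _
  rw [hsw ξ η ζ, h, h, h]
  simp only [graphGen_const, trilinear_graph, map_applyₗ_eq_eval, cyclSum]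
  have h5 : ∀ ξ η ζ : Dual K g, (map (ζ ∘ₗ G.ϖ.flip η ∘ₗ LinearMap.applyₗ ξ) r : FormalMap d K) =
      map (ζ ∘ₗ G.ϖ.flip η) (eval r (const d ξ)) := by
    intro ξ η ζ
    rw [← map_applyₗ_eq_eval, map_map]; rfl
  simp only [h5]
  change _ = _ - (_ - map ζ (bilin (lieBilin K g) _ _) - _ + (_ - map ξ (bilin (lieBilin K g) _ _) - _) +
    (_ - map η (bilin (lieBilin K g) _ _) - _))
  abel

end LagrangianTau

/-! ### Gauge transformations preserve dynamical ℓ-matrices -/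

section GaugeAction

open FormalMap

variable {K : Type*} [Field K] {g : Type*} [LieRing g] [LieAlgebra K g] [FiniteDimensional K g]
  [CharZero K] {l : LieSubalgebra K g} {d : ℕ} (G : LieQuasiBialgebra K g) {b : Basis (Fin d) K l}
  {r r' : FormalMap d (Dual K g →ₗ[K] g)}

theorem isotropic_gens (hr : ∀ n, IsSkew (r n)) : ∀ x ∈ lagrangianGens b r,
    ∀ y ∈ lagrangianGens b r, (G.formalDouble d).extend.B x y = 0 := by
  rintro x (⟨ξ, rfl⟩ | ⟨j, rfl⟩) y (⟨η, rfl⟩ | ⟨k, rfl⟩)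
  · beta_reduce
    rw [extend_B_graph_graph, ← map_applyₗ_eq_eval, ← map_applyₗ_eq_eval]
    funext n
    simpa using (by rw [hr n ξ η]; ring : η (r n ξ) + ξ (r n η) = 0)
  · rw [DiffQuad.B_symm]
    exact extend_B_base_graph G b r k ξ
  · exact extend_B_base_graph G b r j η
  · exact extend_B_base_base G b j k

/-- Antisymmetry of `tau` on isotropic elements reduces the eight combinations of generators to the
four computed above. -/
theorem tau_gens (hr : r ∈ Dynl b G) : ∀ x ∈ lagrangianGens b r, ∀ y ∈ lagrangianGens b r,
    ∀ z ∈ lagrangianGens b r,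
      (G.formalDouble d).extend.tau (DiffQuad.anchor _ _ _) x y z = 0 := by
  obtain ⟨hs, h1, h2⟩ := hr
  have hB := isotropic_gens G (b := b) hs
  have hg : ∀ ξ : Dual K g, graphGen b r (const d ξ) ∈ lagrangianGens b r := fun ξ =>
    Or.inl ⟨ξ, rfl⟩
  have hb : ∀ k, baseGen K g b k ∈ lagrangianGens b r := fun k => Or.inr ⟨k, rfl⟩
  have e1 : ∀ k ξ η, (G.formalDouble d).extend.tau (DiffQuad.anchor _ _ _) (baseGen K g b k)
      (graphGen b r (const d ξ)) (graphGen b r (const d η)) = 0 := by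
    intro k ξ η
    rw [tau_base_graph_graph G b r hs, h2]
    funext n; simp [eval_eq_bilin]
  rintro x (⟨ξ, rfl⟩ | ⟨i, rfl⟩) y (⟨η, rfl⟩ | ⟨j, rfl⟩) z (⟨ζ, rfl⟩ | ⟨k, rfl⟩) <;> beta_reduce
  · rw [tau_graph_graph_graph G b r hs, h1, sub_self]
  · rw [DiffQuad.tau_swap_right _ _ (hB _ (hg ξ) _ (hb k)) (hB _ (hb k) _ (hg η))
      (hB _ (hg ξ) _ (hg η)), DiffQuad.tau_swap_left _ _ (hB _ (hb k) _ (hg ξ)), e1]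
    simp
  · rw [DiffQuad.tau_swap_left _ _ (hB _ (hb j) _ (hg ξ)), e1, neg_zero]
  · rw [DiffQuad.tau_swap_left _ _ (hB _ (hb j) _ (hg ξ)),
      DiffQuad.tau_swap_right _ _ (hB _ (hb j) _ (hb k)) (hB _ (hb k) _ (hg ξ))
      (hB _ (hb j) _ (hg ξ)), tau_base_base_graph]
    simp
  · exact e1 _ _ _
  · rw [DiffQuad.tau_swap_right _ _ (hB _ (hb i) _ (hb k)) (hB _ (hb k) _ (hg η))
      (hB _ (hb i) _ (hg η)), tau_base_base_graph, neg_zero]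
  · exact tau_base_base_graph G b r _ _ _
  · exact tau_base_base_base G b _ _ _

/-- Converse of `isotropic_gens` and `tau_gens`. Skewness has to be extracted from isotropy first,
as the formulas for `tau` rely on it; equivariance is obtained on the basis of l and extended
linearly. -/
theorem mem_dynl_of_gens
    (hB : ∀ x ∈ lagrangianGens b r, ∀ y ∈ lagrangianGens b r, (G.formalDouble d).extend.B x y = 0)
    (hτ : ∀ x ∈ lagrangianGens b r, ∀ y ∈ lagrangianGens b r, ∀ z ∈ lagrangianGens b r,
      (G.formalDouble d).extend.tau (DiffQuad.anchor _ _ _) x y z = 0) : r ∈ Dynl b G := by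
  have hg : ∀ ξ : Dual K g, graphGen b r (const d ξ) ∈ lagrangianGens b r := fun ξ =>
    Or.inl ⟨ξ, rfl⟩
  have hb : ∀ k, baseGen K g b k ∈ lagrangianGens b r := fun k => Or.inr ⟨k, rfl⟩
  have hs : ∀ n, IsSkew (r n) := by
    intro n ξ η
    have h := hB _ (hg ξ) _ (hg η)
    rw [extend_B_graph_graph, ← map_applyₗ_eq_eval, ← map_applyₗ_eq_eval] at h
    have h2 : η (r n ξ) + ξ (r n η) = 0 := by simpa using congrFun h n
    linear_combination h2
  have hk : ∀ k, derivCoad b (b k) r + const d (G.ϖ (b k)) + map (homAct K g (b k : g)) r = 0 := by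
    intro k
    funext n
    refine LinearMap.ext fun ξ => eq_of_dual (K := K) fun η => ?_
    have h := hτ _ (hb k) _ (hg ξ) _ (hg η)
    rw [tau_base_graph_graph G b r hs, ← map_applyₗ_eq_eval] at h
    rw [zero_coeff, LinearMap.zero_apply, map_zero]
    exact congrFun h n
  refine ⟨hs, fun ξ η ζ => ?_, fun z => ?_⟩
  · have h := hτ _ (hg ξ) _ (hg η) _ (hg ζ)
    rw [tau_graph_graph_graph G b r hs, sub_eq_zero] at h
    exact h.symm
  · have h0 : ∀ z : l, derivCoad b z r + const d (G.ϖ z) + map (homAct K g (z : g)) r =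
        ∑ k, b.coord k z • (derivCoad b (b k) r + const d (G.ϖ (b k)) +
          map (homAct K g (b k : g)) r) := by
      intro z
      have hz : z = ∑ k, b.coord k z • b k := (b.sum_repr z).symm
      have hzg : (z : g) = ∑ k, b.coord k z • (b k : g) := by
        conv_lhs => rw [hz]
        simp only [AddSubmonoidClass.coe_finsetSum]
        rfl
      have h1 : derivCoad b z r = ∑ k, b.coord k z • derivCoad b (b k) r := by
        simp only [derivCoad_eq, Finset.smul_sum]
        rw [Finset.sum_comm]
        refine Finset.sum_congr rfl fun i _ => ?_
        have h3 : coadField b z i = ∑ k, b.coord k z • coadField b (b k) i := by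
          have h4 : ⁅z, b i⁆ = ∑ k, b.coord k z • ⁅b k, b i⁆ := by
            conv_lhs => rw [hz, sum_lie]
            simp only [smul_lie]
          rw [coadField, h4]
          funext n
          simp [lin, sum_coeff, coadField]
        rw [h3, Finset.sum_smul]
        refine Finset.sum_congr rfl fun k _ => ?_
        rw [function_smul_def, function_smul_def, bilin_smul_left]
      have h2 : const d (G.ϖ z) = ∑ k, b.coord k z • const d (G.ϖ (b k)) := by
        rw [hzg]
        funext n
        simp only [sum_coeff, smul_coeff, const_coeff, map_sum, map_smul]
        split_ifs <;> simp
      have h3 : map (homAct K g (z : g)) r =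
          ∑ k, b.coord k z • map (homAct K g (b k : g)) r := by
        rw [hzg]
        funext n
        simp only [sum_coeff, smul_coeff, map_coeff, map_sum, map_smul, LinearMap.sum_apply,
          LinearMap.smul_apply]
      rw [h1, h2, h3, ← Finset.sum_add_distrib, ← Finset.sum_add_distrib]
      exact Finset.sum_congr rfl fun k _ => by rw [smul_add, smul_add]
    rw [h0]
    exact Finset.sum_eq_zero fun k _ => by rw [hk, smul_zero]

/-- The gauge transformation of the formal double given by an element of the gauge group. -/
noncomputable def GaugeMap.gauge (σ : GaugeMap b) : (G.formalDouble d).Gauge :=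
  G.gaugeOf σ.logarithm_zero

theorem GaugeMap.gauge_al (σ : GaugeMap b) (v : Fin d → FormalMap d K) :
    (σ.gauge G).al v =
      map (LinearMap.inl K g (Dual K g)) (∑ i, v i • logDeriv (K := K) σ.logarithm i) := by
  rw [DiffQuad.Gauge.al_apply, map_sum']
  exact Finset.sum_congr rfl fun i _ => (map_function_smul _ _ _).symm

theorem GaugeMap.sum_coadField (σ : GaugeMap b) (z : l) :
    ∑ i, coadField b z i • logDeriv (K := K) σ.logarithm i =
      eval (AdExp (K := K) σ.logarithm) (const d (z : g)) - const d (z : g) := by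
  rw [← eval_rightLogDeriv_coadMap, σ.equivariant, map_applyₗ_eq_eval]

/-- Equivariance of σ says that a(ad*_z p) = Ad_σ z - z, which is the amount `Phi` subtracts from
Ad_σ z. The 1-form part is unchanged because g is isotropic. -/
theorem GaugeMap.Phi_baseGen (σ : GaugeMap b) (k : Fin d) :
    (σ.gauge G).Phi (baseGen K g b k) = baseGen K g b k := by
  have h1 : (σ.gauge G).A (baseGen K g b k).1 = map (LinearMap.inl K g (Dual K g))
      (eval (AdExp (K := K) σ.logarithm) (const d (b k : g))) :=
    G.eval_exp_adDouble_inl σ.logarithm_zero _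
  rw [DiffQuad.Gauge.Phi_apply, h1, gauge_al]
  refine Prod.ext ?_ (Prod.ext rfl ?_)
  · have h2 : (baseGen K g b k).2.1 = coadField b (b k) := rfl
    simp only [h2, σ.sum_coadField, ← FormalMap.map_sub', sub_sub_cancel]
    rfl
  · funext i
    have h3 : (G.formalDouble d).B ((σ.gauge G).a i) (map (LinearMap.inl K g (Dual K g))
      (eval (AdExp (K := K) σ.logarithm) (const d (b k : g)))) = 0 :=
      LieQuasiBialgebra.bilin_pairing_inl_inl _ _
    change (baseGen K g b k).2.2 i + (G.formalDouble d).B ((σ.gauge G).a i)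
      (map (LinearMap.inl K g (Dual K g))
      (eval (AdExp (K := K) σ.logarithm) (const d (b k : g)))) = _
    rw [h3, add_zero]

theorem GaugeMap.A_graph (σ : GaugeMap b) (ξ : Dual K g) :
    (σ.gauge G).A (graphGen b r (coAdExp σ.logarithm ξ)).1 =
      map (LinearMap.inl K g (Dual K g))
        (eval (AdExp (K := K) σ.logarithm) (eval r (coAdExp σ.logarithm ξ)) +
          eval (cocycleExp G σ.logarithm) (const d ξ)) +
        map (LinearMap.inr K g (Dual K g)) (const d ξ) := by
  rw [graphGen_apply, map_add, map_add', FormalMap.map_const]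
  have h1 := G.eval_exp_adDouble_inl σ.logarithm_zero (eval r (coAdExp σ.logarithm ξ))
  have h2 := G.eval_exp_adDouble_inr σ.logarithm_zero ξ
  rw [map_applyₗ_eq_eval] at h2
  change eval _ _ + eval _ _ = _
  rw [h1, add_assoc, ← h2]
  rfl

/-- Explains the shape of the gauge action: the automorphism gives Ad_σ r Ad*_σ + π_σ, the
logarithmic derivative along the anchor gives a i* Ad*_σ, and the combination of generators from l,
subtracted to remove the 1-form part created by `Phi`, gives -i a*. -/
theorem GaugeMap.graphGen_act (σ : GaugeMap b) (r : FormalMap d (Dual K g →ₗ[K] g))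
    (ξ : Dual K g) :
    graphGen b (σ.act G r) (const d ξ) = (σ.gauge G).Phi (graphGen b r (coAdExp σ.logarithm ξ)) -
      ∑ k, (map ξ (logDeriv (K := K) σ.logarithm k) : FormalMap d K) • baseGen K g b k := by
  have hv : (graphGen b r (coAdExp σ.logarithm ξ)).2.1 = fun i =>
      -map (Dual.eval K g (b i : g)) (coAdExp σ.logarithm ξ) := rfl
  rw [DiffQuad.Gauge.Phi_apply, σ.A_graph, gauge_al, graphGen_const, σ.eval_act, hv]
  refine Prod.ext ?_ (Prod.ext ?_ ?_)
  · have h1 : ∀ k, (map ξ (logDeriv (K := K) σ.logarithm k) : FormalMap d K) •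
        (baseGen K g b k).1 = map (LinearMap.inl K g (Dual K g))
          ((map ξ (logDeriv (K := K) σ.logarithm k) : FormalMap d K) • const d (b k : g)) :=
      fun k => (map_function_smul _ _ _).symm
    simp only [Prod.fst_sub, Prod.fst_sum, Prod.smul_fst, h1, ← map_sum', neg_smul,
      Finset.sum_neg_distrib, FormalMap.map_add', FormalMap.map_sub', FormalMap.map_neg']
    abel
  · funext i
    simp only [Prod.fst_sub, Prod.snd_sub, Prod.fst_sum, Prod.snd_sum, Prod.smul_fst,
      Prod.smul_snd, Pi.sub_apply, Finset.sum_apply, Pi.smul_apply, smul_eq_mul]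
    -- By antisymmetry of the bracket, equivariance of σ at b i paired with ξ accounts for the
    -- change of anchor from Ad*_σ ξ to ξ.
    have h2 : ∀ k, (baseGen K g b k).2.1 i = -coadField b (b i) k := by
      intro k
      change lin b ⁅b k, b i⁆ = -lin b ⁅b i, b k⁆
      rw [← lie_skew, lin_neg]
    have h3 := congrArg (map ξ) (σ.sum_coadField (b i))
    rw [map_sum', FormalMap.map_sub', FormalMap.map_const] at h3
    have h4 : map ξ (eval (AdExp (K := K) σ.logarithm) (const d (b i : g))) =
        map (Dual.eval K g (b i : g)) (coAdExp σ.logarithm ξ) := by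
      have h5 := LieQuasiBialgebra.bilin_dualPairing_transpose (AdExp (K := K) σ.logarithm) (const d ξ)
        (const d (b i : g))
      rw [bilin_const_right, bilin_const_left] at h5
      exact h5.symm
    simp only [h2, mul_neg, Finset.sum_neg_distrib]
    rw [← h4]
    have h6 : ∑ k, (map ξ (logDeriv (K := K) σ.logarithm k) : FormalMap d K) * coadField b (b i) k =
        ∑ k, map ξ (coadField b (b i) k • logDeriv (K := K) σ.logarithm k) :=
      Finset.sum_congr rfl fun k _ => by rw [map_function_smul_mul, mul_comm]
    rw [h6, h3]
    abel
  · funext i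
    simp only [Prod.snd_sub, Prod.snd_sum, Prod.smul_snd, Pi.sub_apply, Finset.sum_apply,
      Pi.smul_apply, smul_eq_mul]
    have h1 : (graphGen b r (coAdExp σ.logarithm ξ)).2.2 i = 0 := rfl
    have h2 : (G.formalDouble d).B ((σ.gauge G).a i) (map (LinearMap.inl K g (Dual K g))
        (eval (AdExp (K := K) σ.logarithm) (eval r (coAdExp σ.logarithm ξ)) +
          eval (cocycleExp G σ.logarithm) (const d ξ)) +
        map (LinearMap.inr K g (Dual K g)) (const d ξ)) =
        map ξ (logDeriv (K := K) σ.logarithm i) := pairing_inl_graph G _ _ _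
    have h3 : ∀ k, (baseGen K g b k).2.2 = Pi.single k 1 := fun k => rfl
    rw [h1, h2, zero_add, Finset.sum_eq_single i]
    · simp [h3]
    · intro k _ hk; simp [h3, Pi.single_eq_of_ne hk.symm]
    · simp

theorem GaugeMap.graphGen_act_mem (σ : GaugeMap b) (r : FormalMap d (Dual K g →ₗ[K] g)) :
    ∀ x ∈ lagrangianGens b (σ.act G r), ∃ y ∈ lagrangian b r, x = (σ.gauge G).Phi y := by
  rintro x (⟨ξ, rfl⟩ | ⟨k, rfl⟩)
  · refine ⟨graphGen b r (coAdExp σ.logarithm ξ) -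
      ∑ k, (map ξ (logDeriv (K := K) σ.logarithm k) : FormalMap d K) • baseGen K g b k, ?_, ?_⟩
    · exact Submodule.sub_mem _ (graphGen_mem b r _) (Submodule.sum_mem _ fun k _ =>
        Submodule.smul_mem _ _ (baseGen_mem b r k))
    · rw [map_sub, map_sum]
      simp only [map_smul, σ.Phi_baseGen]
      exact σ.graphGen_act G r ξ
  · exact ⟨_, baseGen_mem b r k, (σ.Phi_baseGen G k).symm⟩

/-- The generators for the transformed matrix lie in the `Phi`-image of `lagrangian b r`, on which
pairing and `tau` vanish because `Phi` preserves both. -/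
theorem GaugeMap.act_mem_dynl (σ : GaugeMap b) (hr : r ∈ Dynl b G) : σ.act G r ∈ Dynl b G := by
  have hB := isotropic_gens G (b := b) hr.1
  have hτ := tau_gens G hr
  refine mem_dynl_of_gens G ?_ ?_
  · intro x hx y hy
    obtain ⟨x', hx', rfl⟩ := σ.graphGen_act_mem G r x hx
    obtain ⟨y', hy', rfl⟩ := σ.graphGen_act_mem G r y hy
    rw [DiffQuad.Gauge.Phi_B]
    exact DiffQuad.isotropic_span _ hB hx' hy'
  · intro x hx y hy z hz
    obtain ⟨x', hx', rfl⟩ := σ.graphGen_act_mem G r x hx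
    obtain ⟨y', hy', rfl⟩ := σ.graphGen_act_mem G r y hy
    obtain ⟨z', hz', rfl⟩ := σ.graphGen_act_mem G r z hz
    rw [DiffQuad.Gauge.Phi_tau]
    exact DiffQuad.tau_eq_zero_of_span _ _ hB hτ hx' hy' hz'

end GaugeAction

/-! ### Products and inverses of gauge transformations -/

section GaugeGroup

open FormalMap

variable {K : Type*} [Field K] {g : Type*} [LieRing g] [LieAlgebra K g] [FiniteDimensional K g]
  [CharZero K] {d : ℕ}

namespace FormalMap

theorem AdExp_lie {S : FormalMap d g} (h0 : S 0 = 0) (f h : FormalMap d g) :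
    eval (AdExp (K := K) S) (bilin (lieBilin K g) f h) =
      bilin (lieBilin K g) (eval (AdExp (K := K) S) f) (eval (AdExp (K := K) S) h) :=
  eval_exp_bilin isRep_ad isRep_ad isRep_ad (lieBilin K g) (fun x v w => by simp) h0 f h

theorem pderiv_AdExp {S : FormalMap d g} (h0 : S 0 = 0) (f : FormalMap d g) (i : Fin d) :
    pderiv K i (eval (AdExp (K := K) S) f) = eval (AdExp (K := K) S) (pderiv K i f) +
      bilin (lieBilin K g) (logDeriv (K := K) S i) (eval (AdExp (K := K) S) f) :=
  pderiv_eval_exp isRep_ad h0 f i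

theorem AdExp_injective (S : FormalMap d g) {f h : FormalMap d g}
    (H : eval (AdExp (K := K) S) f = eval (AdExp (K := K) S) h) : f = h :=
  eval_exp_injective _ H

/-- The logarithm of a product. -/
theorem exists_log_mul {S' S : FormalMap d g} (h0' : S' 0 = 0) (h0 : S 0 = 0) :
    ∃ T : FormalMap d g, T 0 = 0 ∧ ∀ i, logDeriv (K := K) T i =
      logDeriv (K := K) S' i + eval (AdExp (K := K) S') (logDeriv (K := K) S i) := by
  -- The product rule a_{σ'σ} = a_{σ'} + Ad_{σ'} a_σ prescribes a family; once it satisfies the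
  -- Maurer-Cartan equation it has a logarithm.
  refine exists_logDeriv_eq fun i j => ?_
  have h1 := pderiv_logDeriv (K := K) h0' i j
  have h2 := congrArg (eval (AdExp (K := K) S')) (pderiv_logDeriv (K := K) h0 i j)
  rw [AdExp_lie h0', eval_eq_bilin, bilin_sub_right, ← eval_eq_bilin, ← eval_eq_bilin] at h2
  simp only [pderiv_add, pderiv_AdExp h0', bilin_add_left, bilin_add_right]
  rw [← h1, ← h2, bilin_lie_swap (logDeriv (K := K) S' j)]
  abel

/-- A product known only through its logarithmic derivative acts as the product in every
finite-dimensional representation: on constants both sides solve the same total differential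
equation with the same initial value. -/
theorem exp_mul {S' S T : FormalMap d g} (h0' : S' 0 = 0) (h0 : S 0 = 0) (hT : T 0 = 0)
    (H : ∀ i, logDeriv (K := K) T i =
      logDeriv (K := K) S' i + eval (AdExp (K := K) S') (logDeriv (K := K) S i))
    {V : Type*} [AddCommGroup V] [Module K V] [FiniteDimensional K V]
    {ρ : g →ₗ[K] Module.End K V} (hρ : IsRep ρ) (f : FormalMap d V) :
    eval (exp (map ρ T)) f = eval (exp (map ρ S')) (eval (exp (map ρ S)) f) := by
  refine induction_const (K := K) f (fun v => ?_) (fun f f' H H' => ?_) (fun r f H => ?_)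
  · rw [← sub_eq_zero]
    refine eq_zero_of_pderiv_eq ρ (logDeriv (K := K) T) _ ?_ fun i => ?_
    · rw [sub_coeff, eval_exp_coeff_zero, eval_exp_coeff_zero, eval_exp_coeff_zero, sub_self]
    · rw [pderiv_sub, pderiv_eval_exp_const hρ hT, pderiv_eval_exp hρ h0',
        pderiv_eval_exp_const hρ h0, eval_exp_bilin isRep_ad hρ hρ ρ (fun x v w => by
          simp [hρ x v]) h0', bilin_sub_right, H i]
      simp only [bilin_add_left]
      congr 1
      rw [add_comm]
      rfl
  · simp only [eval_eq_bilin, bilin_add_right] at H H' ⊢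
    rw [H, H']
  · simp only [eval_eq_bilin, bilin_function_smul_right] at H ⊢
    rw [H]

/-- The logarithm of the inverse. -/
theorem exists_log_inv {S : FormalMap d g} (h0 : S 0 = 0) :
    ∃ T : FormalMap d g, T 0 = 0 ∧ ∀ i, eval (AdExp (K := K) S) (logDeriv (K := K) T i) =
      -logDeriv (K := K) S i := by
  -- The inverse must have logarithmic derivative -Ad_σ⁻¹ a_σ; injectivity of Ad_σ lets the
  -- Maurer-Cartan equation be checked after applying Ad_σ.
  choose a ha using fun i => eval_exp_surjective (adFormal (K := K) S) (-logDeriv (K := K) S i)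
  change ∀ i, eval (AdExp (K := K) S) (a i) = _ at ha
  have hD : ∀ i j, eval (AdExp (K := K) S) (pderiv K i (a j)) =
      -pderiv K i (logDeriv (K := K) S j) +
        bilin (lieBilin K g) (logDeriv (K := K) S i) (logDeriv (K := K) S j) := by
    intro i j
    have h := pderiv_AdExp (K := K) h0 (a j) i
    rw [ha, pderiv_neg, bilin_neg_right] at h
    rw [h]; abel
  obtain ⟨T, hT, hTa⟩ := exists_logDeriv_eq (K := K) (a := a) fun i j => by
    refine AdExp_injective (K := K) S ?_
    rw [AdExp_lie h0, eval_eq_bilin, bilin_sub_right, ← eval_eq_bilin, ← eval_eq_bilin, hD, hD,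
      ha, ha, bilin_neg_left, bilin_neg_right, neg_neg,
      bilin_lie_swap (logDeriv (K := K) S j), ← pderiv_logDeriv (K := K) h0]
    abel
  exact ⟨T, hT, fun i => by rw [hTa, ha]⟩

theorem adFormal_zero : adFormal (K := K) (0 : FormalMap d g) = 0 := map_zero' _

theorem AdExp_zero (f : FormalMap d g) : eval (AdExp (K := K) (0 : FormalMap d g)) f = f := by
  rw [AdExp, adFormal_zero, exp_zero, eval_one]

theorem logDeriv_zero (i : Fin d) : logDeriv (K := K) (0 : FormalMap d g) i = 0 := by
  rw [FormalMap.logDeriv, show pderiv K i (0 : FormalMap d g) = 0 from pderiv_zero i, eval_eq_bilin,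
    bilin_zero_right]

end FormalMap

variable {l : LieSubalgebra K g} {b : Basis (Fin d) K l} (G : LieQuasiBialgebra K g)

/-- `σ` is the product of `σ₁` and `σ₂`. -/
def GaugeMap.IsMul (σ σ₁ σ₂ : GaugeMap b) : Prop := ∀ i, logDeriv (K := K) σ.logarithm i =
  logDeriv (K := K) σ₁.logarithm i +
    eval (AdExp (K := K) σ₁.logarithm) (logDeriv (K := K) σ₂.logarithm i)

theorem GaugeMap.equivariant_iff (S : FormalMap d g) (z : l) :
    (eval (rightLogDeriv b S) (ofLinear b (coadMap K z))
      = map (LinearMap.applyₗ (z : g)) (AdExp (K := K) S) - const d (z : g)) ↔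
    ∑ i, coadField b z i • logDeriv (K := K) S i =
      eval (AdExp (K := K) S) (const d (z : g)) - const d (z : g) := by
  rw [eval_rightLogDeriv_coadMap, map_applyₗ_eq_eval]

/-- The identity. -/
def GaugeMap.one : GaugeMap b where
  logarithm := 0
  logarithm_zero := rfl
  equivariant z := by
    rw [equivariant_iff, AdExp_zero, sub_self]
    exact Finset.sum_eq_zero fun i _ => by rw [logDeriv_zero, smul_zero]

theorem FormalMap.eval_sum_smul {V W : Type*} [AddCommGroup V] [Module K V] [AddCommGroup W]
    [Module K W] {ι : Type*} (s : Finset ι) (T : FormalMap d (V →ₗ[K] W)) (u : ι → FormalMap d K)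
    (f : ι → FormalMap d V) :
    ∑ i ∈ s, u i • eval T (f i) = eval T (∑ i ∈ s, u i • f i) := by
  simp only [eval_eq_bilin, bilin_sum_right, bilin_function_smul_right]

theorem GaugeMap.exists_mul (σ₁ σ₂ : GaugeMap b) : ∃ σ : GaugeMap b, σ.IsMul σ₁ σ₂ := by
  obtain ⟨T, hT, H⟩ := exists_log_mul (K := K) σ₁.logarithm_zero σ₂.logarithm_zero
  refine ⟨⟨T, hT, fun z => ?_⟩, H⟩
  rw [equivariant_iff]
  have h1 := exp_mul σ₁.logarithm_zero σ₂.logarithm_zero hT H isRep_ad (const d (z : g))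
  change eval (AdExp (K := K) T) _ = eval (AdExp (K := K) _) (eval (AdExp (K := K) _) _) at h1
  simp only [H, smul_add, Finset.sum_add_distrib]
  rw [FormalMap.eval_sum_smul, σ₁.sum_coadField, σ₂.sum_coadField, h1]
  simp only [eval_eq_bilin, bilin_sub_right]
  abel

theorem GaugeMap.exists_inv (σ : GaugeMap b) : ∃ σ' : GaugeMap b,
    ∀ i, eval (AdExp (K := K) σ.logarithm) (logDeriv (K := K) σ'.logarithm i) =
      -logDeriv (K := K) σ.logarithm i := by
  obtain ⟨T, hT, H⟩ := exists_log_inv (K := K) σ.logarithm_zero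
  refine ⟨⟨T, hT, fun z => ?_⟩, H⟩
  rw [equivariant_iff]
  have h1 := exp_mul (T := 0) σ.logarithm_zero hT rfl (fun i => by rw [H, logDeriv_zero]; abel)
    isRep_ad (const d (z : g))
  change eval (AdExp (K := K) _) _ = eval (AdExp (K := K) _) (eval (AdExp (K := K) _) _) at h1
  rw [AdExp_zero] at h1
  refine AdExp_injective (K := K) σ.logarithm ?_
  rw [← FormalMap.eval_sum_smul]
  simp only [H, smul_neg, Finset.sum_neg_distrib]
  rw [σ.sum_coadField, eval_eq_bilin _ (_ - _), bilin_sub_right, ← eval_eq_bilin, ← eval_eq_bilin,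
    ← h1]
  abel

theorem DiffQuad.Gauge.Phi_mul {R E ι : Type*} [CommRing R] [AddCommGroup E] [Module R E]
    [Fintype ι] {Q : DiffQuad R E ι} {σ σ₁ σ₂ : Q.Gauge} (hA : ∀ x, σ.A x = σ₁.A (σ₂.A x))
    (ha : ∀ i, σ.a i = σ₁.a i + σ₁.A (σ₂.a i)) (h : ∀ i j, Q.B (σ₁.a i) (σ₁.A (σ₂.a j)) = 0)
    (x : E × (ι → R) × (ι → R)) : σ.Phi x = σ₁.Phi (σ₂.Phi x) := by
  rw [Phi_apply, Phi_apply σ₁, Phi_apply σ₂]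
  refine Prod.ext ?_ (Prod.ext rfl ?_)
  · simp only [al_apply, ha, hA, smul_add, Finset.sum_add_distrib, map_sub, map_sum, map_smul]
    abel
  · funext i
    have h2 : ∀ v, Q.B (σ₁.a i) (σ₁.A (σ₂.al v)) = 0 := by
      intro v
      simp [al_apply, h]
    simp only [hA, ha, map_sub, map_add, LinearMap.add_apply, σ₁.A_B, h2]
    ring

theorem GaugeMap.IsMul.Phi {σ σ₁ σ₂ : GaugeMap b} (H : σ.IsMul σ₁ σ₂)
    (x : FormalMap d (g × Dual K g) × (Fin d → FormalMap d K) × (Fin d → FormalMap d K)) :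
    (σ.gauge G).Phi x = (σ₁.gauge G).Phi ((σ₂.gauge G).Phi x) := by
  have hA : ∀ i, (σ₁.gauge G).A ((σ₂.gauge G).a i) = map (LinearMap.inl K g (Dual K g))
      (eval (AdExp (K := K) σ₁.logarithm) (logDeriv (K := K) σ₂.logarithm i)) := fun i =>
    G.eval_exp_adDouble_inl σ₁.logarithm_zero _
  refine DiffQuad.Gauge.Phi_mul (fun x => ?_) (fun i => ?_) (fun i j => ?_) x
  · exact exp_mul σ₁.logarithm_zero σ₂.logarithm_zero σ.logarithm_zero H G.isRep_adDouble x
  · rw [hA]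
    change map _ _ = map _ _ + _
    rw [H, FormalMap.map_add']
  · rw [hA]
    exact LieQuasiBialgebra.bilin_pairing_inl_inl _ _

theorem GaugeMap.lagrangian_act_le (σ : GaugeMap b) (r : FormalMap d (Dual K g →ₗ[K] g)) :
    lagrangian b (σ.act G r) ≤ (lagrangian b r).map (σ.gauge G).Phi := by
  refine Submodule.span_le.2 fun x hx => ?_
  obtain ⟨y, hy, rfl⟩ := σ.graphGen_act_mem G r x hx
  exact ⟨y, hy, rfl⟩

/-- The graphs of both sides lie in the image of one isotropic submodule under the same `Phi`.
Orthogonality of a graph element for ζ to those of both matrices for ξ forces equality, so no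
cocycle identity for π or θ is needed. -/
theorem GaugeMap.IsMul.act {σ σ₁ σ₂ : GaugeMap b} (H : σ.IsMul σ₁ σ₂)
    {r : FormalMap d (Dual K g →ₗ[K] g)} (hr : ∀ n, IsSkew (r n)) :
    σ.act G r = σ₁.act G (σ₂.act G r) := by
  have hB := isotropic_gens G (b := b) hr
  have h1 : ∀ ξ, ∃ y ∈ lagrangian b r,
      graphGen b (σ.act G r) (const d ξ) = (σ.gauge G).Phi y := fun ξ =>
    σ.graphGen_act_mem G r _ (Or.inl ⟨ξ, rfl⟩)
  have h2 : ∀ ξ, ∃ y ∈ lagrangian b r,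
      graphGen b (σ₁.act G (σ₂.act G r)) (const d ξ) = (σ.gauge G).Phi y := by
    intro ξ
    obtain ⟨y, hy, e⟩ := σ₁.graphGen_act_mem G (σ₂.act G r) _ (Or.inl ⟨ξ, rfl⟩)
    obtain ⟨z, hz, rfl⟩ := σ₂.lagrangian_act_le G r hy
    exact ⟨z, hz, e.trans (H.Phi G z).symm⟩
  funext n
  refine LinearMap.ext fun ξ => eq_of_dual (K := K) fun ζ => ?_
  obtain ⟨y₁, hy₁, e₁⟩ := h1 ζ
  obtain ⟨y₂, hy₂, e₂⟩ := h1 ξ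
  obtain ⟨y₃, hy₃, e₃⟩ := h2 ξ
  have e4 := extend_B_graph_graph G b (σ.act G r) (σ.act G r) ζ ξ
  have e5 := extend_B_graph_graph G b (σ.act G r) (σ₁.act G (σ₂.act G r)) ζ ξ
  rw [e₁, e₂, DiffQuad.Gauge.Phi_B, DiffQuad.isotropic_span _ hB hy₁ hy₂] at e4
  rw [e₁, e₃, DiffQuad.Gauge.Phi_B, DiffQuad.isotropic_span _ hB hy₁ hy₃, e4,
    add_right_inj, ← map_applyₗ_eq_eval, ← map_applyₗ_eq_eval] at e5
  exact congrFun e5 n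

theorem GaugeMap.act_of_logarithm_eq_zero {σ : GaugeMap b} (h : σ.logarithm = 0)
    (r : FormalMap d (Dual K g →ₗ[K] g)) : σ.act G r = r := by
  have hco : ∀ ξ : Dual K g, coAdExp (0 : FormalMap d g) ξ = const d ξ := by
    intro ξ
    rw [coAdExp, AdExp, adFormal_zero, exp_zero, end_one_eq_const, FormalMap.map_const,
      eval_const_left, FormalMap.map_const]
    rfl
  have hc : cocycleExp G (0 : FormalMap d g) = 0 := by
    rw [cocycleExp, FormalMap.map_zero' G.ϖ, eval_eq_bilin, bilin_zero_right]
  funext n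
  refine LinearMap.ext fun ξ => ?_
  have e := congrFun (σ.eval_act G r ξ) n
  simp only [h, hco, AdExp_zero, logDeriv_zero, map_zero', smul_zero, Finset.sum_const_zero, hc,
    zero_smul, add_zero, sub_zero] at e
  rw [eval_eq_bilin 0, bilin_zero_left, add_zero, ← map_applyₗ_eq_eval, ← map_applyₗ_eq_eval] at e
  exact e

theorem gaugeRel_equivalence : Equivalence (GaugeRel b G) where
  refl r := ⟨GaugeMap.one, (GaugeMap.act_of_logarithm_eq_zero G rfl _).symm⟩
  symm {r r'} := by
    rintro ⟨σ, h⟩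
    obtain ⟨σ', H⟩ := σ.exists_inv
    obtain ⟨τ, hτ⟩ := σ'.exists_mul σ
    refine ⟨σ', ?_⟩
    have h1 : ∀ f : FormalMap d g, eval (AdExp (K := K) σ'.logarithm)
        (eval (AdExp (K := K) σ.logarithm) f) = f := by
      have h2 : ∀ f : FormalMap d g, eval (AdExp (K := K) σ.logarithm)
          (eval (AdExp (K := K) σ'.logarithm) f) = f := by
        intro f
        have := exp_mul (T := 0) σ.logarithm_zero σ'.logarithm_zero rfl
          (fun i => by rw [H, logDeriv_zero]; abel) isRep_ad f
        change eval (AdExp (K := K) _) _ = eval (AdExp (K := K) _) (eval (AdExp (K := K) _) _)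
          at this
        rw [AdExp_zero] at this
        exact this.symm
      intro f
      exact AdExp_injective (K := K) σ.logarithm (h2 _)
    -- The candidate inverse was built on the right of σ. The product in the other order has
    -- vanishing logarithmic derivative, so its logarithm is zero by uniqueness.
    have h3 : τ.logarithm = 0 := by
      refine eq_of_logDeriv (K := K) τ.logarithm_zero rfl fun i => ?_
      refine AdExp_injective (K := K) σ.logarithm ?_
      rw [hτ, logDeriv_zero, eval_eq_bilin, bilin_add_right, ← eval_eq_bilin, ← eval_eq_bilin, H,
        eval_eq_bilin _ 0, bilin_zero_right]
      rw [neg_add_eq_zero]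
      refine AdExp_injective (K := K) σ'.logarithm ?_
      rw [h1]
    rw [h, ← hτ.act G r.2.1, GaugeMap.act_of_logarithm_eq_zero G h3]
  trans {r r' r''} := by
    rintro ⟨σ, h⟩ ⟨σ', h'⟩
    obtain ⟨τ, hτ⟩ := σ'.exists_mul σ
    exact ⟨τ, by rw [h', h, hτ.act G r.2.1]⟩

end GaugeGroup

/-! ### Constant terms: normalisation and gauge invariance -/

section Reductive

open FormalMap

variable {K : Type*} [Field K] {g : Type*} [LieRing g] [LieAlgebra K g] [FiniteDimensional K g]
  {l : LieSubalgebra K g} {m : Submodule K g} (hlm : IsReductiveDecomposition l m)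

/-- The projection onto `l` along `m`. -/
noncomputable def lProj : g →ₗ[K] l := Submodule.projectionOnto l.toSubmodule m hlm.1

theorem lProj_coe (z : l) : lProj hlm (z : g) = z :=
  Submodule.projectionOnto_apply_left hlm.1 z

theorem lProj_of_mem {y : g} (hy : y ∈ m) : lProj hlm y = 0 :=
  (Submodule.projectionOnto_apply_eq_zero_iff hlm.1).2 hy

theorem sub_lProj_mem (y : g) : y - lProj hlm y ∈ m :=
  Submodule.sub_projection_mem hlm.1 y

theorem lProj_lie (z : l) (y : g) : lProj hlm ⁅(z : g), y⁆ = ⁅z, lProj hlm y⁆ := by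
  have h : ⁅(z : g), y⁆ = ((⁅z, lProj hlm y⁆ : l) : g) + ⁅(z : g), y - lProj hlm y⁆ := by
    rw [LieSubalgebra.coe_bracket, lie_sub]; abel
  rw [h, map_add, lProj_coe, lProj_of_mem hlm (hlm.2 z z.2 _ (sub_lProj_mem hlm y)), add_zero]

/-- The extension of a form on `l` by zero on `m`. -/
noncomputable def liftDual : Dual K l →ₗ[K] Dual K g := (lProj hlm).dualMap

theorem liftDual_apply (α : Dual K l) (y : g) : liftDual hlm α y = α (lProj hlm y) := rfl

theorem liftDual_coadMap (z : l) (α : Dual K l) :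
    liftDual hlm (coadMap K z α) = coadMap K (z : g) (liftDual hlm α) := by
  ext y
  rw [liftDual_apply, coadMap_apply, coadMap_apply, liftDual_apply, lProj_lie]

theorem restrictDual_apply (ξ : Dual K g) (z : l) : restrictDual l ξ z = ξ z := rfl

theorem restrictDual_eq_zero {ξ : Dual K g} (h : ξ ∈ l.toSubmodule.dualAnnihilator) :
    restrictDual l ξ = 0 := by
  ext z
  exact (Submodule.mem_dualAnnihilator ξ).1 h z z.2

theorem liftDual_mem (α : Dual K l) : liftDual hlm α ∈ m.dualAnnihilator :=
  (Submodule.mem_dualAnnihilator _).2 fun y hy => by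
    rw [liftDual_apply, lProj_of_mem hlm hy, map_zero]

theorem sub_liftDual_mem (ξ : Dual K g) :
    ξ - liftDual hlm (restrictDual l ξ) ∈ l.toSubmodule.dualAnnihilator :=
  (Submodule.mem_dualAnnihilator _).2 fun y hy => by
    have h := lProj_coe hlm ⟨y, hy⟩
    rw [LinearMap.sub_apply, liftDual_apply]
    change ξ y - ξ (lProj hlm ((⟨y, hy⟩ : l) : g) : l) = 0
    rw [h, sub_self]

theorem liftDual_restrictDual {ξ : Dual K g} (h : ξ ∈ m.dualAnnihilator) :
    liftDual hlm (restrictDual l ξ) = ξ := by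
  ext y
  have h1 := (Submodule.mem_dualAnnihilator ξ).1 h _ (sub_lProj_mem hlm y)
  rw [map_sub, sub_eq_zero] at h1
  exact h1.symm

/-- Writing forms as sums of one vanishing on l and one vanishing on m, a normalised map retains
only its m-m block. -/
theorem eq_of_isNormalized (hlm : IsReductiveDecomposition l m) {t t' : Dual K g →ₗ[K] g} (h : IsNormalized l m t)
    (h' : IsNormalized l m t')
    (H : ∀ ξ ∈ l.toSubmodule.dualAnnihilator, ∀ η ∈ l.toSubmodule.dualAnnihilator,
      η (t ξ) = η (t' ξ)) : t = t' := by
  refine LinearMap.ext fun ξ => ?_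
  have e : ξ = (ξ - liftDual hlm (restrictDual l ξ)) + liftDual hlm (restrictDual l ξ) := by abel
  have hm := sub_liftDual_mem hlm ξ
  rw [e, map_add, map_add, h.1 _ (liftDual_mem hlm _), h'.1 _ (liftDual_mem hlm _), add_zero,
    add_zero]
  refine eq_of_dual (K := K) fun η => ?_
  have e' : η = (η - liftDual hlm (restrictDual l η)) + liftDual hlm (restrictDual l η) := by abel
  rw [e', LinearMap.add_apply, LinearMap.add_apply, H _ hm _ (sub_liftDual_mem hlm η),
    (Submodule.mem_dualAnnihilator _).1 (liftDual_mem hlm _) _ (h.2 _ hm),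
    (Submodule.mem_dualAnnihilator _).1 (liftDual_mem hlm _) _ (h'.2 _ hm)]

variable {d : ℕ} {b : Basis (Fin d) K l} (G : LieQuasiBialgebra K g)

theorem coadField_coeff_zero (z : l) (i : Fin d) : coadField b z i 0 = 0 := by
  rw [coadField, lin_eq, ofLinear_coeff_zero]

theorem derivCoad_coeff_zero {V : Type*} [AddCommGroup V] [Module K V] (z : l)
    (f : FormalMap d V) : derivCoad b z f 0 = 0 := by
  rw [derivCoad_eq, sum_coeff]
  refine Finset.sum_eq_zero fun i _ => ?_
  rw [function_smul_def, bilin_coeff_zero, coadField_coeff_zero, map_zero, LinearMap.zero_apply]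

theorem derivCoad_ofLinear {V : Type*} [AddCommGroup V] [Module K V] (z : l)
    (A : Dual K l →ₗ[K] V) : derivCoad b z (ofLinear b A) = ofLinear b (A ∘ₗ coadMap K z) := by
  rw [derivCoad_eq, ← map_ofLinear b A (coadMap K z)]
  simp only [pderiv_ofLinear, function_smul_def, bilin_const_right, coadField, lin_eq]
  funext n
  simp only [sum_coeff, map_coeff, ofLinear_coeff, map_sum, LinearMap.flip_apply,
    LinearMap.lsmul_apply]
  have h : ∀ i : Fin d, A (coadMap K z (b.coord i)) =
      ∑ j, (b.coord i) ⁅z, b j⁆ • A (b.coord j) := by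
    intro i
    conv_lhs => rw [← b.sum_dual_apply_smul_coord (coadMap K z (b.coord i))]
    rw [map_sum]
    exact Finset.sum_congr rfl fun j _ => by rw [map_smul]; rfl
  rw [Finset.sum_comm]
  refine Finset.sum_congr rfl fun i _ => ?_
  split_ifs
  · rw [h]; rfl
  · simp

/-- The coadjoint vector field vanishes at the origin and ϖ vanishes on l, so only the adjoint
action survives in the equivariance equation at p = 0. -/
theorem homAct_coeff_zero (hϖ : ∀ z ∈ l, G.ϖ z = 0) {r : FormalMap d (Dual K g →ₗ[K] g)}
    (hr : r ∈ Dynl b G) (z : g) (hz : z ∈ l) : homAct K g z (r 0) = 0 := by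
  have h := congrFun (hr.2.2 ⟨z, hz⟩) 0
  rw [add_coeff, add_coeff, derivCoad_coeff_zero, hϖ z hz, map_coeff, const_coeff_zero, zero_add,
    zero_add] at h
  exact h

/-- For forms vanishing on l the derivatives along i*ξ disappear, and the Yang-Baxter equation at p
= 0 is the vanishing of the twisted associator. -/
theorem twistedAssociator_coeff_zero {r : FormalMap d (Dual K g →ₗ[K] g)} (hr : r ∈ Dynl b G)
    {ξ η ζ : Dual K g} (hξ : ξ ∈ l.toSubmodule.dualAnnihilator)
    (hη : η ∈ l.toSubmodule.dualAnnihilator) (hζ : ζ ∈ l.toSubmodule.dualAnnihilator) :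
    G.twistedAssociator (r 0) ξ η ζ = 0 := by
  have h := congrFun (hr.2.1 ξ η ζ) 0
  simp only [cyclSum, add_coeff, sub_coeff, map_coeff, bilin_coeff_zero, const_coeff_zero,
    restrictDual_eq_zero hξ, restrictDual_eq_zero hη, restrictDual_eq_zero hζ, map_zero,
    LinearMap.comp_zero, LinearMap.zero_apply, zero_sub] at h
  rw [LieQuasiBialgebra.twistedAssociator, ← h]
  simp only [cyclSum, LinearMap.comp_apply, LinearMap.applyₗ_apply_apply, LinearMap.flip_apply,
    map_add, map_zero, LinearMap.zero_apply]
  change _ + (_ + _ + _) = _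
  have e : ∀ x y : g, (LieAlgebra.ad K g : g →ₗ[K] Module.End K g) x y = ⁅x, y⁆ := fun _ _ => rfl
  simp only [e]
  ring

variable [CharZero K]

/-- The gauge transformation with equivariant logarithm. -/
noncomputable def GaugeMap.ofEquivariant (S : FormalMap d g) (h0 : S 0 = 0)
    (h : ∀ z : l, derivCoad b z S = bilin (lieBilin K g) S (const d (z : g))) : GaugeMap b where
  logarithm := S
  logarithm_zero := h0
  equivariant z := by
    rw [equivariant_iff]
    -- For dS(ad*_z p) = [S, z], applying (e^{ad S} - 1)/ad S gives a(ad*_z p) = e^{ad S} z - z.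
    have h1 := eval_exp_const_of_intertwines (LieAlgebra.ad K g : g →ₗ[K] Module.End K g)
      (LieAlgebra.ad K g : g →ₗ[K] Module.End K g) LinearMap.id ((lieBilin K g).flip (z : g))
      (z : g) (fun x => rfl) (fun x w => rfl) h0
    have h2 := h z
    rw [derivCoad_eq, bilin_const_right] at h2
    change eval (AdExp (K := K) S) _ = _ at h1
    rw [h1, add_sub_cancel_right, ← h2, ← FormalMap.eval_sum_smul]
    rfl

/-- Since σ_0 = 1, both Ad factors and π_σ are trivial at the origin, leaving l_0 + a i* - i a*. -/
theorem GaugeMap.act_coeff_zero (σ : GaugeMap b) (r : FormalMap d (Dual K g →ₗ[K] g))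
    (ξ : Dual K g) : σ.act G r 0 ξ = r 0 ξ + ∑ i, ξ (b i) • logDeriv (K := K) σ.logarithm i 0 -
      ∑ i, ξ (logDeriv (K := K) σ.logarithm i 0) • (b i : g) := by
  have h := congrFun (σ.eval_act G r ξ) 0
  rw [← map_applyₗ_eq_eval] at h
  have h1 : coAdExp σ.logarithm ξ 0 = ξ := by
    rw [coAdExp, eval_eq_bilin, bilin_coeff_zero, map_coeff, AdExp, exp_coeff_zero]
    simp
    rfl
  have h2 : eval (cocycleExp G σ.logarithm) (const d ξ) 0 = 0 := by
    rw [← map_applyₗ_eq_eval, map_coeff, cocycleExp, eval_eq_bilin, bilin_coeff_zero, map_coeff,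
      σ.logarithm_zero, map_zero, map_zero, map_zero]
  simp only [add_coeff, sub_coeff, sum_coeff, eval_exp_coeff_zero, function_smul_def,
    bilin_coeff_zero, map_coeff, h1, AdExp, eval_eq_bilin r, h2, add_zero] at h
  exact h

theorem logDeriv_coeff_zero {S : FormalMap d g} (h0 : S 0 = 0) (i : Fin d) :
    logDeriv (K := K) S i 0 = pderiv K i S 0 := by
  rw [FormalMap.logDeriv, eval_eq_bilin, bilin_coeff_zero, expSubOneDiv, powerSum_coeff_zero]
  simp

/-- The linear part of the logarithm of the normalising gauge transformation. -/
noncomputable def normalizer (t : Dual K g →ₗ[K] g) : Dual K l →ₗ[K] g :=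
  -- On the l-l block both a i* and -i a* contribute, so each must remove one half; the component in
  -- m is removed entirely by a i*.
  (2 : K)⁻¹ • (l.toSubmodule.subtype ∘ₗ lProj hlm ∘ₗ t ∘ₗ liftDual hlm) - t ∘ₗ liftDual hlm

theorem normalizer_apply (t : Dual K g →ₗ[K] g) (α : Dual K l) : normalizer hlm t α =
    (2 : K)⁻¹ • (lProj hlm (t (liftDual hlm α)) : g) - t (liftDual hlm α) := rfl

theorem normalizer_coadMap {t : Dual K g →ₗ[K] g} (ht : ∀ z ∈ l, homAct K g z t = 0) (z : l)
    (α : Dual K l) : normalizer hlm t (coadMap K z α) = ⁅normalizer hlm t α, (z : g)⁆ := by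
  have h : ∀ ξ, t (coadMap K (z : g) ξ) = ⁅t ξ, (z : g)⁆ := by
    intro ξ
    have h1 : ⁅(z : g), t ξ⁆ + t (coadMap K (z : g) ξ) = 0 := LinearMap.congr_fun (ht z z.2) ξ
    rw [← lie_skew, eq_neg_iff_add_eq_zero, add_comm, h1]
  rw [normalizer_apply, normalizer_apply, liftDual_coadMap, h, sub_lie, smul_lie,
    ← lie_skew (t (liftDual hlm α)) (z : g), map_neg, lProj_lie,
    ← lie_skew (lProj hlm (t (liftDual hlm α)) : g) (z : g)]
  rfl

/-- Every dynamical `ℓ`-matrix is gauge equivalent to one with normalised constant term. -/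
theorem exists_isNormalized (hlm : IsReductiveDecomposition l m) (hϖ : ∀ z ∈ l, G.ϖ z = 0) {r : FormalMap d (Dual K g →ₗ[K] g)}
    (hr : r ∈ Dynl b G) : ∃ σ : GaugeMap b, IsNormalized l m (σ.act G r 0) := by
  have hS : ∀ z : l, derivCoad b z (ofLinear b (normalizer hlm (r 0))) =
      bilin (lieBilin K g) (ofLinear b (normalizer hlm (r 0))) (const d (z : g)) := by
    intro z
    rw [derivCoad_ofLinear, bilin_const_right, map_ofLinear]
    congr 1
    exact LinearMap.ext fun α => normalizer_coadMap hlm (homAct_coeff_zero G hϖ hr) z α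
  set σ : GaugeMap b := GaugeMap.ofEquivariant _ (ofLinear_coeff_zero b _) hS with hσ
  have hl : ∀ i, logDeriv (K := K) σ.logarithm i 0 = normalizer hlm (r 0) (b.coord i) := by
    intro i
    rw [logDeriv_coeff_zero σ.logarithm_zero]
    change pderiv K i (ofLinear b (normalizer hlm (r 0))) 0 = _
    rw [pderiv_ofLinear, const_coeff_zero]
  have h1 : ∀ ξ ∈ m.dualAnnihilator, σ.act G r 0 ξ = 0 := by
    intro ξ hξ
    rw [σ.act_coeff_zero]
    simp only [hl]
    have e1 : ∑ i, ξ (b i) • normalizer hlm (r 0) (b.coord i) =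
        (2 : K)⁻¹ • (lProj hlm (r 0 ξ) : g) - r 0 ξ := by
      have h2 : normalizer hlm (r 0) (restrictDual l ξ) =
          ∑ i, ξ (b i) • normalizer hlm (r 0) (b.coord i) := by
        conv_lhs => rw [← b.sum_dual_apply_smul_coord (restrictDual l ξ), map_sum]
        exact Finset.sum_congr rfl fun i _ => by rw [map_smul]; rfl
      rw [← h2, normalizer_apply, liftDual_restrictDual hlm hξ]
    have e2 : ∑ i, ξ (normalizer hlm (r 0) (b.coord i)) • (b i : g) =
        (2 : K)⁻¹ • (lProj hlm (r 0 ξ) : g) := by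
      have h3 : ∀ i, ξ (normalizer hlm (r 0) (b.coord i)) =
          (2 : K)⁻¹ * b.coord i (lProj hlm (r 0 ξ)) := by
        intro i
        have h4 : ∀ y : g, ξ (lProj hlm y : g) = ξ y := fun y =>
          LinearMap.congr_fun (liftDual_restrictDual hlm hξ) y
        rw [normalizer_apply, map_sub, map_smul, h4, hr.1 0 ξ, liftDual_apply, smul_eq_mul]
        ring
      have h5 : (lProj hlm (r 0 ξ) : g) =
          ∑ i, b.coord i (lProj hlm (r 0 ξ)) • (b i : g) := by
        conv_lhs => rw [← b.sum_repr (lProj hlm (r 0 ξ))]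
        simp only [AddSubmonoidClass.coe_finsetSum]
        rfl
      rw [h5, Finset.smul_sum]
      exact Finset.sum_congr rfl fun i _ => by rw [h3, mul_smul]
    rw [e1, e2]
    abel
  refine ⟨σ, h1, fun ξ _ => ?_⟩
  -- By skewness, vanishing on the annihilator of m puts all values in m.
  have h2 : lProj hlm (σ.act G r 0 ξ) = 0 := by
    refine (Module.forall_dual_apply_eq_zero_iff K _).1 fun α => ?_
    rw [← liftDual_apply, (σ.act_mem_dynl G hr).1 0, h1 _ (liftDual_mem hlm α), map_zero, neg_zero]
  have h3 := sub_lProj_mem hlm (σ.act G r 0 ξ)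
  rwa [h2, ZeroMemClass.coe_zero, sub_zero] at h3

/-- The normalised constant term is invariant under gauge transformations. -/
theorem GaugeMap.act_coeff_zero_eq (hlm : IsReductiveDecomposition l m) (σ : GaugeMap b)
    {r : FormalMap d (Dual K g →ₗ[K] g)} (h : IsNormalized l m (r 0))
    (h' : IsNormalized l m (σ.act G r 0)) : σ.act G r 0 = r 0 := by
  refine eq_of_isNormalized hlm h' h fun ξ hξ η hη => ?_
  have hz : ∀ ζ ∈ l.toSubmodule.dualAnnihilator, ∀ i, ζ (b i : g) = 0 := fun ζ hζ i =>
    (Submodule.mem_dualAnnihilator ζ).1 hζ _ (b i).2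
  -- Forms vanishing on l kill both correction terms a i* and i a*.
  rw [act_coeff_zero]
  simp [hz ξ hξ, hz η hη]

theorem mem_variety (hϖ : ∀ z ∈ l, G.ϖ z = 0) {r : FormalMap d (Dual K g →ₗ[K] g)}
    (hr : r ∈ Dynl b G) (h : IsNormalized l m (r 0)) : r 0 ∈ G.variety l m :=
  ⟨hr.1 0, homAct_coeff_zero G hϖ hr, h, fun _ hξ _ hη _ hζ =>
    twistedAssociator_coeff_zero G hr hξ hη hζ⟩

end Reductive

/-! ### A homotopy formula for the leading difference of two solutions -/

section Injectivity

open FormalMap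

variable {K : Type*} [Field K] {g : Type*} [LieRing g] [LieAlgebra K g] [FiniteDimensional K g]
  {l : LieSubalgebra K g} {m : Submodule K g} (hlm : IsReductiveDecomposition l m) {d : ℕ}
  (b : Basis (Fin d) K l)

section Entry

variable {V : Type*} [AddCommGroup V] [Module K V]

/-- The matrix coefficient `p ↦ ⟨η, w_p ξ⟩`. -/
def entry (w : FormalMap d (Dual K g →ₗ[K] g)) (ξ η : Dual K g) : FormalMap d K :=
  map (η ∘ₗ LinearMap.applyₗ ξ) w

theorem entry_coeff (w : FormalMap d (Dual K g →ₗ[K] g)) (ξ η : Dual K g) (n : Fin d →₀ ℕ) :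
    entry w ξ η n = η (w n ξ) := rfl

/-- The derivative in the direction of the restriction of `ξ` to `l`. -/
noncomputable def dualDeriv (ξ : Dual K g) (f : FormalMap d V) : FormalMap d V :=
  ∑ i, ξ (b i) • pderiv K i f

theorem dualDeriv_add (ξ : Dual K g) (f h : FormalMap d V) :
    dualDeriv b ξ (f + h) = dualDeriv b ξ f + dualDeriv b ξ h := by
  simp only [dualDeriv, pderiv_add, smul_add, Finset.sum_add_distrib]

theorem dualDeriv_sub (ξ : Dual K g) (f h : FormalMap d V) :
    dualDeriv b ξ (f - h) = dualDeriv b ξ f - dualDeriv b ξ h := by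
  simp only [dualDeriv, pderiv_sub, smul_sub, Finset.sum_sub_distrib]

theorem dualDeriv_neg (ξ : Dual K g) (f : FormalMap d V) :
    dualDeriv b ξ (-f) = -dualDeriv b ξ f := by
  simp only [dualDeriv, pderiv_neg, smul_neg, Finset.sum_neg_distrib]

theorem dualDeriv_add_left (ξ ξ' : Dual K g) (f : FormalMap d V) :
    dualDeriv b (ξ + ξ') f = dualDeriv b ξ f + dualDeriv b ξ' f := by
  simp only [dualDeriv, LinearMap.add_apply, add_smul, Finset.sum_add_distrib]

theorem dualDeriv_eq_zero {ξ : Dual K g} (h : ξ ∈ l.toSubmodule.dualAnnihilator)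
    (f : FormalMap d V) : dualDeriv b ξ f = 0 :=
  Finset.sum_eq_zero fun i _ => by
    rw [(Submodule.mem_dualAnnihilator ξ).1 h _ (b i).2, zero_smul]

theorem dualDeriv_liftDual_coord (k : Fin d) (f : FormalMap d V) :
    dualDeriv b (liftDual hlm (b.coord k)) f = pderiv K k f := by
  rw [dualDeriv, Finset.sum_eq_single k]
  · simp [liftDual_apply, lProj_coe]
  · intro i _ hi
    simp [liftDual_apply, lProj_coe, Finsupp.single_apply, hi]
  · simp

theorem map_differential_eq_entry (r : FormalMap d (Dual K g →ₗ[K] g)) (ξ η ζ : Dual K g) :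
    (map (ζ ∘ₗ LinearMap.applyₗ η ∘ₗ LinearMap.applyₗ (restrictDual l ξ)) (differential b r) :
      FormalMap d K) = dualDeriv b ξ (entry r η ζ) := by
  rw [differential_eq, map_sum', dualDeriv]
  refine Finset.sum_congr rfl fun i _ => ?_
  rw [map_map, entry, ← map_pderiv]
  funext n
  simp [evalSMul_apply, restrictDual_apply]

theorem OrderGE_smul {N : ℕ} {f : FormalMap d V} (h : OrderGE N f) (c : K) : OrderGE N (c • f) :=
  fun n hn => by rw [smul_coeff, h n hn, smul_zero]

end Entry

/-- The bracket and ϖ terms agree through degree N, while differentiation lowers degrees by one. The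
degree N + 1 part of the difference is therefore closed for the cyclic differential. -/
theorem orderGE_cyclic (G : LieQuasiBialgebra K g) {r r' : FormalMap d (Dual K g →ₗ[K] g)}
    (hr : r ∈ Dynl b G) (hr' : r' ∈ Dynl b G) {N : ℕ} (h : AgreeTo (N + 1) r' r)
    (ξ η ζ : Dual K g) :
    OrderGE (N + 1) (dualDeriv b ξ (entry (r' - r) η ζ) + dualDeriv b η (entry (r' - r) ζ ξ) +
      dualDeriv b ζ (entry (r' - r) ξ η)) := by
  have h1 := hr.2.1 ξ η ζ
  have h2 := hr'.2.1 ξ η ζ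
  simp only [cyclSum, map_differential_eq_entry] at h1 h2
  have hq : ∀ ξ η ζ : Dual K g, AgreeTo (N + 1)
      (map ζ (bilin (LieAlgebra.ad K g : g →ₗ[K] Module.End K g)
              (map (LinearMap.applyₗ ξ) r') (map (LinearMap.applyₗ η) r'))
          + map (ζ ∘ₗ G.ϖ.flip η ∘ₗ LinearMap.applyₗ ξ) r' : FormalMap d K)
      (map ζ (bilin (LieAlgebra.ad K g : g →ₗ[K] Module.End K g)
              (map (LinearMap.applyₗ ξ) r) (map (LinearMap.applyₗ η) r))
          + map (ζ ∘ₗ G.ϖ.flip η ∘ₗ LinearMap.applyₗ ξ) r : FormalMap d K) := fun ξ η ζ =>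
    (((h.map _).bilin (h.map _) _).map _).add (h.map _)
  have h3 := ((hq ξ η ζ).add (hq η ζ ξ)).add (hq ζ ξ η)
  have e : ∀ η ζ, entry (r' - r) η ζ = entry r' η ζ - entry r η ζ := fun η ζ =>
    FormalMap.map_sub' _ _ _
  simp only [e, dualDeriv_sub]
  rw [AgreeTo] at h3
  convert h3 using 1
  rw [← sub_eq_zero] at h1 h2 ⊢
  rw [← sub_eq_zero.2 (h2.trans h1.symm)]
  abel

/-- The contraction of `w` with the radial vector field. -/
noncomputable def radial (w : FormalMap d (Dual K g →ₗ[K] g)) : FormalMap d g :=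
  ∑ k, (MvPowerSeries.X k : FormalMap d K) • map (LinearMap.applyₗ (liftDual hlm (b.coord k))) w

theorem map_radial (w : FormalMap d (Dual K g →ₗ[K] g)) (η : Dual K g) : map η (radial hlm b w) =
    ∑ k, (MvPowerSeries.X k : FormalMap d K) * entry w (liftDual hlm (b.coord k)) η := by
  rw [radial, map_sum']
  exact Finset.sum_congr rfl fun k _ => by rw [map_function_smul_mul, map_map]; rfl

theorem dualDeriv_map_radial [CharZero K] (w : FormalMap d (Dual K g →ₗ[K] g)) (ξ η : Dual K g) :
    dualDeriv b ξ (map η (radial hlm b w)) = entry w (liftDual hlm (restrictDual l ξ)) η +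
      ∑ k, (MvPowerSeries.X k : FormalMap d K) *
        dualDeriv b ξ (entry w (liftDual hlm (b.coord k)) η) := by
  have h1 : entry w (liftDual hlm (restrictDual l ξ)) η =
      ∑ i, ξ (b i) • entry w (liftDual hlm (b.coord i)) η := by
    conv_lhs => rw [← b.sum_dual_apply_smul_coord (restrictDual l ξ)]
    funext n
    simp [entry_coeff, sum_coeff, restrictDual_apply]
  rw [map_radial, h1]
  simp only [dualDeriv, pderiv_sum, pderiv_mul, pderiv_X, Finset.sum_add_distrib, smul_add,
    ite_mul, one_mul, zero_mul, Finset.sum_ite_eq, Finset.mem_univ, if_true]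
  congr 1
  simp only [Finset.smul_sum, Finset.mul_sum]
  rw [Finset.sum_comm]
  exact Finset.sum_congr rfl fun k _ => Finset.sum_congr rfl fun i _ =>
    (mul_smul_comm _ _ _).symm

theorem OrderGE.X_mul {N : ℕ} {f : FormalMap d K} (hf : OrderGE N f) (i : Fin d) :
    OrderGE (N + 1) ((MvPowerSeries.X i : FormalMap d K) * f) := by
  have h := OrderGE.X_smul (K := K) hf i
  rwa [function_smul_def, function_smul_eq_mul] at h

theorem orderGE_euler_sub [CharZero K] {N : ℕ} {f : FormalMap d K} (hf : OrderGE N f) :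
    OrderGE (N + 1) (∑ k, (MvPowerSeries.X k : FormalMap d K) * pderiv K k f - (N : K) • f) := by
  intro n hn
  have h : ∑ k, (MvPowerSeries.X k : FormalMap d K) * pderiv K k f = euler (K := K) f := by
    rw [euler]
    exact Finset.sum_congr rfl fun k _ => by rw [function_smul_def, function_smul_eq_mul]
  rw [h, sub_coeff, euler_coeff, smul_coeff, ← sub_smul]
  rcases Nat.lt_or_ge n.degree N with h1 | h1
  · rw [hf n h1, smul_zero]
  · rw [show n.degree = N by omega, sub_self, zero_smul]

section Primitive

variable [CharZero K] {w : FormalMap d (Dual K g →ₗ[K] g)} {N : ℕ}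

/-- Cartan's formula for the radial field, read in degree N + 1: closedness removes one term,
Euler's identity gives the factor N + 1, and each argument with a component along l* adds one copy
of w. -/
theorem orderGE_radial (hs : ∀ n, IsSkew (w n))
    (ho : OrderGE (N + 1) w) (hc : ∀ ξ η ζ : Dual K g, OrderGE (N + 1)
    (dualDeriv b ξ (entry w η ζ) + dualDeriv b η (entry w ζ ξ) + dualDeriv b ζ (entry w ξ η)))
    (ξ η : Dual K g) : OrderGE (N + 2)
    (dualDeriv b ξ (map η (radial hlm b w)) - dualDeriv b η (map ξ (radial hlm b w)) -
      (entry w (liftDual hlm (restrictDual l ξ)) η - entry w (liftDual hlm (restrictDual l η)) ξ +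
        ((N + 1 : ℕ) : K) • entry w ξ η)) := by
  have hsk : ∀ ξ η, entry w ξ η = -entry w η ξ := fun ξ η => funext fun n => hs n η ξ
  have h1 : OrderGE (N + 2) (∑ k, (MvPowerSeries.X k : FormalMap d K) *
      pderiv K k (entry w ξ η) - ((N + 1 : ℕ) : K) • entry w ξ η) :=
    orderGE_euler_sub (ho.map _)
  have h2 : OrderGE (N + 2) (∑ k, (MvPowerSeries.X k : FormalMap d K) *
      (dualDeriv b ξ (entry w η (liftDual hlm (b.coord k))) +
        dualDeriv b η (entry w (liftDual hlm (b.coord k)) ξ) + pderiv K k (entry w ξ η))) := by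
    refine OrderGE.sum _ fun k _ => OrderGE.X_mul ?_ k
    have := hc ξ η (liftDual hlm (b.coord k))
    rwa [dualDeriv_liftDual_coord] at this
  convert h1.sub h2 using 1
  rw [dualDeriv_map_radial, dualDeriv_map_radial]
  have h3 : ∀ k, dualDeriv b ξ (entry w η (liftDual hlm (b.coord k))) =
      -dualDeriv b ξ (entry w (liftDual hlm (b.coord k)) η) := fun k => by
    rw [hsk, dualDeriv_neg]
  simp only [h3, mul_add, mul_neg, Finset.sum_add_distrib, Finset.sum_neg_distrib]
  abel

/-- The logarithm of the gauge transformation which kills the leading term `w` of a difference. -/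
noncomputable def corrector (N : ℕ) (w : FormalMap d (Dual K g →ₗ[K] g)) : FormalMap d g :=
  -- These weights invert the eigenvalues N + 2 of the l-m block and N + 3 of the l-l block in
  -- `orderGE_radial`.
  map (((N : K) + 2)⁻¹ • (LinearMap.id - l.toSubmodule.subtype ∘ₗ lProj hlm) +
    ((N : K) + 3)⁻¹ • (l.toSubmodule.subtype ∘ₗ lProj hlm)) (radial hlm b w)

theorem map_corrector_of_mem_left {η : Dual K g} (h : η ∈ m.dualAnnihilator) :
    map η (corrector hlm b N w) = ((N : K) + 3)⁻¹ • map η (radial hlm b w) := by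
  have h4 : ∀ y : g, η (lProj hlm y : g) = η y := fun y =>
    LinearMap.congr_fun (liftDual_restrictDual hlm h) y
  rw [corrector, map_map]
  funext n
  simp [h4]

theorem map_corrector_of_mem_right {η : Dual K g} (h : η ∈ l.toSubmodule.dualAnnihilator) :
    map η (corrector hlm b N w) = ((N : K) + 2)⁻¹ • map η (radial hlm b w) := by
  have h4 : ∀ y : g, η (lProj hlm y : g) = 0 := fun y =>
    (Submodule.mem_dualAnnihilator η).1 h _ (lProj hlm y).2
  rw [corrector, map_map]
  funext n
  simp [h4]

theorem dualDeriv_smul {V : Type*} [AddCommGroup V] [Module K V] (ξ : Dual K g) (c : K)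
    (f : FormalMap d V) : dualDeriv b ξ (c • f) = c • dualDeriv b ξ f := by
  simp only [dualDeriv, pderiv_smul, Finset.smul_sum, smul_comm c]

/-- By bilinearity it suffices to take ξ and η each vanishing on l or on m; on each of the three
blocks the homotopy formula has a single eigenvalue. -/
theorem orderGE_corrector (hs : ∀ n, IsSkew (w n))
    (ho : OrderGE (N + 1) w) (hc : ∀ ξ η ζ : Dual K g, OrderGE (N + 1)
    (dualDeriv b ξ (entry w η ζ) + dualDeriv b η (entry w ζ ξ) + dualDeriv b ζ (entry w ξ η)))
    (ξ η : Dual K g) : OrderGE (N + 2)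
    (dualDeriv b ξ (map η (corrector hlm b N w)) - dualDeriv b η (map ξ (corrector hlm b N w)) -
      entry w ξ η) := by
  have hsk : ∀ ξ η, entry w ξ η = -entry w η ξ := fun ξ η => funext fun n => hs n η ξ
  have hN2 : (N : K) + 2 ≠ 0 := by exact_mod_cast (by omega : N + 2 ≠ 0)
  have hN3 : (N : K) + 3 ≠ 0 := by exact_mod_cast (by omega : N + 3 ≠ 0)
  have hN1 : (N : K) + 1 ≠ 0 := by exact_mod_cast (by omega : N + 1 ≠ 0)
  have key := orderGE_radial hlm b hs ho hc
  have cmm : ∀ ξ ∈ m.dualAnnihilator, ∀ η ∈ m.dualAnnihilator, OrderGE (N + 2)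
    (dualDeriv b ξ (map η (corrector hlm b N w)) - dualDeriv b η (map ξ (corrector hlm b N w)) -
      entry w ξ η) := by
    intro ξ hξ η hη
    rw [map_corrector_of_mem_left hlm b hξ, map_corrector_of_mem_left hlm b hη]
    convert OrderGE_smul (key ξ η) ((N : K) + 3)⁻¹ using 1
    rw [liftDual_restrictDual hlm hξ, liftDual_restrictDual hlm hη, hsk η ξ, dualDeriv_smul,
      dualDeriv_smul]
    funext n
    simp only [sub_coeff, smul_coeff, add_coeff, neg_coeff, smul_eq_mul]
    push_cast
    field_simp
    ring
  have cml : ∀ ξ ∈ m.dualAnnihilator, ∀ η ∈ l.toSubmodule.dualAnnihilator, OrderGE (N + 2)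
    (dualDeriv b ξ (map η (corrector hlm b N w)) - dualDeriv b η (map ξ (corrector hlm b N w)) -
      entry w ξ η) := by
    intro ξ hξ η hη
    have h1 := key ξ η
    rw [dualDeriv_eq_zero b hη, restrictDual_eq_zero hη, map_zero] at h1
    rw [map_corrector_of_mem_right hlm b hη, dualDeriv_eq_zero b hη]
    convert OrderGE_smul h1 ((N : K) + 2)⁻¹ using 1
    rw [liftDual_restrictDual hlm hξ, dualDeriv_smul]
    funext n
    simp only [sub_coeff, smul_coeff, add_coeff, smul_eq_mul, entry_coeff, map_zero, zero_coeff]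
    push_cast
    field_simp
    ring
  -- No derivative survives here, so N + 1 times the block vanishes in degree N + 1. Nothing can
  -- correct this block; equal constant terms are what make N + 1 nonzero from the start.
  have cll : ∀ ξ ∈ l.toSubmodule.dualAnnihilator, ∀ η ∈ l.toSubmodule.dualAnnihilator,
    OrderGE (N + 2) (dualDeriv b ξ (map η (corrector hlm b N w)) -
      dualDeriv b η (map ξ (corrector hlm b N w)) - entry w ξ η) := by
    intro ξ hξ η hη
    have h1 := key ξ η
    rw [dualDeriv_eq_zero b hη, restrictDual_eq_zero hη, map_zero, dualDeriv_eq_zero b hξ,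
      restrictDual_eq_zero hξ, map_zero] at h1
    rw [dualDeriv_eq_zero b hη, dualDeriv_eq_zero b hξ]
    convert OrderGE_smul h1 ((N : K) + 1)⁻¹ using 1
    funext n
    simp only [sub_coeff, smul_coeff, add_coeff, smul_eq_mul, entry_coeff, map_zero, zero_coeff]
    push_cast
    field_simp
    ring
  have anti : ∀ ξ η, OrderGE (N + 2)
      (dualDeriv b ξ (map η (corrector hlm b N w)) - dualDeriv b η (map ξ (corrector hlm b N w)) -
        entry w ξ η) → OrderGE (N + 2)
      (dualDeriv b η (map ξ (corrector hlm b N w)) - dualDeriv b ξ (map η (corrector hlm b N w)) -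
        entry w η ξ) := by
    intro ξ η h
    convert h.neg using 1
    rw [hsk η ξ]
    abel
  have hξ : ξ = (ξ - liftDual hlm (restrictDual l ξ)) + liftDual hlm (restrictDual l ξ) := by abel
  have hη : η = (η - liftDual hlm (restrictDual l η)) + liftDual hlm (restrictDual l η) := by abel
  have m1 := sub_liftDual_mem hlm ξ
  have m2 := sub_liftDual_mem hlm η
  have m3 := liftDual_mem hlm (restrictDual l ξ)
  have m4 := liftDual_mem hlm (restrictDual l η)
  have hfin := ((cll _ m1 _ m2).add (cml _ m3 _ m2)).add
    ((anti _ _ (cml _ m4 _ m1)).add (cmm _ m3 _ m4))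
  have e1 : ∀ η η' : Dual K g, map (η + η') (corrector hlm b N w) =
      (map η (corrector hlm b N w) + map η' (corrector hlm b N w) : FormalMap d K) :=
    fun η η' => rfl
  have e2 : ∀ ξ ξ' η : Dual K g, entry w (ξ + ξ') η = entry w ξ η + entry w ξ' η :=
    fun ξ ξ' η => funext fun n => by simp [entry_coeff]
  have e3 : ∀ ξ η η' : Dual K g, entry w ξ (η + η') = entry w ξ η + entry w ξ η' :=
    fun ξ ξ' η => rfl
  rw [hξ, hη]
  convert hfin using 1
  simp only [e1, e2, e3, dualDeriv_add, dualDeriv_add_left]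
  abel

end Primitive

end Injectivity

/-! ### Successive approximation by gauge transformations -/

section Convergence

open FormalMap

variable {K : Type*} [Field K] [CharZero K] {g : Type*} [LieRing g] [LieAlgebra K g]
  [FiniteDimensional K g] {l : LieSubalgebra K g} {m : Submodule K g}
  (hlm : IsReductiveDecomposition l m) {d : ℕ} {b : Basis (Fin d) K l}

namespace FormalMap

theorem AgreeTo.sum {V ι : Type*} [AddCommGroup V] {N : ℕ} (s : Finset ι) {f h : ι → FormalMap d V}
    (H : ∀ i ∈ s, AgreeTo N (f i) (h i)) : AgreeTo N (∑ i ∈ s, f i) (∑ i ∈ s, h i) :=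
  agreeTo_iff.2 fun n hn => by
    rw [sum_coeff, sum_coeff]
    exact Finset.sum_congr rfl fun i hi => agreeTo_iff.1 (H i hi) n hn

theorem AgreeTo.function_smul {V : Type*} [AddCommGroup V] [Module K V] {N : ℕ}
    {u v : FormalMap d K} {f h : FormalMap d V} (H : AgreeTo N u v) (H' : AgreeTo N f h) :
    AgreeTo N (u • f) (v • h) := H.bilin H' (LinearMap.lsmul K V)

theorem AgreeTo.eval {V W : Type*} [AddCommGroup V] [Module K V] [AddCommGroup W] [Module K W]
    {N : ℕ} {S T : FormalMap d (V →ₗ[K] W)} {f h : FormalMap d V} (H : AgreeTo N S T)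
    (H' : AgreeTo N f h) : AgreeTo N (eval S f) (FormalMap.eval T h) :=
  H.bilin H' LinearMap.id

theorem AgreeTo.AdExp {N : ℕ} {S S' : FormalMap d g} (H : AgreeTo N S S') :
    AgreeTo N (AdExp (K := K) S) (_root_.AdExp (K := K) S') :=
  AgreeTo.powerSum (H.map _) _

theorem AgreeTo.logDeriv {N : ℕ} {S S' : FormalMap d g} (H : AgreeTo (N + 1) S S') (i : Fin d) :
    AgreeTo N (logDeriv (K := K) S i) (FormalMap.logDeriv (K := K) S' i) :=
  AgreeTo.eval (AgreeTo.powerSum ((H.mono (by omega)).map _) _) (H.pderiv (K := K) i)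

theorem eq_of_agreeTo {V : Type*} [AddCommGroup V] {f h : FormalMap d V}
    (H : ∀ N, AgreeTo N f h) : f = h := sub_eq_zero.1 (eq_zero_of_orderGE H)

theorem ofLinear_eq_sum {V L : Type*} [AddCommGroup V] [Module K V] [AddCommGroup L] [Module K L]
    (b : Basis (Fin d) K L) (A : Dual K L →ₗ[K] V) : ofLinear b A =
      ∑ k, (MvPowerSeries.X k : FormalMap d K) • const d (A (b.coord k)) := by
  classical
  funext n
  rw [ofLinear_coeff, sum_coeff]
  refine Finset.sum_congr rfl fun k _ => ?_
  rw [function_smul_def, bilin_const_right, map_coeff]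
  have h := MvPowerSeries.coeff_X (R := K) n k
  rw [MvPowerSeries.coeff_apply] at h
  rw [h]
  split_ifs <;> simp

end FormalMap

theorem coAdExp_agreeTo {N : ℕ} {S S' : FormalMap d g} (H : AgreeTo N S S') (ξ : Dual K g) :
    AgreeTo N (coAdExp S ξ) (coAdExp S' ξ) :=
  AgreeTo.eval (H.AdExp.map _) (AgreeTo.refl _ _)

theorem cocycleExp_agreeTo (G : LieQuasiBialgebra K g) {N : ℕ} {S S' : FormalMap d g}
    (H : AgreeTo N S S') : AgreeTo N (cocycleExp G S) (cocycleExp G S') :=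
  AgreeTo.eval (AgreeTo.powerSum (H.map _) _) (H.map _)

theorem GaugeMap.eval_act_agreeTo (G : LieQuasiBialgebra K g) (σ : GaugeMap b)
    (r : FormalMap d (Dual K g →ₗ[K] g)) {N : ℕ} {S : FormalMap d g} {a : Fin d → FormalMap d g}
    (H : AgreeTo N σ.logarithm S) (Ha : ∀ i, AgreeTo N (logDeriv (K := K) σ.logarithm i) (a i))
    (ξ : Dual K g) : AgreeTo N (eval (σ.act G r) (const d ξ))
      (eval (AdExp (K := K) S) (eval r (coAdExp S ξ))
        + ∑ i, (map (Dual.eval K g (b i : g)) (coAdExp S ξ) : FormalMap d K) • a i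
        - ∑ i, (map ξ (a i) : FormalMap d K) • const d (b i : g)
        + eval (cocycleExp G S) (const d ξ)) := by
  rw [σ.eval_act]
  have hco := coAdExp_agreeTo H ξ
  refine AgreeTo.add (AgreeTo.sub (AgreeTo.add ?_ ?_) ?_) ?_
  · exact AgreeTo.eval H.AdExp (AgreeTo.eval (AgreeTo.refl _ _) hco)
  · exact AgreeTo.sum _ fun i _ => AgreeTo.function_smul (hco.map _) (Ha i)
  · exact AgreeTo.sum _ fun i _ => AgreeTo.function_smul ((Ha i).map _) (AgreeTo.refl _ _)
  · exact AgreeTo.eval (cocycleExp_agreeTo G H) (AgreeTo.refl _ _)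

theorem agreeTo_of_eval {N : ℕ} {r r' : FormalMap d (Dual K g →ₗ[K] g)}
    (H : ∀ ξ : Dual K g, AgreeTo N (eval r (const d ξ)) (eval r' (const d ξ))) : AgreeTo N r r' :=
  agreeTo_iff.2 fun n hn => LinearMap.ext fun ξ => by
    have h := agreeTo_iff.1 (H ξ) n hn
    rwa [← map_applyₗ_eq_eval, ← map_applyₗ_eq_eval] at h

/-- One extra degree of agreement is needed because the action involves the derivative of the
logarithm. -/
theorem GaugeMap.act_agreeTo (G : LieQuasiBialgebra K g) {σ σ' : GaugeMap b}
    (r : FormalMap d (Dual K g →ₗ[K] g)) {N : ℕ}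
    (H : AgreeTo (N + 1) σ.logarithm σ'.logarithm) :
    AgreeTo N (σ.act G r) (σ'.act G r) := by
  refine agreeTo_of_eval fun ξ => ?_
  rw [σ'.eval_act]
  exact σ.eval_act_agreeTo G r (H.mono (by omega)) (fun i => H.logDeriv i) ξ

section Corrector

variable {w : FormalMap d (Dual K g →ₗ[K] g)} {N : ℕ}

theorem orderGE_corrector_self (ho : OrderGE (N + 1) w) :
    OrderGE (N + 2) (corrector hlm b N w) :=
  (OrderGE.sum _ fun k _ => OrderGE.X_smul (ho.map _) k).map _

theorem radial_eq (w : FormalMap d (Dual K g →ₗ[K] g)) :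
    radial hlm b w = eval w (ofLinear b (liftDual hlm)) := by
  rw [ofLinear_eq_sum, eval_eq_bilin, bilin_sum_right]
  refine Finset.sum_congr rfl fun k _ => ?_
  rw [bilin_function_smul_right, ← eval_eq_bilin, map_applyₗ_eq_eval]

theorem derivCoad_map {V W : Type*} [AddCommGroup V] [Module K V] [AddCommGroup W] [Module K W]
    (T : V →ₗ[K] W) (z : l) (f : FormalMap d V) :
    derivCoad b z (map T f) = map T (derivCoad b z f) := by
  rw [derivCoad_eq, derivCoad_eq, map_sum']
  exact Finset.sum_congr rfl fun i _ => by rw [map_function_smul, map_pderiv]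

theorem derivCoad_eval {V W : Type*} [AddCommGroup V] [Module K V] [AddCommGroup W] [Module K W]
    (z : l) (T : FormalMap d (V →ₗ[K] W)) (f : FormalMap d V) :
    derivCoad b z (eval T f) = eval (derivCoad b z T) f + eval T (derivCoad b z f) := by
  simp only [derivCoad_eq, eval_eq_bilin, pderiv_bilin, smul_add, Finset.sum_add_distrib,
    bilin_sum_left, bilin_sum_right, bilin_function_smul_left, bilin_function_smul_right]

/-- In the difference of two solutions the term ϖ_z cancels, so w is equivariant. Contraction with
the radial field preserves equivariance, and so do the projections, because m is stable under l. -/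
theorem derivCoad_corrector (hw : ∀ z : l, derivCoad b z w + map (homAct K g (z : g)) w = 0)
    (z : l) : derivCoad b z (corrector hlm b N w) =
      bilin (lieBilin K g) (corrector hlm b N w) (const d (z : g)) := by
  have h1 : derivCoad b z (radial hlm b w) = -map (LieAlgebra.ad K g (z : g)) (radial hlm b w) := by
    have h2 : eval (map (homAct K g (z : g)) w) (ofLinear b (liftDual hlm)) =
        map (LieAlgebra.ad K g (z : g)) (eval w (ofLinear b (liftDual hlm))) +
          eval w (map (coadMap K (z : g)) (ofLinear b (liftDual hlm))) := by
      funext n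
      simp only [eval_eq_bilin, bilin_coeff, add_coeff, map_coeff, map_sum,
        ← Finset.sum_add_distrib]
      rfl
    have h3 : liftDual hlm ∘ₗ coadMap K z = coadMap K (z : g) ∘ₗ liftDual hlm :=
      LinearMap.ext fun α => liftDual_coadMap hlm z α
    rw [radial_eq, derivCoad_eval, eq_neg_of_add_eq_zero_left (hw z), derivCoad_ofLinear, h3,
      ← map_ofLinear, eval_eq_bilin (-_), bilin_neg_left, ← eval_eq_bilin, h2]
    abel
  rw [corrector, derivCoad_map, h1, bilin_const_right, map_map]
  have h4 : ∀ y : g, ((lProj hlm ⁅(z : g), y⁆ : l) : g) = -⁅(lProj hlm y : g), (z : g)⁆ := by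
    intro y
    rw [lProj_lie, lie_skew]
    rfl
  have h5 : ∀ y : g, -(((N : K) + 2)⁻¹ • (⁅(z : g), y⁆ - (lProj hlm ⁅(z : g), y⁆ : g)) +
      ((N : K) + 3)⁻¹ • (lProj hlm ⁅(z : g), y⁆ : g)) =
      ⁅((N : K) + 2)⁻¹ • (y - (lProj hlm y : g)) + ((N : K) + 3)⁻¹ • (lProj hlm y : g),
        (z : g)⁆ := by
    intro y
    rw [h4, ← lie_skew (z : g) y, add_lie, smul_lie, smul_lie, sub_lie]
    simp only [smul_neg, sub_neg_eq_add, smul_add, smul_sub]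
    abel
  rw [FormalMap.map_neg']
  funext n
  rw [neg_coeff]
  exact h5 _

end Corrector

/-- If two dynamical `ℓ`-matrices agree in degrees at most `N`, then a gauge transformation which is
trivial in degrees at most `N + 1` makes them agree in degree `N + 1`. -/
theorem exists_correction (hlm : IsReductiveDecomposition l m) (G : LieQuasiBialgebra K g)
    {r r' : FormalMap d (Dual K g →ₗ[K] g)}
    (hr : r ∈ Dynl b G) (hr' : r' ∈ Dynl b G) {N : ℕ} (h : AgreeTo (N + 1) r' r) :
    ∃ σ : GaugeMap b, OrderGE (N + 2) σ.logarithm ∧ AgreeTo (N + 2) (σ.act G r) r' := by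
  have ho : OrderGE (N + 1) (r' - r) := h
  have hs : ∀ n, IsSkew ((r' - r) n) := fun n ξ η => by
    rw [sub_coeff, LinearMap.sub_apply, LinearMap.sub_apply, map_sub, map_sub, hr.1 n, hr'.1 n]
    ring
  have hw : ∀ z : l, derivCoad b z (r' - r) + map (homAct K g (z : g)) (r' - r) = 0 := by
    intro z
    have h1 := hr.2.2 z
    have h2 := hr'.2.2 z
    rw [FormalMap.map_sub', derivCoad_eq]
    rw [derivCoad_eq] at h1 h2
    simp only [pderiv_sub, smul_sub, Finset.sum_sub_distrib]
    rw [← sub_eq_zero.2 (h2.trans h1.symm)]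
    abel
  have hT := orderGE_corrector_self (b := b) hlm ho
  have hc := orderGE_corrector hlm b hs ho (orderGE_cyclic b G hr hr' h)
  refine ⟨GaugeMap.ofEquivariant (corrector hlm b N (r' - r)) (hT 0 (by simp))
    (derivCoad_corrector hlm hw), hT, ?_⟩
  set T := corrector hlm b N (r' - r) with hTdef
  set σ : GaugeMap b := GaugeMap.ofEquivariant T (hT 0 (by simp))
    (derivCoad_corrector hlm hw) with hσ
  -- T has order N + 2, so (e^{ad T} - 1)/ad T is the identity to that order.
  have hl : ∀ i, AgreeTo (N + 2) (logDeriv (K := K) σ.logarithm i) (pderiv K i T) := by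
    intro i
    have h1 : AgreeTo (N + 2) T 0 := by rw [AgreeTo, sub_zero]; exact hT
    have h2 : AgreeTo (N + 2) (expSubOneDiv (adFormal (K := K) T))
        (const d (1 : Module.End K g)) := by
      have h3 : AgreeTo (N + 2) (expSubOneDiv (adFormal (K := K) T))
        (expSubOneDiv (adFormal (K := K) (0 : FormalMap d g))) := AgreeTo.powerSum (h1.map _) _
      have h5 : expSubOneDiv (adFormal (K := K) (0 : FormalMap d g)) = const d 1 := by
        rw [adFormal_zero, expSubOneDiv, powerSum_zero]
        simp
      rwa [h5] at h3
    have h4 := AgreeTo.eval h2 (AgreeTo.refl (N + 2) (pderiv K i T))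
    rw [eval_const_left] at h4
    exact h4
  refine agreeTo_of_eval fun ξ => ?_
  -- Modulo order N + 2 the factors Ad_σ, Ad*_σ and π_σ are trivial. The action just adds dT i* - i
  -- dT*, which is r' - r to this order by `orderGE_corrector`.
  have h1 := σ.eval_act_agreeTo G r (S := 0) (by rw [AgreeTo, sub_zero]; exact hT) hl ξ
  refine h1.trans ?_
  have hco : coAdExp (0 : FormalMap d g) ξ = const d ξ := by
    rw [coAdExp, AdExp, adFormal_zero, exp_zero, end_one_eq_const, FormalMap.map_const,
      eval_const_left, FormalMap.map_const]
    rfl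
  have hcc : cocycleExp G (0 : FormalMap d g) = 0 := by
    rw [cocycleExp, FormalMap.map_zero' G.ϖ, eval_eq_bilin, bilin_zero_right]
  rw [hco, AdExp_zero, hcc, eval_eq_bilin 0, bilin_zero_left, add_zero]
  refine agreeTo_iff.2 fun n hn => eq_of_dual (K := K) fun η => ?_
  have h5 := hc ξ η n hn
  rw [← map_applyₗ_eq_eval, ← map_applyₗ_eq_eval]
  simp only [dualDeriv, sub_coeff, add_coeff, sum_coeff, map_coeff, map_sub, map_add, map_sum,
    function_smul_def, bilin_const_right, bilin_const_left, FormalMap.map_const, smul_coeff,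
    entry_coeff, LinearMap.sub_apply, ← map_pderiv] at h5 ⊢
  simp only [LinearMap.applyₗ_apply_apply, LinearMap.flip_apply, LinearMap.lsmul_apply, map_smul,
    Dual.eval_apply, smul_eq_mul] at h5 ⊢
  simp only [mul_comm (η _)] at h5 ⊢
  linear_combination h5

theorem exists_act_eq (hlm : IsReductiveDecomposition l m) (G : LieQuasiBialgebra K g)
    {r r' : FormalMap d (Dual K g →ₗ[K] g)}
    (hr : r ∈ Dynl b G) (hr' : r' ∈ Dynl b G) (h : r 0 = r' 0) :
    ∃ σ : GaugeMap b, σ.act G r = r' := by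
  -- The approximation hypothesis sits inside the existential so that `choose` returns a function of
  -- all gauge transformations, ready for recursion.
  have step : ∀ (N : ℕ) (σ : GaugeMap b), ∃ σ' : GaugeMap b,
      AgreeTo (N + 1) (σ.act G r) r' → AgreeTo (N + 2) (σ'.act G r) r' ∧
        AgreeTo (N + 2) σ'.logarithm σ.logarithm := by
    intro N σ
    by_cases hσ : AgreeTo (N + 1) (σ.act G r) r'
    · obtain ⟨τ, hτ, hτ'⟩ := exists_correction hlm G (σ.act_mem_dynl G hr) hr' hσ.symm
      obtain ⟨σ', H⟩ := τ.exists_mul σ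
      refine ⟨σ', fun _ => ⟨by rwa [H.act G hr.1], ?_⟩⟩
      -- Multiplication by the correction alters the logarithmic derivative only from degree N + 1
      -- on; integrating gains one degree for the logarithm.
      refine agreeTo_of_logDeriv (K := K) σ'.logarithm_zero σ.logarithm_zero fun i => ?_
      rw [H]
      have h0 : AgreeTo (N + 1 + 1) τ.logarithm 0 := by rw [AgreeTo, sub_zero]; exact hτ
      have h1 := h0.logDeriv (K := K) i
      have h2 := AgreeTo.eval (AgreeTo.AdExp (K := K) (h0.mono (Nat.le_succ _)))
        (AgreeTo.refl (N + 1) (logDeriv (K := K) σ.logarithm i))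
      rw [AdExp_zero (K := K)] at h2
      have h3 := h1.add h2
      rwa [logDeriv_zero (K := K), zero_add] at h3
    · exact ⟨σ, fun h => absurd h hσ⟩
  choose f hf using step
  let s : ℕ → GaugeMap b := fun N => 
    Nat.rec (motive := fun _ => GaugeMap b) GaugeMap.one (fun N σ => f N σ) N
  have hs : ∀ N, AgreeTo (N + 1) ((s N).act G r) r' := by
    intro N
    induction N with
    | zero =>
      change AgreeTo 1 ((GaugeMap.one : GaugeMap b).act G r) r'
      rw [GaugeMap.act_of_logarithm_eq_zero G rfl]
      exact orderGE_one (by rw [sub_coeff, h, sub_self])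
    | succ N ih => exact (hf N (s N) ih).1
  have hstep : ∀ N, AgreeTo (N + 2) (s (N + 1)).logarithm (s N).logarithm := fun N =>
    (hf N (s N) (hs N)).2
  have hmono : ∀ N k, AgreeTo (N + 2) (s (N + k)).logarithm (s N).logarithm := by
    intro N k
    induction k with
    | zero => exact AgreeTo.refl _ _
    | succ k ih => exact ((hstep (N + k)).mono (by omega)).trans ih
  -- The coefficient of exponent n has stabilised by stage |n|, since all later logarithms agree
  -- with that one to order |n| + 2.
  let S : FormalMap d g := fun n => (s n.degree).logarithm n
  have hS : ∀ N, AgreeTo (N + 2) S (s N).logarithm := by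
    intro N
    refine agreeTo_iff.2 fun n hn => ?_
    rcases Nat.lt_or_ge N n.degree with h1 | h1
    · have h2 : n.degree = N + 1 := by omega
      change (s n.degree).logarithm n = _
      rw [h2]
      exact agreeTo_iff.1 (hstep N) n hn
    · obtain ⟨k, rfl⟩ := Nat.exists_eq_add_of_le h1
      exact (agreeTo_iff.1 (hmono n.degree k) n (by omega)).symm
  have hS0 : S 0 = 0 := (s (Finsupp.degree (0 : Fin d →₀ ℕ))).logarithm_zero
  have heq : ∀ z : l, ∑ i, coadField b z i • logDeriv (K := K) S i =
      eval (AdExp (K := K) S) (const d (z : g)) - const d (z : g) := by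
    intro z
    -- Equivariance is not linear in S, but each coefficient of either side only involves finitely
    -- many degrees, so it passes to the limit.
    refine eq_of_agreeTo fun N => ?_
    have h1 : AgreeTo N (∑ i, coadField b z i • logDeriv (K := K) S i)
        (∑ i, coadField b z i • logDeriv (K := K) (s N).logarithm i) :=
      AgreeTo.sum _ fun i _ => AgreeTo.function_smul (AgreeTo.refl _ _)
        (((hS N).mono (by omega)).logDeriv i)
    rw [(s N).sum_coadField] at h1
    exact h1.trans ((AgreeTo.eval ((hS N).mono (by omega)).AdExp (AgreeTo.refl _ _)).sub
      (AgreeTo.refl _ _)).symm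
  let σ : GaugeMap b := ⟨S, hS0, fun z => (GaugeMap.equivariant_iff S z).2 (heq z)⟩
  refine ⟨σ, eq_of_agreeTo fun N => ?_⟩
  have h1 : AgreeTo N (σ.act G r) ((s N).act G r) :=
    GaugeMap.act_agreeTo G r ((hS N).mono (by omega))
  exact h1.trans ((hs N).mono (by omega))

end Convergence

/-! ### The injection of the moduli space -/

theorem mainTheorem5 {K : Type*} [RCLike K] {g : Type*} [LieRing g] [LieAlgebra K g]
    [FiniteDimensional K g] (l : LieSubalgebra K g) (m : Submodule K g)
    (hlm : IsReductiveDecomposition l m) (G : LieQuasiBialgebra K g)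
    (hϖ : ∀ z ∈ l, G.ϖ z = 0) {d : ℕ} (b : Module.Basis (Fin d) K l) :
    Equivalence (GaugeRel b G) ∧
    ∃ F : ModuliSpace b G → G.variety l m,
      Function.Injective F ∧
      ∀ C : ModuliSpace b G,
        (∃ r : Dynl b G, gaugeClass r = C ∧ IsNormalized l m (r.1 0)) ∧
        ∀ r : Dynl b G, gaugeClass r = C → IsNormalized l m (r.1 0) →
          (F C : Module.Dual K g →ₗ[K] g) = r.1 0 := by
  have hequiv := gaugeRel_equivalence (b := b) G
  refine ⟨hequiv, ?_⟩
  have hrep : ∀ C : ModuliSpace b G, ∃ r : Dynl b G,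
      gaugeClass r = C ∧ IsNormalized l m (r.1 0) := by
    intro C
    obtain ⟨r, rfl⟩ := Quot.exists_rep C
    obtain ⟨σ, hσ⟩ := exists_isNormalized G hlm hϖ r.2
    refine ⟨⟨σ.act G r.1, σ.act_mem_dynl G r.2⟩, ?_, hσ⟩
    exact (Quot.sound ⟨σ, rfl⟩ : gaugeClass r = gaugeClass _).symm
  -- The map is defined by arbitrary normalised representatives; independence of the choice is
  -- invariance of the normalised constant term.
  choose rep hclass hnorm using hrep
  refine ⟨fun C => ⟨(rep C).1 0, mem_variety G hϖ (rep C).2 (hnorm C)⟩, ?_, ?_⟩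
  · intro C C' h
    obtain ⟨σ, hσ⟩ := exists_act_eq hlm G (rep C).2 (rep C').2 (Subtype.ext_iff.1 h)
    rw [← hclass C, ← hclass C']
    exact Quot.sound ⟨σ, hσ.symm⟩
  · refine fun C => ⟨⟨rep C, hclass C, hnorm C⟩, fun r hr hrn => ?_⟩
    -- Equality in the quotient only gives a chain of relations; as the gauge relation is an
    -- equivalence, one gauge transformation suffices.
    obtain ⟨σ, hσ⟩ : GaugeRel b G r (rep C) :=
      hequiv.eqvGen_iff.1 (Quot.eqvGen_exact (hr.trans (hclass C).symm))
    have h := hnorm C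
    rw [hσ] at h
    change (rep C).1 0 = r.1 0
    rw [hσ]
    exact σ.act_coeff_zero_eq G hlm hrn h
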